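/- **Setting.** Let $X=[x_1,\dots,x_q]\in\mathbb R^{n\times q}$ be a deterministic matrix of rank $r\ge 1$, and let $\frac1q XX'=U\bar\Lambda U'$ be a reduced eigenvalue decomposition ($U\in\mathbb R^{n\times r}$ with orthonormal columns, $\bar\Lambda$ an $r\times r$ diagonal matrix). Let $\kappa=\bar\lambda_{\max}/\bar\lambda_{\min}$ be the ratio of the largest to the smallest diagonal entry of $\bar\Lambda$, and $\rho=\max_k\|x_k\|^2\big/\big(\frac1q\sum_k\|x_k\|^2\big)$. *Measurements.* Let $a_{i,k}$ ($1\le i\le m$, $1\le k\le q$) and $a_i^{new}$ ($1\le i\le\tilde m$) be mutually independent real standard Gaussian vectors $\mathcal N(0,I)$ in $\mathbb R^n$. We observe $y_{i,k}=(a_{i,k}'x_k)^2$ and $y^{new}_{i,k}=(a_i^{new\prime}x_k)^2$, together with the measurement vectors. *Algorithm ($r$ known).* The columns of $\hat U\in\mathbb R^{n\times r}$ are orthonormal top $r$ eigenvectors of $$Y_U=\frac1{mq}\sum_{i=1}^m\sum_{k=1}^q y_{i,k}\,a_{i,k}a_{i,k}'\,\mathbb 1\Big\{y_{i,k}\le \tfrac9m\sum_{i'=1}^m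 y_{i',k}\Big\}.$$ For each $k$, let $\hat v_k$ be a unit top eigenvector of $\hat U'\big(\frac1{\tilde m}\sum_i y^{new}_{i,k}a_i^{new}a_i^{new\prime}\big)\hat U$, let $\hat\nu_k=\big(\frac1{\tilde m}\sum_i y_{i,k}^{new}\big)^{1/2}$, and set $\hat x_k=\hat U\hat v_k\hat\nu_k$, $\hat X=[\hat x_1,\dots,\hat x_q]$. *Errors.* $\mathrm{SE}(\hat U,U)=\|(I-\hat U\hat U')U\|$ (spectral norm), $\mathrm{dist}(z,w)=\min(\|z-w\|,\|z+w\|)$ and $\mathrm{NormErr}(X,\hat X)=\sum_k\mathrm{dist}(x_k,\hat x_k)^2/\sum_k\|x_k\|^2$. **Theorem.** For every $c_0>0$ there are constants $c_1,\dots,c_6>0$, depending only on $c_0$, such that the following holds for all $n,q,r,m,\tilde m$, all $X$, $U$ and $\bar\Lambda$ as above and all $0<\varepsilon<1$. Suppose that $r\le c_0n^{1/5}$ and $$\tilde m\ge\frac{c_1\sqrt n}{\varepsilon^2},\qquad m\ge\frac{c_2\,\kappa^2r^4\log n\,(\log\tilde m)^2}{\varepsilon^2},\qquad mq\ge\frac{c_3\,\rho^2\kappa^2\,n\,r^4(\log\tilde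 m)^2}{\varepsilon^2}.$$ Then, with probability at least $1-4\exp(-c_4n)-\frac{32q}{n^4}$, every output of the algorithm (for any choice of the eigenvectors) satisfies 1. $\mathrm{SE}(\hat U,U)\le\dfrac{c_5\,\varepsilon}{r\log\tilde m}$; 2. $\mathrm{dist}(x_k,\hat x_k)^2\le c_6\,\varepsilon\,\|x_k\|^2$ for all $k=1,\dots,q$, and so $\mathrm{NormErr}(X,\hat X)\le c_6\,\varepsilon$. Furthermore, for every $c_7>0$ there is a constant $c_8>0$ (depending only on $c_0,\dots,c_7$) such that, if $q\le c_7n^2$, the same event has probability at least $1-c_8/n^2$. -/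

import Mathlib

namespace LRPR

open MeasureTheory ProbabilityTheory

noncomputable section

/-- The `k`-th column `x_k` of `X`, as a vector of Euclidean space. -/
def column {n q : ℕ} (X : Matrix (Fin n) (Fin q) ℝ) (k : Fin q) : EuclideanSpace ℝ (Fin n) :=
  WithLp.toLp 2 (fun i => X i k)

/-- The rank-one matrix `a a'`. -/
def outer {n : ℕ} (a : EuclideanSpace ℝ (Fin n)) : Matrix (Fin n) (Fin n) ℝ :=
  Matrix.of fun i j => a i * a j

/-- The phaseless measurement `(a' x)²`. -/
def phaseless {n : ℕ} (a x : EuclideanSpace ℝ (Fin n)) : ℝ := (inner ℝ a x) ^ 2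

/-! ### The measurement model -/

/-- All the measurement vectors `a_{i,k}` (`i ≤ m`, `k ≤ q`) and `a_i^new` (`i ≤ m̃`) are mutually
independent, and each is a standard Gaussian vector `N(0, I)` of `ℝⁿ`. -/
structure MeasurementModel {n m mt q : ℕ} {Ω : Type*} [MeasurableSpace Ω] (P : Measure Ω)
    (a : Fin m → Fin q → Ω → EuclideanSpace ℝ (Fin n))
    (anew : Fin mt → Ω → EuclideanSpace ℝ (Fin n)) : Prop where
  law : ∀ i k, HasLaw (a i k) (stdGaussian (EuclideanSpace ℝ (Fin n))) P
  law_new : ∀ i, HasLaw (anew i) (stdGaussian (EuclideanSpace ℝ (Fin n))) P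
  indep : iIndepFun
    (Sum.elim (fun p : Fin m × Fin q => a p.1 p.2) anew :
      (Fin m × Fin q) ⊕ Fin mt → Ω → EuclideanSpace ℝ (Fin n)) P

/-! ### The algorithm -/

/-- The columns of `V` are top `r` eigenvectors of the symmetric matrix `A`: they are the first `r`
columns of the orthogonal matrix `W` of some eigenvalue decomposition `A = W diag(l) W'` whose
eigenvalues `l` are in non-increasing order. -/
def IsTopEigenvectors {n r : ℕ} (A : Matrix (Fin n) (Fin n) ℝ) (V : Matrix (Fin n) (Fin r) ℝ) :
    Prop :=
  ∃ (hr : r ≤ n) (W : Matrix (Fin n) (Fin n) ℝ) (l : Fin n → ℝ),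
    W.transpose * W = 1 ∧ Antitone l ∧ A = W * Matrix.diagonal l * W.transpose ∧
      ∀ i j, V i j = W i (Fin.castLE hr j)

/-- `v` is a (unit norm) top eigenvector of the symmetric matrix `A`. -/
def IsTopEigenvector {n : ℕ} (A : Matrix (Fin n) (Fin n) ℝ) (v : Fin n → ℝ) : Prop :=
  IsTopEigenvectors A (Matrix.of fun i (_ : Fin 1) => v i)

/-- The truncated matrix
`Y_U = (1/(mq)) ∑_i ∑_k y_{i,k} a_{i,k} a_{i,k}' 1{y_{i,k} ≤ 9 (∑_i y_{i,k}) / m}`. -/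
def truncatedMatrix {n m q : ℕ} (a : Fin m → Fin q → EuclideanSpace ℝ (Fin n))
    (y : Fin m → Fin q → ℝ) : Matrix (Fin n) (Fin n) ℝ :=
  (1 / ((m : ℝ) * (q : ℝ))) • ∑ i, ∑ k,
    if y i k ≤ 9 * ((∑ i', y i' k) / (m : ℝ)) then y i k • outer (a i k) else 0

/-- The matrix `Y_{b,k} = Û' ((1/m̃) ∑_i y_{i,k}^new a_i^new a_i^new') Û`; here `y` is the vector
`(y_{i,k}^new)_i`. -/
def projectedMatrix {n r mt : ℕ} (Uhat : Matrix (Fin n) (Fin r) ℝ)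
    (anew : Fin mt → EuclideanSpace ℝ (Fin n)) (y : Fin mt → ℝ) : Matrix (Fin r) (Fin r) ℝ :=
  Uhat.transpose * ((1 / (mt : ℝ)) • ∑ i, y i • outer (anew i)) * Uhat

/-- `Û` (`n × r`) and `X̂` (`n × q`) are a possible output of LRPR-init-theoretical, with known rank
`r`, on the data `a_{i,k}, y_{i,k}` (first set) and `a_i^new, y_{i,k}^new` (second set). It is a
relation since eigenvectors are not unique. -/
def IsOutput {n r m mt q : ℕ} (a : Fin m → Fin q → EuclideanSpace ℝ (Fin n))
    (y : Fin m → Fin q → ℝ) (anew : Fin mt → EuclideanSpace ℝ (Fin n))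
    (ynew : Fin mt → Fin q → ℝ) (Uhat : Matrix (Fin n) (Fin r) ℝ)
    (Xhat : Matrix (Fin n) (Fin q) ℝ) : Prop :=
  IsTopEigenvectors (truncatedMatrix a y) Uhat ∧
    ∀ k, ∃ v : Fin r → ℝ,
      IsTopEigenvector (projectedMatrix Uhat anew (fun i => ynew i k)) v ∧
        (fun i => Xhat i k) =
          Uhat.mulVec (Real.sqrt ((1 / (mt : ℝ)) * ∑ i, ynew i k) • v)

/-! ### The quantities of the guarantee -/

/-- `(1/q) X X' = U diag(lam) U'` is a reduced eigenvalue decomposition: `U` is `n × r` with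
orthonormal columns. For `X` of rank `r`, the entries of `lam` are the nonzero eigenvalues. -/
def IsReducedEVD {n q r : ℕ} (X : Matrix (Fin n) (Fin q) ℝ) (U : Matrix (Fin n) (Fin r) ℝ)
    (lam : Fin r → ℝ) : Prop :=
  U.transpose * U = 1 ∧
    (1 / (q : ℝ)) • (X * X.transpose) = U * Matrix.diagonal lam * U.transpose

/-- `κ = λ_max / λ_min` for the eigenvalues `lam`. -/
def conditionNumber {r : ℕ} (lam : Fin r → ℝ) : ℝ := (⨆ j, lam j) / (⨅ j, lam j)

/-- `ρ = max_k ‖x_k‖² / ((1/q) ∑_k ‖x_k‖²)`. -/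
def rho {n q : ℕ} (X : Matrix (Fin n) (Fin q) ℝ) : ℝ :=
  (⨆ k, ‖column X k‖ ^ 2) / ((1 / (q : ℝ)) * ∑ k, ‖column X k‖ ^ 2)

open scoped Matrix.Norms.L2Operator in
/-- The subspace error `SE(Û, U) = ‖(I - Û Û') U‖`, with the induced `ℓ₂` norm. -/
def subspaceError {n r : ℕ} (Uhat U : Matrix (Fin n) (Fin r) ℝ) : ℝ :=
  ‖(1 - Uhat * Uhat.transpose) * U‖

/-- The phase-invariant distance of two real vectors: the phase is `+1` or `-1`. -/
def phaseDist {n : ℕ} (z w : EuclideanSpace ℝ (Fin n)) : ℝ := min ‖z - w‖ ‖z + w‖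

/-- `NormErr(X, X̂) = ∑_k dist(x_k, x̂_k)² / ∑_k ‖x_k‖²`. -/
def normErr {n q : ℕ} (X Xhat : Matrix (Fin n) (Fin q) ℝ) : ℝ :=
  (∑ k, phaseDist (column X k) (column Xhat k) ^ 2) / ∑ k, ‖column X k‖ ^ 2

end

end LRPR

/-! The two sets of measurements are treated in turn, the second conditionally on the first.

Stage one. With deterministic thresholds `τ ‖x_k‖²`, the summands of the truncated matrix, tested
against a unit vector, are independent, nonnegative and dominated by a constant times a squared
Gaussian. A Bernstein bound and a net of the sphere then make the quadratic form uniformly close to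
its mean (`measure_thresholdMatrix_uniform_le`). That mean is a multiple of the identity plus `γ`
times `(1/q) X X'`, and `γ ≥ 1/3` for `τ = 9` (`truncMoment_gap`). The true thresholds depend on the
data, but the column energies concentrate, so the true matrix is squeezed between those for `9 (1 -
δ)` and `9 (1 + δ)` (`quadratic_truncatedMatrix_close`). A Davis-Kahan argument
(`residual_sq_le_of_quadratic_close`) turns closeness `t` into a subspace error of at most `t / (γ
λ_min - t)`.

Stage two. Given stage one, `Û` is fixed and the new vectors are still independent Gaussians. The
entries of the projected matrix are empirical means of quartic Gaussian polynomials, which need not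
have exponential moments; Markov's inequality for a high fixed moment replaces Bernstein
(`measure_pi_abs_mean_ge_le`). An entry fails with probability of order `(r² / (m̃ ε²)) ^ 44`, and
`m̃ ε² ≳ √n` with `r ≲ n^(1/5)` makes the sum over the `r²` entries of order `n⁻⁴`. The mean is
`‖x‖² I + 2 ξ ξ'` with `ξ = Û' x`, so comparing Rayleigh quotients shows that the top eigenvector is
nearly aligned with `ξ` (`phaseDist_sq_le_of_close`).

Eigenvectors are not unique, and no measurable choice is made. The stage-two failure ranges over all
ordered eigenbases of the first-stage matrix. Compactness of the orthogonal group makes this a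
closed condition on the matrices, hence measurable (`isClosed_exists_isOrderedEigenbasis`). On the
good first-stage event the spectral gap gives all these bases the same top projection
(`IsOrderedEigenbasis.topProj_eq`), so Fubini reduces to one fixed projection. -/

namespace LRPR
open MeasureTheory ProbabilityTheory Real
open scoped NNReal ENNReal

/-! ### Moments of the one-dimensional and of the standard Gaussian. -/

lemma integral_even_pow_gaussianReal (k : ℕ) :
    ∫ x, x ^ (2 * k) ∂(gaussianReal 0 1) = (Nat.doubleFactorial (2 * k - 1) : ℝ) := by
  rw [integral_gaussianReal_eq_integral_smul one_ne_zero]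
  have h1 : ∀ x : ℝ, gaussianPDFReal 0 1 x • x ^ (2 * k) =
      (√(2 * π))⁻¹ * ((fun y : ℝ => y ^ ((2 * k : ℕ) : ℝ) * rexp (-(1 / 2) * y ^ (2 : ℝ))) |x|) := by
    intro x
    simp only [gaussianPDFReal, smul_eq_mul, NNReal.coe_one, sub_zero, rpow_natCast, rpow_two,
      pow_mul, sq_abs, mul_one]
    ring_nf
  simp_rw [h1]
  rw [integral_const_mul, integral_comp_abs (f := fun y : ℝ => y ^ ((2 * k : ℕ) : ℝ) *
      rexp (-(1 / 2) * y ^ (2 : ℝ))),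
    integral_rpow_mul_exp_neg_mul_rpow (by norm_num)
      (lt_of_lt_of_le (by norm_num) (Nat.cast_nonneg _)) (by norm_num)]
  have h2 : (((2 * k : ℕ) : ℝ) + 1) / 2 = k + 1 / 2 := by push_cast; ring
  have h3 : ((1 : ℝ) / 2) ^ (-((2 * k : ℕ) + 1 : ℝ) / 2) = 2 ^ k * √2 := by
    rw [neg_div, h2, rpow_neg (by norm_num), one_div, inv_rpow (by norm_num), inv_inv,
      rpow_add (by norm_num), rpow_natCast, sqrt_eq_rpow]
    norm_num
  rw [h3, h2, Real.Gamma_nat_add_half, sqrt_mul (by norm_num)]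
  have : √2 ≠ 0 := by positivity
  have : √π ≠ 0 := by positivity
  field_simp

lemma integrable_pow_gaussianReal (k : ℕ) : Integrable (fun x : ℝ => x ^ k) (gaussianReal 0 1) := by
  have h : MemLp id (k : ℝ≥0∞) (gaussianReal 0 1) := memLp_id_gaussianReal' _ (by simp)
  have h1 := h.integrable_norm_pow'
  refine (integrable_norm_iff (by fun_prop)).1 ?_
  simpa using h1

lemma integrable_exp_sq_gaussianReal (k : ℕ) :
    Integrable (fun x : ℝ => (x ^ 2 + 1) ^ k * rexp ((x ^ 2 + 1) / 8)) (gaussianReal 0 1) := by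
  rw [gaussianReal_of_var_ne_zero _ one_ne_zero, integrable_withDensity_iff (by fun_prop)
    (ae_of_all _ fun _ => gaussianPDF_lt_top)]
  simp only [toReal_gaussianPDF]
  have h0 := integrable_exp_neg_mul_sq (b := 1 / 8) (by norm_num)
  refine (h0.const_mul ((k.factorial : ℝ) * 8 ^ k * rexp 2)).mono' (by fun_prop) ?_
  filter_upwards with x
  have hpi : (√(2 * π))⁻¹ ≤ 1 := by
    apply inv_le_one_of_one_le₀
    rw [one_le_sqrt]
    linarith [pi_gt_three]
  -- The power costs one more factor `exp ((x² + 1) / 8)`. The two factors together grow like `exp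
  -- (x² / 4)`, which the density `exp (-x² / 2)` still beats.
  have h1 : (x ^ 2 + 1) ^ k ≤ (k.factorial : ℝ) * 8 ^ k * rexp ((x ^ 2 + 1) / 8) := by
    have := pow_div_factorial_le_exp ((x ^ 2 + 1) / 8) (by positivity) k
    rw [div_pow, div_div, div_le_iff₀ (by positivity)] at this
    linarith
  rw [norm_eq_abs, abs_of_nonneg (by have := gaussianPDFReal_nonneg 0 1 x; positivity)]
  simp only [gaussianPDFReal, NNReal.coe_one, sub_zero, mul_one]
  calc (x ^ 2 + 1) ^ k * rexp ((x ^ 2 + 1) / 8) * ((√(2 * π))⁻¹ * rexp (-x ^ 2 / 2))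
      ≤ ((k.factorial : ℝ) * 8 ^ k * rexp ((x ^ 2 + 1) / 8)) * rexp ((x ^ 2 + 1) / 8) *
        (1 * rexp (-x ^ 2 / 2)) := by gcongr
    _ = (k.factorial : ℝ) * 8 ^ k * (rexp ((x ^ 2 + 1) / 8 + (x ^ 2 + 1) / 8 + -x ^ 2 / 2)) := by
        rw [exp_add, exp_add]; ring
    _ ≤ (k.factorial : ℝ) * 8 ^ k * (rexp (2 + -(1 / 8) * x ^ 2)) := by
        refine mul_le_mul_of_nonneg_left (exp_le_exp.2 ?_) (by positivity)
        nlinarith [sq_nonneg x]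
    _ = _ := by rw [exp_add]; ring

section Std
variable {E : Type*} [NormedAddCommGroup E] [InnerProductSpace ℝ E] [FiniteDimensional ℝ E]
  [MeasurableSpace E] [BorelSpace E]

lemma hasLaw_inner_stdGaussian {x : E} (hx : ‖x‖ = 1) :
    HasLaw (fun a => inner ℝ a x) (gaussianReal 0 1) (stdGaussian E) := by
  refine ⟨by fun_prop, ?_⟩
  have h : (fun a : E => inner ℝ a x) = innerSL ℝ x := by
    ext a; simp [real_inner_comm]
  rw [h, IsGaussian.map_eq_gaussianReal, integral_strongDual_stdGaussian,
    variance_dual_stdGaussian]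
  simp [hx]

lemma memLp_inner_stdGaussian (x : E) {p : ℝ≥0∞} (hp : p ≠ ⊤) :
    MemLp (fun a => inner ℝ a x) p (stdGaussian E) := by
  have h : (fun a : E => inner ℝ a x) = innerSL ℝ x := by
    ext a; simp [real_inner_comm]
  rw [h]
  exact IsGaussian.memLp_dual _ _ _ hp

lemma integral_inner_stdGaussian (x : E) : ∫ a, inner ℝ a x ∂(stdGaussian E) = 0 := by
  simpa [real_inner_comm] using integral_strongDual_stdGaussian (E := E) (innerSL ℝ x)

lemma integral_inner_sq_stdGaussian (x : E) : ∫ a, inner ℝ a x ^ 2 ∂(stdGaussian E) = ‖x‖ ^ 2 := by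
  have h := variance_dual_stdGaussian (E := E) (innerSL ℝ x)
  rw [variance_of_integral_eq_zero (by fun_prop) (integral_strongDual_stdGaussian _)] at h
  simpa [real_inner_comm] using h

lemma indepFun_inner_stdGaussian {x h : E} (hxh : inner ℝ x h = 0) :
    IndepFun (fun a => inner ℝ a x) (fun a => inner ℝ a h) (stdGaussian E) := by
  have h1 : HasGaussianLaw (fun a : E => (inner ℝ a x, inner ℝ a h)) (stdGaussian E) := by
    have h2 : HasGaussianLaw (id : E → E) (stdGaussian E) := IsGaussian.hasGaussianLaw_id
    have := h2.map_fun ((innerSL ℝ x).prod (innerSL ℝ h))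
    simpa [real_inner_comm] using this
  apply h1.indepFun_of_covariance_eq_zero
  have h3 := covarianceBilin_apply_eq_cov (μ := stdGaussian E) (by exact IsGaussian.memLp_two_id) x h
  rw [covarianceBilin_stdGaussian] at h3
  rw [show innerSL ℝ x h = 0 from hxh] at h3
  simpa [real_inner_comm] using h3.symm

/-- Split `w = c x + h` with `h ⟂ x`. Then `⟨a, h⟩` is centred and independent of `⟨a, x⟩`, so the
cross term vanishes and `⟨a, h⟩²` contributes its mean `‖w‖² - c²`. -/
lemma integral_comp_inner_mul_inner_sq {φ : ℝ → ℝ} (hφ : Measurable φ) {x : E} (hx : ‖x‖ = 1)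
    (w : E) (h0 : Integrable φ (gaussianReal 0 1))
    (h1 : Integrable (fun g => φ g * g) (gaussianReal 0 1))
    (h2 : Integrable (fun g => φ g * g ^ 2) (gaussianReal 0 1)) :
    ∫ a, φ (inner ℝ a x) * inner ℝ a w ^ 2 ∂(stdGaussian E) =
      (∫ g, φ g * g ^ 2 ∂(gaussianReal 0 1)) * inner ℝ x w ^ 2 +
        (∫ g, φ g ∂(gaussianReal 0 1)) * (‖w‖ ^ 2 - inner ℝ x w ^ 2) := by
  set c := inner ℝ x w with hc
  set h := w - c • x with hh
  have hxh : inner ℝ x h = 0 := by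
    simp [hh, inner_sub_right, inner_smul_right, hx, hc]
  have hnh : ‖h‖ ^ 2 = ‖w‖ ^ 2 - c ^ 2 := by
    rw [hh, norm_sub_sq_real, norm_smul, inner_smul_right, real_inner_comm, ← hc, hx]
    simp; ring
  have hw : ∀ a : E, inner ℝ a w = c * inner ℝ a x + inner ℝ a h := by
    intro a; simp [hh, inner_sub_right, inner_smul_right]
  have hl := hasLaw_inner_stdGaussian hx
  have hI := indepFun_inner_stdGaussian hxh
  have tr : ∀ ψ : ℝ → ℝ, Measurable ψ → Integrable ψ (gaussianReal 0 1) →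
      Integrable (fun a => ψ (inner ℝ a x)) (stdGaussian E) ∧
      ∫ a, ψ (inner ℝ a x) ∂(stdGaussian E) = ∫ g, ψ g ∂(gaussianReal 0 1) := by
    intro ψ hψ hi
    refine ⟨?_, hl.integral_comp hψ.aestronglyMeasurable⟩
    rw [← hl.map_eq] at hi
    exact hi.comp_aemeasurable hl.aemeasurable
  obtain ⟨i0, e0⟩ := tr φ hφ h0
  obtain ⟨i1, e1⟩ := tr (fun g => φ g * g) (by fun_prop) h1
  obtain ⟨i2, e2⟩ := tr (fun g => φ g * g ^ 2) (by fun_prop) h2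
  have ih : Integrable (fun a => inner ℝ a h) (stdGaussian E) :=
    memLp_one_iff_integrable.1 (memLp_inner_stdGaussian h (by simp))
  have ih2 : Integrable (fun a => inner ℝ a h ^ 2) (stdGaussian E) :=
    (memLp_inner_stdGaussian h (by simp)).integrable_sq
  have I1 : IndepFun (fun a => φ (inner ℝ a x) * inner ℝ a x) (fun a => inner ℝ a h)
      (stdGaussian E) := hI.comp (φ := fun g => φ g * g) (ψ := id) (by fun_prop) (by fun_prop)
  have I2 : IndepFun (fun a => φ (inner ℝ a x)) (fun a => inner ℝ a h ^ 2)
      (stdGaussian E) := hI.comp (φ := φ) (ψ := fun y => y ^ 2) (by fun_prop) (by fun_prop)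
  have m1 := I1.integral_fun_mul_eq_mul_integral i1.aestronglyMeasurable ih.aestronglyMeasurable
  have m2 := I2.integral_fun_mul_eq_mul_integral i0.aestronglyMeasurable ih2.aestronglyMeasurable
  have j1 : Integrable (fun a => φ (inner ℝ a x) * inner ℝ a x * inner ℝ a h) (stdGaussian E) := I1.integrable_mul i1 ih
  have j2 : Integrable (fun a => φ (inner ℝ a x) * inner ℝ a h ^ 2) (stdGaussian E) := I2.integrable_mul i0 ih2
  rw [integral_inner_stdGaussian, mul_zero] at m1
  rw [integral_inner_sq_stdGaussian, e0, hnh] at m2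
  have j3 : Integrable (fun a => 2 * c * (φ (inner ℝ a x) * inner ℝ a x * inner ℝ a h) +
      φ (inner ℝ a x) * inner ℝ a h ^ 2) (stdGaussian E) := (j1.const_mul _).add j2
  have : ∀ a : E, φ (inner ℝ a x) * inner ℝ a w ^ 2 =
      c ^ 2 * (φ (inner ℝ a x) * inner ℝ a x ^ 2) +
      (2 * c * (φ (inner ℝ a x) * inner ℝ a x * inner ℝ a h) +
        φ (inner ℝ a x) * inner ℝ a h ^ 2) := by
    intro a; rw [hw]; ring
  simp_rw [this]
  rw [integral_add (i2.const_mul _) j3, integral_add (j1.const_mul _) j2,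
    integral_const_mul, integral_const_mul]
  rw [m1, m2, e2]
  ring

end Std
end LRPR

/-! ### Truncated Gaussian moments and the means of the summands. -/

namespace LRPR
open MeasureTheory ProbabilityTheory Real
open scoped NNReal ENNReal

/-- The truncated Gaussian moment `E[g ^ j 1{g² ≤ τ}]`. -/
noncomputable def truncMoment (j : ℕ) (τ : ℝ) : ℝ :=
  ∫ g, (if g ^ 2 ≤ τ then g ^ j else 0) ∂(gaussianReal 0 1)

lemma measurable_trunc (j : ℕ) (τ : ℝ) :
    Measurable (fun g : ℝ => if g ^ 2 ≤ τ then g ^ j else 0) :=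
  Measurable.ite (measurableSet_le (by fun_prop) (by fun_prop)) (by fun_prop) (by fun_prop)

lemma integrable_trunc (j : ℕ) (τ : ℝ) :
    Integrable (fun g : ℝ => if g ^ 2 ≤ τ then g ^ j else 0) (gaussianReal 0 1) := by
  refine (integrable_pow_gaussianReal j).norm.mono' (measurable_trunc j τ).aestronglyMeasurable ?_
  filter_upwards with g
  split_ifs <;> simp

/-- Pointwise, the truncated `g⁴ - g²` is at least `g⁴ - g² - g⁶ / 9`: beyond `g² = 9` the latter is
negative. The moments `1, 3, 15` then give `3 - 1 - 15 / 9 = 1 / 3`. This constant is the signal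
strength of the spectral step. -/
lemma truncMoment_gap : 1 / 3 ≤ truncMoment 4 9 - truncMoment 2 9 := by
  have h2 := integral_even_pow_gaussianReal 1
  have h4 := integral_even_pow_gaussianReal 2
  have h6 := integral_even_pow_gaussianReal 3
  norm_num [Nat.doubleFactorial] at h2 h4 h6
  have i2 := integrable_pow_gaussianReal 2
  have i4 := integrable_pow_gaussianReal 4
  have i6 := integrable_pow_gaussianReal 6
  have i1 : Integrable (fun g : ℝ => g ^ 4 - g ^ 2) (gaussianReal 0 1) := i4.sub i2
  rw [truncMoment, truncMoment, ← integral_sub (integrable_trunc _ _) (integrable_trunc _ _)]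
  have : (1 : ℝ) / 3 = ∫ g : ℝ, (g ^ 4 - g ^ 2) - g ^ 6 / 9 ∂(gaussianReal 0 1) := by
    rw [integral_sub i1 (i6.div_const 9), integral_sub i4 i2, integral_div, h2, h4, h6]
    norm_num
  rw [this]
  refine integral_mono (i1.sub (i6.div_const 9))
    ((integrable_trunc _ _).sub (integrable_trunc _ _)) fun g => ?_
  have h0 : 0 ≤ g ^ 4 := by positivity
  simp only
  split_ifs with h
  · have : 0 ≤ g ^ 6 := by positivity
    linarith
  · have : 9 * g ^ 4 ≤ g ^ 6 := by nlinarith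
    nlinarith [sq_nonneg g]

lemma gaussianReal_real_le_volume {s : Set ℝ} (hf : volume s ≠ ⊤) :
    (gaussianReal 0 1).real s ≤ volume.real s := by
  refine ENNReal.toReal_mono hf ?_
  rw [gaussianReal_apply _ one_ne_zero]
  calc ∫⁻ x in s, gaussianPDF 0 1 x ≤ ∫⁻ x in s, 1 := by
        refine lintegral_mono fun x => ?_
        rw [gaussianPDF, ENNReal.ofReal_le_one, gaussianPDFReal]
        refine mul_le_one₀ ?_ (exp_pos _).le ?_
        · apply inv_le_one_of_one_le₀
          rw [one_le_sqrt]
          simp only [NNReal.coe_one]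
          linarith [pi_gt_three]
        · rw [exp_le_one_iff]
          apply div_nonpos_of_nonpos_of_nonneg
          · linarith [sq_nonneg (x - 0)]
          · positivity
    _ = volume s := by simp

lemma gaussianReal_real_sq_Ioc_le {a b : ℝ} (ha : 0 ≤ a) (hab : a ≤ b) (hb : 9 ≤ b) :
    (gaussianReal 0 1).real {g | a < g ^ 2 ∧ g ^ 2 ≤ b} ≤ b - a := by
  have hsab : √a ≤ √b := sqrt_le_sqrt hab
  have hsub : {g : ℝ | a < g ^ 2 ∧ g ^ 2 ≤ b} ⊆ Set.Icc (√a) (√b) ∪ Set.Icc (-√b) (-√a) := by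
    rintro g ⟨h1, h2⟩
    have h3 : √a ≤ |g| := by rw [← sqrt_sq_eq_abs]; exact sqrt_le_sqrt h1.le
    have h4 : |g| ≤ √b := by rw [← sqrt_sq_eq_abs]; exact sqrt_le_sqrt h2
    rcases abs_cases g with ⟨h, -⟩ | ⟨h, -⟩ <;> rw [h] at h3 h4
    · exact Or.inl ⟨h3, h4⟩
    · exact Or.inr ⟨by linarith, by linarith⟩
  have hfin : volume (Set.Icc (√a) (√b) ∪ Set.Icc (-√b) (-√a)) ≠ ⊤ :=
    ((measure_union_le _ _).trans_lt (by simp [Real.volume_Icc])).ne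
  calc (gaussianReal 0 1).real {g | a < g ^ 2 ∧ g ^ 2 ≤ b}
      ≤ (gaussianReal 0 1).real (Set.Icc (√a) (√b) ∪ Set.Icc (-√b) (-√a)) := measureReal_mono hsub
    _ ≤ volume.real (Set.Icc (√a) (√b) ∪ Set.Icc (-√b) (-√a)) :=
        gaussianReal_real_le_volume hfin
    _ ≤ volume.real (Set.Icc (√a) (√b)) + volume.real (Set.Icc (-√b) (-√a)) :=
        measureReal_union_le _ _
    _ = 2 * (√b - √a) := by
        rw [Real.volume_real_Icc_of_le hsab, Real.volume_real_Icc_of_le (by linarith)]; ring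
    -- Since `√a + √b ≥ 2`, the length `2 (√b - √a)` is at most `(√b + √a) (√b - √a)`.
    _ ≤ b - a := by
        have h3 : 3 ≤ √b := by rw [le_sqrt' (by norm_num)]; linarith
        nlinarith [sq_sqrt ha, sq_sqrt (ha.trans hab), sqrt_nonneg a]

/-- Lipschitz dependence on the threshold, needed to pass from `9 (1 ± δ)` back to `9`. The constant
is `18²`, a bound for `g ^ j` when `g² ≤ 18` and `j ≤ 4` is even. -/
lemma truncMoment_sub_mem {j : ℕ} (hj : Even j) (hj4 : j ≤ 4) {a b : ℝ} (ha : 0 ≤ a) (hab : a ≤ b)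
    (hb : 9 ≤ b) (hb' : b ≤ 18) :
    0 ≤ truncMoment j b - truncMoment j a ∧ truncMoment j b - truncMoment j a ≤ 324 * (b - a) := by
  have hms : MeasurableSet {g : ℝ | a < g ^ 2 ∧ g ^ 2 ≤ b} :=
    (measurableSet_lt (f := fun _ : ℝ => a) (g := fun g => g ^ 2) (by fun_prop) (by fun_prop)).inter
      (measurableSet_le (f := fun g : ℝ => g ^ 2) (g := fun _ => b) (by fun_prop) (by fun_prop))
  rw [truncMoment, truncMoment, ← integral_sub (integrable_trunc _ _) (integrable_trunc _ _)]
  have hpt : ∀ g : ℝ, ((if g ^ 2 ≤ b then g ^ j else 0) - if g ^ 2 ≤ a then g ^ j else 0) =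
      {g : ℝ | a < g ^ 2 ∧ g ^ 2 ≤ b}.indicator (fun g => g ^ j) g := by
    intro g
    by_cases h1 : g ^ 2 ≤ a
    · simp [Set.indicator, h1, h1.trans hab, not_lt.2 h1]
    · by_cases h2 : g ^ 2 ≤ b <;> simp [Set.indicator, h1, h2, not_le.1 h1]
  simp_rw [hpt]
  constructor
  · exact integral_nonneg fun g => Set.indicator_nonneg (fun g _ => hj.pow_nonneg g) g
  · rw [integral_indicator hms]
    have hbd : ∀ g ∈ {g : ℝ | a < g ^ 2 ∧ g ^ 2 ≤ b}, ‖g ^ j‖ ≤ 324 := by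
      rintro g ⟨-, h2⟩
      obtain ⟨k, rfl⟩ := hj.two_dvd
      have hk : k ≤ 2 := by omega
      rw [norm_eq_abs, abs_of_nonneg (hj.pow_nonneg g), pow_mul]
      calc (g ^ 2) ^ k ≤ 18 ^ k := by gcongr; linarith
        _ ≤ 18 ^ 2 := by gcongr; norm_num
        _ = 324 := by norm_num
    calc _ ≤ ‖∫ g in {g : ℝ | a < g ^ 2 ∧ g ^ 2 ≤ b}, g ^ j ∂(gaussianReal 0 1)‖ := le_abs_self _
      _ ≤ 324 * (gaussianReal 0 1).real {g : ℝ | a < g ^ 2 ∧ g ^ 2 ≤ b} :=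
          norm_setIntegral_le_of_norm_le_const (measure_lt_top _ _) hbd
      _ ≤ _ := by gcongr; exact gaussianReal_real_sq_Ioc_le ha hab hb

section Std
variable {E : Type*} [NormedAddCommGroup E] [InnerProductSpace ℝ E] [FiniteDimensional ℝ E]
  [MeasurableSpace E] [BorelSpace E]

/-- The mean of one summand of the first-stage quadratic form. Summed over the columns it produces
the identity part and the `X X'` part of `meanMatrix`. -/
lemma integral_trunc_inner_sq_mul_inner_sq (τ : ℝ) (x w : E) :
    ∫ a, (if inner ℝ a x ^ 2 ≤ τ * ‖x‖ ^ 2 then inner ℝ a x ^ 2 else 0) * inner ℝ a w ^ 2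
      ∂(stdGaussian E) =
      truncMoment 2 τ * (‖x‖ ^ 2 * ‖w‖ ^ 2) +
        (truncMoment 4 τ - truncMoment 2 τ) * inner ℝ x w ^ 2 := by
  rcases eq_or_ne x 0 with rfl | hx
  · simp
  set u : E := ‖x‖⁻¹ • x with hu
  have hx0 : ‖x‖ ≠ 0 := norm_ne_zero_iff.2 hx
  have hu1 : ‖u‖ = 1 := by simp [hu, norm_smul, hx0]
  have hxu : x = ‖x‖ • u := by simp [hu, smul_smul, hx0]
  have hin : ∀ a : E, inner ℝ a x = ‖x‖ * inner ℝ a u := by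
    intro a; conv_lhs => rw [hxu, inner_smul_right]
  have key := integral_comp_inner_mul_inner_sq (measurable_trunc 2 τ) hu1 w
    (integrable_trunc 2 τ)
    ((integrable_trunc 3 τ).congr (ae_of_all _ fun g => by simp only; split_ifs <;> ring))
    ((integrable_trunc 4 τ).congr (ae_of_all _ fun g => by simp only; split_ifs <;> ring))
  have h4 : ∫ g : ℝ, (if g ^ 2 ≤ τ then g ^ 2 else 0) * g ^ 2 ∂(gaussianReal 0 1) =
      truncMoment 4 τ := by
    rw [truncMoment]; congr 1; ext g; split_ifs <;> ring
  rw [h4] at key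
  have hpt : ∀ a : E, (if inner ℝ a x ^ 2 ≤ τ * ‖x‖ ^ 2 then inner ℝ a x ^ 2 else 0) *
      inner ℝ a w ^ 2 = ‖x‖ ^ 2 * ((if inner ℝ a u ^ 2 ≤ τ then inner ℝ a u ^ 2 else 0) *
      inner ℝ a w ^ 2) := by
    intro a
    have : inner ℝ a x ^ 2 ≤ τ * ‖x‖ ^ 2 ↔ inner ℝ a u ^ 2 ≤ τ := by
      rw [hin, mul_pow, mul_comm τ]
      exact mul_le_mul_iff_right₀ (by positivity)
    simp only [this]
    split_ifs
    · rw [hin]; ring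
    · simp
  simp_rw [hpt]
  have hxw : inner ℝ x w = ‖x‖ * inner ℝ u w := by
    conv_lhs => rw [hxu, inner_smul_left]
    simp
  rw [integral_const_mul, key, hxw, show ∫ g : ℝ, (if g ^ 2 ≤ τ then g ^ 2 else 0)
    ∂(gaussianReal 0 1) = truncMoment 2 τ from rfl]
  ring

lemma integral_inner_sq_mul_inner_sq {x : E} (hx : ‖x‖ = 1) (w : E) :
    ∫ a, inner ℝ a x ^ 2 * inner ℝ a w ^ 2 ∂(stdGaussian E) = ‖w‖ ^ 2 + 2 * inner ℝ x w ^ 2 := by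
  have h2 := integral_even_pow_gaussianReal 1
  have h4 := integral_even_pow_gaussianReal 2
  norm_num [Nat.doubleFactorial] at h2 h4
  have := integral_comp_inner_mul_inner_sq (φ := fun g => g ^ 2) (by fun_prop) hx w
    (integrable_pow_gaussianReal 2)
    ((integrable_pow_gaussianReal 3).congr (ae_of_all _ fun g => by ring))
    ((integrable_pow_gaussianReal 4).congr (ae_of_all _ fun g => by ring))
  rw [this, show (fun g : ℝ => g ^ 2 * g ^ 2) = fun g => g ^ 4 by ext; ring, h2, h4]
  ring

end Std
end LRPR

/-! ### A Bernstein inequality for variables dominated by squared Gaussians. -/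

namespace LRPR
open MeasureTheory ProbabilityTheory Real
open scoped NNReal ENNReal

lemma exp_le_one_add_add_sq_mul_exp_abs (x : ℝ) : rexp x ≤ 1 + x + x ^ 2 * rexp |x| := by
  have h := Complex.norm_exp_sub_sum_le_norm_mul_exp (x : ℂ) 2
  have h2 : Complex.exp x - ∑ m ∈ Finset.range 2, (x : ℂ) ^ m / m.factorial =
      ((rexp x - (1 + x) : ℝ) : ℂ) := by
    simp [Finset.sum_range_succ]
  rw [h2, Complex.norm_real, Complex.norm_real, norm_eq_abs, norm_eq_abs, sq_abs] at h
  linarith [le_abs_self (rexp x - (1 + x))]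

/-- A bound for the exponential moments of variables dominated by the square of a Gaussian. -/
noncomputable def expMomentConst : ℝ :=
  1 + ∫ g : ℝ, (g ^ 2 + 1) ^ 2 * rexp ((g ^ 2 + 1) / 8) ∂(gaussianReal 0 1)

lemma one_le_expMomentConst : 1 ≤ expMomentConst := by
  rw [expMomentConst, le_add_iff_nonneg_right]
  exact integral_nonneg fun g => by positivity

section Std
variable {E : Type*} [NormedAddCommGroup E] [InnerProductSpace ℝ E] [FiniteDimensional ℝ E]
  [MeasurableSpace E] [BorelSpace E]

lemma integrable_of_le_inner_sq {f : E → ℝ} {K : ℝ} {w : E} (hf : Measurable f)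
    (h0 : ∀ a, 0 ≤ f a) (h1 : ∀ a, f a ≤ K * inner ℝ a w ^ 2) :
    Integrable f (stdGaussian E) := by
  refine (((memLp_inner_stdGaussian w (by simp)).integrable_sq).const_mul K).mono'
    hf.aestronglyMeasurable (ae_of_all _ fun a => ?_)
  rw [norm_eq_abs, abs_of_nonneg (h0 a)]
  exact h1 a

/-- The centred variable is at most `K (g² + 1)` in absolute value, with `g = ⟨a, w⟩`. In the
second-order expansion of the exponential the linear term integrates to zero, and `|s| K ≤ 1/8`
keeps the remainder below `(s K)²` times the integrand of `expMomentConst`. -/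
lemma exp_moment_centered_le {f : E → ℝ} {K : ℝ} {w : E} (hw : ‖w‖ = 1) (hf : Measurable f)
    (h0 : ∀ a, 0 ≤ f a) (h1 : ∀ a, f a ≤ K * inner ℝ a w ^ 2) (hK : 0 ≤ K) {s : ℝ}
    (hs : |s| * K ≤ 1 / 8) :
    Integrable (fun a => rexp (s * (f a - ∫ b, f b ∂(stdGaussian E)))) (stdGaussian E) ∧
    mgf (fun a => f a - ∫ b, f b ∂(stdGaussian E)) (stdGaussian E) s ≤
      rexp (expMomentConst * (s * K) ^ 2) := by
  set e := ∫ b, f b ∂(stdGaussian E) with he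
  have hfi := integrable_of_le_inner_sq hf h0 h1
  have he0 : 0 ≤ e := integral_nonneg h0
  have heK : e ≤ K := by
    calc e ≤ ∫ a, K * inner ℝ a w ^ 2 ∂(stdGaussian E) :=
          integral_mono hfi ((memLp_inner_stdGaussian w (by simp)).integrable_sq.const_mul K) h1
      _ = K := by rw [integral_const_mul, integral_inner_sq_stdGaussian, hw]; ring
  have hl := hasLaw_inner_stdGaussian hw
  let G : ℝ → ℝ := fun g => (g ^ 2 + 1) ^ 2 * rexp ((g ^ 2 + 1) / 8)
  have hGi : Integrable G (gaussianReal 0 1) := integrable_exp_sq_gaussianReal 2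
  have hGm : Measurable G := by fun_prop
  have hGE : Integrable (fun a => G (inner ℝ a w)) (stdGaussian E) := by
    rw [← hl.map_eq] at hGi
    exact hGi.comp_aemeasurable hl.aemeasurable
  have hGe : ∫ a, G (inner ℝ a w) ∂(stdGaussian E) = expMomentConst - 1 := by
    rw [expMomentConst, add_sub_cancel_left]
    exact hl.integral_comp hGm.aestronglyMeasurable
  have hpt : ∀ a, rexp (s * (f a - e)) ≤
      1 + s * (f a - e) + (s * K) ^ 2 * G (inner ℝ a w) := by
    intro a
    refine (exp_le_one_add_add_sq_mul_exp_abs _).trans ?_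
    have hd : |f a - e| ≤ K * (inner ℝ a w ^ 2 + 1) := by
      rw [abs_le]; constructor <;> nlinarith [h0 a, h1 a, mul_nonneg hK (sq_nonneg (inner ℝ a w))]
    have h3 : |s * (f a - e)| ≤ |s| * K * (inner ℝ a w ^ 2 + 1) := by
      rw [abs_mul, mul_assoc]; gcongr
    have h4 : |s * (f a - e)| ≤ (inner ℝ a w ^ 2 + 1) / 8 := by
      refine h3.trans ?_
      have : 0 ≤ inner ℝ a w ^ 2 + 1 := by positivity
      nlinarith
    have h5 : (s * (f a - e)) ^ 2 ≤ (s * K) ^ 2 * (inner ℝ a w ^ 2 + 1) ^ 2 := by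
      rw [← mul_pow, ← sq_abs]
      refine (pow_le_pow_left₀ (abs_nonneg _) h3 2).trans (le_of_eq ?_)
      rw [mul_pow, mul_pow, sq_abs]
      ring
    have h6 := exp_le_exp.2 h4
    have h7 : 0 ≤ (s * K) ^ 2 * (inner ℝ a w ^ 2 + 1) ^ 2 := by positivity
    have := mul_le_mul h5 h6 (exp_pos _).le h7
    show _ ≤ _ + _ * (_ * _)
    rw [← mul_assoc]
    linarith
  have hfe : Integrable (fun a => s * (f a - e)) (stdGaussian E) :=
    (hfi.sub (integrable_const e)).const_mul s
  have hint : Integrable (fun a => 1 + s * (f a - e) + (s * K) ^ 2 * G (inner ℝ a w))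
      (stdGaussian E) :=
    ((integrable_const 1).add hfe).add
      (hGE.const_mul _)
  have hint1 : Integrable (fun a => 1 + s * (f a - e)) (stdGaussian E) :=
    (integrable_const 1).add hfe
  have hexp : Integrable (fun a => rexp (s * (f a - e))) (stdGaussian E) := by
    refine hint.mono' (by fun_prop) (ae_of_all _ fun a => ?_)
    rw [norm_eq_abs, abs_exp]
    exact hpt a
  refine ⟨hexp, ?_⟩
  calc mgf (fun a => f a - e) (stdGaussian E) s
      ≤ ∫ a, 1 + s * (f a - e) + (s * K) ^ 2 * G (inner ℝ a w) ∂(stdGaussian E) :=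
        integral_mono hexp hint hpt
    _ = 1 + (s * K) ^ 2 * (expMomentConst - 1) := by
        rw [integral_add hint1 (hGE.const_mul _), integral_add (integrable_const 1) hfe, integral_const_mul, integral_const_mul, hGe,
          integral_sub hfi (integrable_const e)]
        simp [← he]
    _ ≤ expMomentConst * (s * K) ^ 2 + 1 := by nlinarith [sq_nonneg (s * K)]
    _ ≤ _ := add_one_le_exp _

/-- Chernoff's bound on both sides. The restriction `t ≤ 1` keeps the exponential parameter in the
range where the moment bound is quadratic. The subset `A` allows sums over a single column `k`
inside the product over all pairs `(i, k)`. -/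
lemma measure_pi_abs_sum_sub_ge_le {ι : Type*} [Fintype ι] {f : ι → E → ℝ} {K : ℝ} {w : ι → E}
    (hw : ∀ i, ‖w i‖ = 1) (hf : ∀ i, Measurable (f i)) (h0 : ∀ i a, 0 ≤ f i a)
    (h1 : ∀ i a, f i a ≤ K * inner ℝ a (w i) ^ 2) (hK : 0 < K) {t : ℝ} (ht : 0 ≤ t) (ht1 : t ≤ 1)
    (A : Finset ι) :
    (Measure.pi fun _ : ι => stdGaussian E).real
      {ω | A.card * (K * t) ≤ |∑ i ∈ A, (f i (ω i) - ∫ b, f i b ∂(stdGaussian E))|} ≤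
      2 * rexp (-(A.card * t ^ 2 / (16 * expMomentConst))) := by
  set P := Measure.pi fun _ : ι => stdGaussian E with hP
  set e : ι → ℝ := fun i => ∫ b, f i b ∂(stdGaussian E) with he
  set C := expMomentConst with hC
  have hC1 : 1 ≤ C := one_le_expMomentConst
  set N : ℝ := (A.card : ℝ) with hN
  let X : ι → (ι → E) → ℝ := fun i ω => f i (ω i) - e i
  have hXm : ∀ i, Measurable (X i) := fun i =>
    ((hf i).comp (measurable_pi_apply i)).sub_const _
  have hind : iIndepFun X P :=
    iIndepFun_pi (X := fun i a => f i a - e i) fun i => ((hf i).sub_const _).aemeasurable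
  have hcomp : ∀ (i : ι) (s : ℝ), |s| * K ≤ 1 / 8 →
      Integrable (fun ω => rexp (s * X i ω)) P ∧ mgf (X i) P s ≤ rexp (C * (s * K) ^ 2) := by
    intro i s hs
    obtain ⟨j1, j2⟩ := exp_moment_centered_le (hw i) (hf i) (h0 i) (h1 i) hK.le hs
    have hmp : MeasurePreserving (Function.eval i) P (stdGaussian E) := measurePreserving_eval _ i
    refine ⟨hmp.integrable_comp_of_integrable j1, ?_⟩
    have : mgf (X i) P s = mgf (fun a => f i a - e i) (stdGaussian E) s := by
      rw [mgf, mgf, ← hmp.map_eq, integral_map hmp.measurable.aemeasurable]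
      have := hf i
      rw [hmp.map_eq]
      fun_prop
    rw [this]; exact j2
  have hsum : ∀ s : ℝ, |s| * K ≤ 1 / 8 →
      Integrable (fun ω => rexp (s * (∑ i ∈ A, X i) ω)) P ∧
      mgf (∑ i ∈ A, X i) P s ≤ rexp (N * (C * (s * K) ^ 2)) := by
    intro s hs
    refine ⟨hind.integrable_exp_mul_sum hXm fun i _ => (hcomp i s hs).1, ?_⟩
    rw [hind.mgf_sum hXm]
    calc ∏ i ∈ A, mgf (X i) P s ≤ ∏ _i ∈ A, rexp (C * (s * K) ^ 2) :=
          Finset.prod_le_prod (fun i _ => mgf_nonneg) fun i _ => (hcomp i s hs).2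
      _ = _ := by
        rw [Finset.prod_const, ← exp_nat_mul]
  -- With this parameter `l K = t / (8 C) ≤ 1/8`, and the exponent is `-N t² / (8 C) + N t² / (64
  -- C)`, below `-N t² / (16 C)`.
  set l : ℝ := t / (8 * C * K) with hl
  have hl0 : 0 ≤ l := by positivity
  have hlK : l * K = t / (8 * C) := by rw [hl]; field_simp
  have hs1 : |l| * K ≤ 1 / 8 := by
    rw [abs_of_nonneg hl0, hlK, div_le_div_iff₀ (by positivity) (by norm_num)]
    nlinarith
  have hs2 : |-l| * K ≤ 1 / 8 := by rwa [abs_neg]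
  have hexpo : -l * (N * (K * t)) + N * (C * (l * K) ^ 2) ≤ -(N * t ^ 2 / (16 * C)) := by
    have h6 : -l * (N * (K * t)) = -(N * t * (l * K)) := by ring
    rw [h6, hlK]
    have hNn : 0 ≤ N := Nat.cast_nonneg _
    have h7 : -(N * t * (t / (8 * C))) + N * (C * (t / (8 * C)) ^ 2) =
        -(N * t ^ 2 / (16 * C)) - 3 * (N * t ^ 2 / (64 * C)) := by field_simp; ring
    rw [h7]
    have : 0 ≤ N * t ^ 2 / (64 * C) := by positivity
    linarith
  obtain ⟨a1, a2⟩ := hsum l hs1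
  obtain ⟨b1, b2⟩ := hsum (-l) hs2
  have up := measure_ge_le_exp_mul_mgf (N * (K * t)) hl0 a1
  have lo := measure_le_le_exp_mul_mgf (-(N * (K * t))) (neg_nonpos.2 hl0) b1
  have up' : P.real {ω | N * (K * t) ≤ (∑ i ∈ A, X i) ω} ≤ rexp (-(N * t ^ 2 / (16 * C))) := by
    refine up.trans ((mul_le_mul_of_nonneg_left a2 (exp_pos _).le).trans ?_)
    rw [← exp_add]
    exact exp_le_exp.2 hexpo
  have lo' : P.real {ω | (∑ i ∈ A, X i) ω ≤ -(N * (K * t))} ≤ rexp (-(N * t ^ 2 / (16 * C))) := by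
    refine lo.trans ((mul_le_mul_of_nonneg_left b2 (exp_pos _).le).trans ?_)
    rw [← exp_add]
    refine exp_le_exp.2 (le_trans (le_of_eq ?_) hexpo)
    ring
  refine (measureReal_mono (μ := P) (s₂ := {ω | N * (K * t) ≤ (∑ i ∈ A, X i) ω} ∪
    {ω | (∑ i ∈ A, X i) ω ≤ -(N * (K * t))}) ?_).trans ((measureReal_union_le _ _).trans
      (by linarith))
  intro ω hω
  have hω : N * (K * t) ≤ |∑ i ∈ A, (f i (ω i) - e i)| := hω
  have hx : (∑ i ∈ A, X i) ω = ∑ i ∈ A, (f i (ω i) - e i) := by simp [X]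
  rcases le_abs.1 hω with h | h
  · left
    rw [Set.mem_ofPred_eq, hx]
    exact h
  · right
    rw [Set.mem_ofPred_eq, hx]
    linarith

end Std
end LRPR

/-! ### Nets of the sphere and quadratic forms. -/

namespace LRPR
open MeasureTheory ProbabilityTheory Real
open scoped NNReal ENNReal

/-- A `1/2`-separated set of unit vectors of maximal cardinality is a net. After scaling by `2`, the
Besicovitch packing bound for `1`-separated points of the ball of radius `2` gives `5 ^ d`. -/
lemma exists_half_net_sphere (E : Type*) [NormedAddCommGroup E] [NormedSpace ℝ E]
    [FiniteDimensional ℝ E] :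
    ∃ N : Finset E, (∀ z ∈ N, ‖z‖ = 1) ∧ N.card ≤ 5 ^ Module.finrank ℝ E ∧
      ∀ w : E, ‖w‖ = 1 → ∃ z ∈ N, ‖w - z‖ < 1 / 2 := by
  classical
  let S : Set ℕ := {k | ∃ N : Finset E, (∀ z ∈ N, ‖z‖ = 1) ∧
    (∀ c ∈ N, ∀ d ∈ N, c ≠ d → 1 / 2 ≤ ‖c - d‖) ∧ N.card = k}
  have hbd : ∀ N : Finset E, (∀ z ∈ N, ‖z‖ = 1) →
      (∀ c ∈ N, ∀ d ∈ N, c ≠ d → 1 / 2 ≤ ‖c - d‖) → N.card ≤ 5 ^ Module.finrank ℝ E := by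
    intro N h1 h2
    have hinj : Function.Injective (fun z : E => (2 : ℝ) • z) :=
      smul_right_injective E (two_ne_zero)
    rw [← Finset.card_image_of_injective N hinj]
    apply Besicovitch.card_le_of_separated
    · intro c hc
      obtain ⟨z, hz, rfl⟩ := Finset.mem_image.1 hc
      simp [norm_smul, h1 z hz]
    · intro c hc d hd hcd
      obtain ⟨z, hz, rfl⟩ := Finset.mem_image.1 hc
      obtain ⟨y, hy, rfl⟩ := Finset.mem_image.1 hd
      have := h2 z hz y hy (fun h => hcd (by rw [h]))
      rw [← smul_sub, norm_smul, norm_ofNat]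
      linarith
  have hSb : BddAbove S := ⟨5 ^ Module.finrank ℝ E, by
    rintro k ⟨N, h1, h2, rfl⟩; exact hbd N h1 h2⟩
  have hSn : S.Nonempty := ⟨0, ∅, by simp, by simp, by simp⟩
  obtain ⟨N, h1, h2, h3⟩ := Nat.sSup_mem hSn hSb
  refine ⟨N, h1, hbd N h1 h2, fun w hw => ?_⟩
  by_contra! hcon
  have hwN : w ∉ N := fun h => by have := hcon w h; simp at this; linarith
  have hmem : N.card + 1 ∈ S := by
    refine ⟨insert w N, ?_, ?_, Finset.card_insert_of_notMem hwN⟩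
    · intro z hz
      rcases Finset.mem_insert.1 hz with rfl | hz
      · exact hw
      · exact h1 z hz
    · intro c hc d hd hcd
      rcases Finset.mem_insert.1 hc with hcw | hcN <;>
        rcases Finset.mem_insert.1 hd with hdw | hdN
      · exact absurd (hcw.trans hdw.symm) hcd
      · rw [hcw]; exact hcon d hdN
      · rw [hdw, norm_sub_rev]; exact hcon c hcN
      · exact h2 c hcN d hdN hcd
  have := le_csSup hSb hmem
  omega

/-- At a maximiser `y` of `|⟨T y, y⟩|`, with maximum `M`, and a net point `z` near `y`, the
difference of the two values is `⟨T (y - z), y + z⟩`. Polarisation bounds this by `(31/32) M`, so `M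
≤ s + (31/32) M`. -/
lemma abs_inner_le_of_half_net {E : Type*} [NormedAddCommGroup E] [InnerProductSpace ℝ E]
    [FiniteDimensional ℝ E] {T : E →L[ℝ] E} (hT : ∀ u v, inner ℝ (T u) v = inner ℝ (T v) u)
    {N : Finset E} (hN : ∀ z ∈ N, ‖z‖ = 1) (hcov : ∀ w : E, ‖w‖ = 1 → ∃ z ∈ N, ‖w - z‖ < 1 / 2)
    {s : ℝ} (hs : ∀ z ∈ N, |inner ℝ (T z) z| ≤ s) {w : E} (hw : ‖w‖ = 1) :
    |inner ℝ (T w) w| ≤ 32 * s := by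
  obtain ⟨y, hy, hmax⟩ := (isCompact_sphere (0 : E) 1).exists_isMaxOn ⟨w, by simp [hw]⟩
    (f := fun w => |inner ℝ (T w) w|) (by fun_prop)
  have hy1 : ‖y‖ = 1 := by simpa using hy
  set M := |inner ℝ (T y) y| with hM
  have hq : ∀ u : E, |inner ℝ (T u) u| ≤ M * ‖u‖ ^ 2 := by
    intro u
    rcases eq_or_ne u 0 with rfl | hu
    · simp
    have hu0 : ‖u‖ ≠ 0 := norm_ne_zero_iff.2 hu
    have h1 : (‖u‖⁻¹ • u) ∈ Metric.sphere (0 : E) 1 := by simp [norm_smul, hu0]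
    have h2 := hmax h1
    simp only [Set.mem_ofPred_eq, map_smul, inner_smul_left, inner_smul_right, conj_trivial] at h2
    rw [← mul_assoc, abs_mul, abs_of_nonneg (by positivity)] at h2
    have h3 : 0 < ‖u‖ ^ 2 := by positivity
    calc |inner ℝ (T u) u| = ‖u‖⁻¹ * ‖u‖⁻¹ * |inner ℝ (T u) u| * ‖u‖ ^ 2 := by field_simp
      _ ≤ M * ‖u‖ ^ 2 := by gcongr
  obtain ⟨z, hz, hyz⟩ := hcov y hy1
  have hz1 := hN z hz
  have hpol : inner ℝ (T y) y - inner ℝ (T z) z = inner ℝ (T (y - z)) (y + z) := by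
    simp only [map_sub, inner_sub_left, inner_add_right]
    rw [hT z y]; ring
  -- The weights `2` and `1/2` balance the short vector `y - z` against `y + z`. With `d = ‖y - z‖ <
  -- 1/2` the two squared norms add up to `8 d² + (4 - d²) / 2 ≤ 31/8`, which is less than `4`.
  have hpol2 : 4 * inner ℝ (T (y - z)) (y + z) =
      inner ℝ (T ((2 : ℝ) • (y - z) + (1 / 2 : ℝ) • (y + z)))
        ((2 : ℝ) • (y - z) + (1 / 2 : ℝ) • (y + z)) -
      inner ℝ (T ((2 : ℝ) • (y - z) - (1 / 2 : ℝ) • (y + z)))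
        ((2 : ℝ) • (y - z) - (1 / 2 : ℝ) • (y + z)) := by
    have := hT (y - z) (y + z)
    generalize y - z = u at *
    generalize y + z = v at *
    simp only [map_add, map_sub, map_smul, inner_add_left, inner_add_right, inner_sub_left,
      inner_sub_right, inner_smul_left, inner_smul_right, conj_trivial]
    rw [this]; ring
  have hpar : ‖(2 : ℝ) • (y - z) + (1 / 2 : ℝ) • (y + z)‖ ^ 2 +
      ‖(2 : ℝ) • (y - z) - (1 / 2 : ℝ) • (y + z)‖ ^ 2 ≤ 31 / 8 := by
    have h1 := parallelogram_law_with_norm ℝ ((2 : ℝ) • (y - z)) ((1 / 2 : ℝ) • (y + z))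
    have h2 := parallelogram_law_with_norm ℝ y z
    rw [norm_smul, norm_smul, norm_of_nonneg (by norm_num : (0 : ℝ) ≤ 2),
      norm_of_nonneg (by norm_num : (0 : ℝ) ≤ 1 / 2)] at h1
    rw [hy1, hz1] at h2
    nlinarith [norm_nonneg (y - z)]
  have hM0 : 0 ≤ M := abs_nonneg _
  have h5 := hq ((2 : ℝ) • (y - z) + (1 / 2 : ℝ) • (y + z))
  have h6 := hq ((2 : ℝ) • (y - z) - (1 / 2 : ℝ) • (y + z))
  have h7 := hs z hz
  have h8 : M ≤ 32 * s := by
    have : M ≤ |inner ℝ (T z) z| + |inner ℝ (T (y - z)) (y + z)| := by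
      rw [hM, ← hpol]
      have := abs_add_le (inner ℝ (T z) z) (inner ℝ (T y) y - inner ℝ (T z) z)
      rwa [add_sub_cancel] at this
    have h9 : 4 * |inner ℝ (T (y - z)) (y + z)| ≤ M * (31 / 8) := by
      have h10 : (4 : ℝ) * |inner ℝ (T (y - z)) (y + z)| = |4 * inner ℝ (T (y - z)) (y + z)| := by
        rw [abs_mul]; norm_num
      rw [h10, hpol2]
      refine (abs_sub _ _).trans ?_
      nlinarith
    linarith
  exact (hmax (by simp [hw])).trans h8

/-! ### Even moments of sums of independent centred variables. -/

/-- In the binomial expansion only the terms of order `0` and `1` in `z` are kept exactly. Each of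
the others contains `z²` times a monomial of degree `2p`, bounded by `s ^ (2p) + z ^ (2p)`, and the
coefficients add up to at most `4 ^ (p + 1)`. -/
lemma add_pow_even_le (p : ℕ) (s z : ℝ) :
    (s + z) ^ (2 * (p + 1)) ≤ s ^ (2 * (p + 1)) + 2 * (p + 1) * (s ^ (2 * p + 1) * z) +
      4 ^ (p + 1) * (s ^ (2 * p) * z ^ 2 + z ^ (2 * (p + 1))) := by
  rw [add_comm s z, add_pow, show 2 * (p + 1) + 1 = (2 * p + 1) + 1 + 1 by ring,
    Finset.sum_range_succ', Finset.sum_range_succ']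
  have hA : 0 ≤ s ^ (2 * p) * z ^ 2 + z ^ (2 * (p + 1)) := by
    rw [pow_mul, pow_mul]; positivity
  have hterm : ∀ m ∈ Finset.range (2 * p + 1), z ^ (m + 1 + 1) * s ^ (2 * (p + 1) - (m + 1 + 1)) *
      ((2 * (p + 1)).choose (m + 1 + 1) : ℝ) ≤ (s ^ (2 * p) * z ^ 2 + z ^ (2 * (p + 1))) *
      ((2 * (p + 1)).choose (m + 1 + 1) : ℝ) := by
    intro m hm
    have hm' : m ≤ 2 * p := by have := Finset.mem_range.1 hm; omega
    refine mul_le_mul_of_nonneg_right ?_ (Nat.cast_nonneg _)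
    rw [show 2 * (p + 1) - (m + 1 + 1) = 2 * p - m by omega]
    have h1 : z ^ m * s ^ (2 * p - m) ≤ s ^ (2 * p) + z ^ (2 * p) := by
      refine (le_abs_self _).trans ?_
      rw [abs_mul, abs_pow, abs_pow]
      have hz : z ^ (2 * p) = |z| ^ (2 * p) := by rw [pow_mul, pow_mul, sq_abs]
      have hs : s ^ (2 * p) = |s| ^ (2 * p) := by rw [pow_mul, pow_mul, sq_abs]
      rw [hz, hs]
      rcases le_total |z| |s| with h | h
      · calc |z| ^ m * |s| ^ (2 * p - m) ≤ |s| ^ m * |s| ^ (2 * p - m) := by gcongr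
          _ = |s| ^ (2 * p) := by rw [← pow_add]; congr 1; omega
          _ ≤ _ := by linarith [pow_nonneg (abs_nonneg z) (2 * p)]
      · calc |z| ^ m * |s| ^ (2 * p - m) ≤ |z| ^ m * |z| ^ (2 * p - m) := by gcongr
          _ = |z| ^ (2 * p) := by rw [← pow_add]; congr 1; omega
          _ ≤ _ := by linarith [pow_nonneg (abs_nonneg s) (2 * p)]
    calc z ^ (m + 1 + 1) * s ^ (2 * p - m) = z ^ 2 * (z ^ m * s ^ (2 * p - m)) := by ring
      _ ≤ z ^ 2 * (s ^ (2 * p) + z ^ (2 * p)) := by gcongr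
      _ = _ := by ring
  have hsum := Finset.sum_le_sum hterm
  rw [← Finset.mul_sum] at hsum
  have hch : ∑ m ∈ Finset.range (2 * p + 1), ((2 * (p + 1)).choose (m + 1 + 1) : ℝ) ≤
      4 ^ (p + 1) := by
    have h := Nat.sum_range_choose (2 * (p + 1))
    rw [show 2 * (p + 1) + 1 = (2 * p + 1) + 1 + 1 by ring, Finset.sum_range_succ',
      Finset.sum_range_succ'] at h
    have h2 : ∑ m ∈ Finset.range (2 * p + 1), (2 * (p + 1)).choose (m + 1 + 1) ≤ 4 ^ (p + 1) := by
      rw [show (4 : ℕ) ^ (p + 1) = 2 ^ (2 * (p + 1)) by rw [pow_mul]; norm_num]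
      omega
    exact_mod_cast h2
  have h3 := hsum.trans (mul_le_mul_of_nonneg_left hch hA)
  simp only [zero_add, pow_zero, pow_one, Nat.choose_zero_right, Nat.choose_one_right, one_mul,
    Nat.sub_zero, Nat.cast_one, mul_one, show 2 * (p + 1) - 1 = 2 * p + 1 by omega]
  push_cast
  linarith

/-- The constant in the bound for the `2p`-th moment of a sum of independent centered variables. -/
noncomputable def momentConst (M : ℝ) : ℕ → ℝ
  | 0 => 1
  | p + 1 => 4 ^ (p + 1) * M * (momentConst M p + 1)

lemma momentConst_nonneg {M : ℝ} (hM : 0 ≤ M) (p : ℕ) : 0 ≤ momentConst M p := by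
  induction p with
  | zero => simp [momentConst]
  | succ p ih => rw [momentConst]; positivity

lemma integrable_pow_of_forall_memLp {Ω : Type*} [MeasurableSpace Ω] {P : Measure Ω}
    {X : Ω → ℝ} (hX : ∀ k : ℕ, MemLp X k P) [IsFiniteMeasure P] (k : ℕ) :
    Integrable (fun ω => X ω ^ k) P := by
  have h := (hX k).integrable_norm_pow'
  have hm := (hX k).aestronglyMeasurable.pow k
  refine (integrable_norm_iff hm).1 (h.congr (ae_of_all _ fun ω => ?_))
  simp

/-- Induction on `p`, and within it on `s`. Adding one variable, the linear term vanishes by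
independence and centring, and the rest involves only the moment of order `2p` of the sum, known
from the outer induction. Hence the growth is `N ^ p` and not `N ^ (2p)`. -/
lemma integral_sum_pow_even_le {Ω : Type*} [MeasurableSpace Ω] {P : Measure Ω}
    [IsProbabilityMeasure P] {ι : Type*} {X : ι → Ω → ℝ} (hind : iIndepFun X P)
    (hX : ∀ i, ∀ k : ℕ, MemLp (X i) k P) (h0 : ∀ i, ∫ ω, X i ω ∂P = 0) {M : ℝ} (hM0 : 0 ≤ M)
    {p : ℕ} (hM : ∀ i, ∀ k ≤ p, ∫ ω, X i ω ^ (2 * k) ∂P ≤ M) (s : Finset ι) :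
    ∫ ω, (∑ i ∈ s, X i ω) ^ (2 * p) ∂P ≤ momentConst M p * (s.card : ℝ) ^ p := by
  classical
  induction p generalizing s with
  | zero => simp [momentConst]
  | succ p ih =>
    have ih' := fun t => ih (fun i k hk => hM i k (by omega)) t
    have hXm : ∀ i, AEMeasurable (X i) P := fun i => (hX i 0).aestronglyMeasurable.aemeasurable
    induction s using Finset.induction_on with
    | empty => simp [momentConst]
    | insert j s hj ihs =>
      set S : Ω → ℝ := fun ω => ∑ i ∈ s, X i ω with hS
      have hSL : ∀ k : ℕ, MemLp S k P := fun k => memLp_finsetSum s fun i _ => hX i k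
      have hSe : (∑ i ∈ s, X i) = S := by ext ω; simp [hS]
      have hIS : IndepFun S (X j) P := by
        rw [← hSe]; exact hind.indepFun_finsetSum_of_notMem₀ hXm hj
      have hSi := integrable_pow_of_forall_memLp hSL
      have hXi := integrable_pow_of_forall_memLp (hX j)
      have I1 : IndepFun (fun ω => S ω ^ (2 * p + 1)) (X j) P :=
        hIS.comp (φ := fun x => x ^ (2 * p + 1)) (ψ := id) (by fun_prop) (by fun_prop)
      have I2 : IndepFun (fun ω => S ω ^ (2 * p)) (fun ω => X j ω ^ 2) P :=
        hIS.comp (φ := fun x => x ^ (2 * p)) (ψ := fun x => x ^ 2) (by fun_prop) (by fun_prop)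
      have hXj1 : Integrable (X j) P := by simpa using hXi 1
      have e1 := I1.integral_fun_mul_eq_mul_integral (hSi _).aestronglyMeasurable
        hXj1.aestronglyMeasurable
      have e2 := I2.integral_fun_mul_eq_mul_integral (hSi _).aestronglyMeasurable
        (hXi 2).aestronglyMeasurable
      have j1 : Integrable (fun ω => S ω ^ (2 * p + 1) * X j ω) P := I1.integrable_mul (hSi _) hXj1
      have j2 : Integrable (fun ω => S ω ^ (2 * p) * X j ω ^ 2) P := I2.integrable_mul (hSi _) (hXi _)
      have j3 : Integrable (fun ω => S ω ^ (2 * (p + 1)) +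
          2 * (p + 1) * (S ω ^ (2 * p + 1) * X j ω)) P := (hSi _).add (j1.const_mul _)
      have j4 : Integrable (fun ω => S ω ^ (2 * p) * X j ω ^ 2 + X j ω ^ (2 * (p + 1))) P :=
        j2.add (hXi _)
      have hSL' : ∀ k : ℕ, MemLp (fun ω => S ω + X j ω) k P := fun k => (hSL k).add (hX j k)
      have hle : ∫ ω, (∑ i ∈ insert j s, X i ω) ^ (2 * (p + 1)) ∂P ≤
          ∫ ω, S ω ^ (2 * (p + 1)) + 2 * (p + 1) * (S ω ^ (2 * p + 1) * X j ω) +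
            4 ^ (p + 1) * (S ω ^ (2 * p) * X j ω ^ 2 + X j ω ^ (2 * (p + 1))) ∂P := by
        simp_rw [Finset.sum_insert hj, add_comm (X j _)]
        exact integral_mono (integrable_pow_of_forall_memLp hSL' _) (j3.add (j4.const_mul _))
          fun ω => add_pow_even_le p (S ω) (X j ω)
      rw [integral_add j3 (j4.const_mul _), integral_add (hSi _) (j1.const_mul _),
        integral_const_mul, integral_const_mul, integral_add j2 (hXi _), e1, e2, h0 j] at hle
      have q1 := ih' s
      have q2 := hM j 1 (by omega)
      have q3 := hM j (p + 1) le_rfl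
      have q0 : 0 ≤ ∫ ω, X j ω ^ 2 ∂P := integral_nonneg fun ω => sq_nonneg _
      have hC := momentConst_nonneg hM0 p
      have q4 : (∫ ω, S ω ^ (2 * p) ∂P) * ∫ ω, X j ω ^ 2 ∂P ≤
          momentConst M p * (s.card : ℝ) ^ p * M :=
        mul_le_mul q1 (by simpa using q2) q0 (by positivity)
      rw [Finset.card_insert_of_notMem hj]
      push_cast
      -- The increment `(N + 1) ^ p` caused by one more variable fits into the step from `N ^ (p +
      -- 1)` to `(N + 1) ^ (p + 1)`.
      have q5 : (s.card : ℝ) ^ (p + 1) + ((s.card : ℝ) + 1) ^ p ≤ ((s.card : ℝ) + 1) ^ (p + 1) := by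
        have : (s.card : ℝ) ^ p ≤ ((s.card : ℝ) + 1) ^ p := by gcongr; linarith
        rw [pow_succ, pow_succ]
        nlinarith [(Nat.cast_nonneg s.card : (0 : ℝ) ≤ s.card)]
      have q6 : momentConst M p * (s.card : ℝ) ^ p * M + M ≤
          M * (momentConst M p + 1) * ((s.card : ℝ) + 1) ^ p := by
        have a1 : (s.card : ℝ) ^ p ≤ ((s.card : ℝ) + 1) ^ p := by gcongr; linarith
        have a2 : (1 : ℝ) ≤ ((s.card : ℝ) + 1) ^ p :=
          one_le_pow₀ (by linarith [(Nat.cast_nonneg s.card : (0 : ℝ) ≤ s.card)])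
        have a3 := mul_le_mul_of_nonneg_left a1 (mul_nonneg hM0 hC)
        have a4 := mul_le_mul_of_nonneg_left a2 hM0
        linarith
      have q7 : 0 ≤ 4 ^ (p + 1) * M * (momentConst M p + 1) := by positivity
      calc _ ≤ _ := hle
        _ ≤ momentConst M (p + 1) * (s.card : ℝ) ^ (p + 1) +
            4 ^ (p + 1) * (M * (momentConst M p + 1) * ((s.card : ℝ) + 1) ^ p) := by
          rw [mul_zero, mul_zero, add_zero]
          gcongr
          linarith
        _ = 4 ^ (p + 1) * M * (momentConst M p + 1) *
            ((s.card : ℝ) ^ (p + 1) + ((s.card : ℝ) + 1) ^ p) := by rw [momentConst]; ring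
        _ ≤ 4 ^ (p + 1) * M * (momentConst M p + 1) * ((s.card : ℝ) + 1) ^ (p + 1) := by gcongr
        _ = _ := by rw [momentConst]

end LRPR

/-! ### Spectral perturbation for matrices close to `b I + γ U diag(lam) U'` in quadratic form. -/

namespace LRPR
open Matrix

lemma dotProduct_mul_diagonal_mul_transpose_mulVec {m n : Type*} [Fintype m] [Fintype n]
    [DecidableEq n] (W : Matrix m n ℝ) (l : n → ℝ) (w z : m → ℝ) :
    w ⬝ᵥ (W * diagonal l * Wᵀ) *ᵥ z = ∑ j, l j * ((Wᵀ *ᵥ w) j * (Wᵀ *ᵥ z) j) := by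
  rw [← mulVec_mulVec, ← mulVec_mulVec, dotProduct_mulVec, ← mulVec_transpose]
  simp only [dotProduct, mulVec_diagonal]
  exact Finset.sum_congr rfl fun j _ => by ring

lemma mulVec_dotProduct_mulVec_of_transpose_mul_self {m n : Type*} [Fintype m] [Fintype n]
    [DecidableEq n] {W : Matrix m n ℝ} (hW : Wᵀ * W = 1) (c d : n → ℝ) :
    (W *ᵥ c) ⬝ᵥ (W *ᵥ d) = c ⬝ᵥ d := by
  rw [dotProduct_mulVec, ← mulVec_transpose, mulVec_mulVec, hW, one_mulVec]

lemma sum_transpose_mulVec_sq {n : Type*} [Fintype n] [DecidableEq n] {W : Matrix n n ℝ}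
    (hW : Wᵀ * W = 1) (w : n → ℝ) : ∑ j, (Wᵀ *ᵥ w) j ^ 2 = w ⬝ᵥ w := by
  have h := mulVec_dotProduct_mulVec_of_transpose_mul_self (W := Wᵀ)
    (by rw [transpose_transpose]; exact mul_eq_one_comm.1 hW) w w
  rw [← h]
  simp [dotProduct, sq]

lemma exists_unit_mulVec_eq_zero {m n : Type*} [Fintype m] [Fintype n]
    (h : Fintype.card m < Fintype.card n) (A : Matrix m n ℝ) :
    ∃ c : n → ℝ, c ⬝ᵥ c = 1 ∧ A *ᵥ c = 0 := by
  have hker : LinearMap.ker A.mulVecLin ≠ ⊥ := by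
    apply LinearMap.ker_ne_bot_of_finrank_lt
    simpa using h
  obtain ⟨c, hc, hc0⟩ := Submodule.exists_mem_ne_zero_of_ne_bot hker
  have hcc : 0 < c ⬝ᵥ c :=
    lt_of_le_of_ne (Finset.sum_nonneg fun i _ => mul_self_nonneg _)
      (Ne.symm (by rwa [Ne, dotProduct_self_eq_zero]))
  refine ⟨(Real.sqrt (c ⬝ᵥ c))⁻¹ • c, ?_, ?_⟩
  · rw [smul_dotProduct, dotProduct_smul, smul_eq_mul, smul_eq_mul, ← mul_assoc, ← mul_inv,
      Real.mul_self_sqrt hcc.le, inv_mul_cancel₀ hcc.ne']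
  · have : A *ᵥ c = 0 := by simpa using hc
    rw [mulVec_smul, this, smul_zero]

/-- The orthogonal projection onto the span of the first `r` columns of `W`. -/
def topProj {n : ℕ} (W : Matrix (Fin n) (Fin n) ℝ) (r : ℕ) : Matrix (Fin n) (Fin n) ℝ :=
  W * diagonal (fun i : Fin n => if (i : ℕ) < r then 1 else 0) * Wᵀ

lemma mul_transpose_eq_topProj {n r : ℕ} (hr : r ≤ n) {W : Matrix (Fin n) (Fin n) ℝ}
    {V : Matrix (Fin n) (Fin r) ℝ} (hV : ∀ i j, V i j = W i (Fin.castLE hr j)) :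
    V * Vᵀ = topProj W r := by
  ext i k
  rw [topProj, mul_apply, mul_apply]
  simp only [transpose_apply, mul_diagonal, mul_ite, mul_one, mul_zero, hV, ite_mul, zero_mul]
  rw [← Finset.sum_filter]
  refine Finset.sum_bij (fun j _ => Fin.castLE hr j) (by simp) ?_ ?_ (by simp)
  · intro a _ b _ h
    simpa [Fin.ext_iff] using h
  · intro b hb
    simp only [Finset.mem_filter, Finset.mem_univ, true_and] at hb
    exact ⟨⟨b, hb⟩, by simp, by ext; simp⟩

lemma transpose_mul_self_of_castLE {n r : ℕ} (hr : r ≤ n) {W : Matrix (Fin n) (Fin n) ℝ}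
    (hW : Wᵀ * W = 1) {V : Matrix (Fin n) (Fin r) ℝ}
    (hV : ∀ i j, V i j = W i (Fin.castLE hr j)) : Vᵀ * V = 1 := by
  ext i j
  have h := congrFun (congrFun hW (Fin.castLE hr i)) (Fin.castLE hr j)
  simp only [mul_apply, transpose_apply, one_apply, hV, Fin.ext_iff, Fin.val_castLE] at h ⊢
  exact h

/-- The matrix `O = W'ᵀ W` intertwines the two diagonal matrices, so `O i j = 0` whenever `l' i ≠ l
j`. The entries joining top and bottom indices vanish, so `O` commutes with the diagonal indicator
of the first `r` indices. -/
lemma topProj_eq_of_gap {n r : ℕ} {W W' : Matrix (Fin n) (Fin n) ℝ} {l l' : Fin n → ℝ}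
    (hW : Wᵀ * W = 1) (hW' : W'ᵀ * W' = 1)
    (h : W * diagonal l * Wᵀ = W' * diagonal l' * W'ᵀ)
    (hne : ∀ i j : Fin n, (i : ℕ) < r → r ≤ (j : ℕ) → l' i ≠ l j ∧ l' j ≠ l i) :
    topProj W r = topProj W' r := by
  set e : Fin n → ℝ := fun i => if (i : ℕ) < r then 1 else 0 with he
  have hWW : W * Wᵀ = 1 := mul_eq_one_comm.1 hW
  have hWW' : W' * W'ᵀ = 1 := mul_eq_one_comm.1 hW'
  set O := W'ᵀ * W with hO
  have h1 : O * diagonal l = diagonal l' * O := by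
    calc O * diagonal l = W'ᵀ * (W * diagonal l * Wᵀ) * W := by
          simp only [hO, Matrix.mul_assoc, hW, Matrix.mul_one]
      _ = (W'ᵀ * W') * diagonal l' * (W'ᵀ * W) := by rw [h]; simp only [Matrix.mul_assoc]
      _ = diagonal l' * O := by rw [hW', Matrix.one_mul]
  have h2 : O * diagonal e = diagonal e * O := by
    ext i j
    have h3 := congrFun (congrFun h1 i) j
    rw [mul_diagonal, diagonal_mul] at h3 ⊢
    by_cases hi : (i : ℕ) < r <;> by_cases hj : (j : ℕ) < r
    · simp [he, hi, hj]
    · have : O i j = 0 := by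
        by_contra h0
        exact (hne i j hi (not_lt.1 hj)).1 (mul_right_cancel₀ h0 (by linarith))
      simp [this]
    · have : O i j = 0 := by
        by_contra h0
        exact (hne j i hj (not_lt.1 hi)).2 (mul_right_cancel₀ h0 (by linarith))
      simp [this]
    · simp [he, hi, hj]
  calc topProj W r = (W' * W'ᵀ) * (W * diagonal e * Wᵀ) := by rw [hWW', Matrix.one_mul]; rfl
    _ = W' * (O * diagonal e) * Wᵀ := by simp only [hO, Matrix.mul_assoc]
    _ = W' * diagonal e * W'ᵀ * (W * Wᵀ) := by rw [h2]; simp only [hO, Matrix.mul_assoc]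
    _ = topProj W' r := by rw [hWW, Matrix.mul_one]; rfl

section Perturbation

variable {n r : ℕ} {A : Matrix (Fin n) (Fin n) ℝ} {W : Matrix (Fin n) (Fin n) ℝ} {l : Fin n → ℝ}
  {U : Matrix (Fin n) (Fin r) ℝ} {lam : Fin r → ℝ} {b γ L t : ℝ}

/-- Courant-Fischer: the first `i + 1 > r` eigenvectors span a space that meets the kernel of `Uᵀ`,
and there the form of the mean is only `b`. -/
lemma eigenvalue_le_of_quadratic_close (hW : Wᵀ * W = 1) (hl : Antitone l)
    (hA : A = W * diagonal l * Wᵀ)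
    (hD : ∀ w : Fin n → ℝ, w ⬝ᵥ w = 1 →
      |w ⬝ᵥ A *ᵥ w - b - γ * (w ⬝ᵥ (U * diagonal lam * Uᵀ) *ᵥ w)| ≤ t)
    (i : Fin n) (hi : r ≤ (i : ℕ)) : l i ≤ b + t := by
  let J := {j : Fin n // j ≤ i}
  have hcard : Fintype.card (Fin r) < Fintype.card J := by
    rw [Fintype.card_fin, Fintype.card_subtype]
    have : (Finset.univ.filter fun j : Fin n => j ≤ i) = Finset.Iic i := by ext; simp
    rw [this, Fin.card_Iic]
    omega
  let WJ : Matrix (Fin n) J ℝ := W.submatrix id Subtype.val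
  have hWJ : WJᵀ * WJ = 1 := by
    ext a c
    have := congrFun (congrFun hW a.1) c.1
    simp only [mul_apply, transpose_apply, one_apply, WJ, submatrix_apply, id] at this ⊢
    rw [this]
    exact if_congr Subtype.ext_iff.symm rfl rfl
  obtain ⟨c, hc1, hc0⟩ := exists_unit_mulVec_eq_zero hcard (Uᵀ * WJ)
  set z := WJ *ᵥ c with hz
  have hz1 : z ⬝ᵥ z = 1 := by rw [hz, mulVec_dotProduct_mulVec_of_transpose_mul_self hWJ, hc1]
  have hUz : Uᵀ *ᵥ z = 0 := by rw [hz, mulVec_mulVec, hc0]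
  have h1 := hD z hz1
  rw [dotProduct_mul_diagonal_mul_transpose_mulVec, hUz] at h1
  simp only [Pi.zero_apply, mul_zero, Finset.sum_const_zero, sub_zero] at h1
  have hWz : ∀ j : Fin n, i < j → (Wᵀ *ᵥ z) j = 0 := by
    intro j hj
    rw [hz, mulVec_mulVec]
    change ∑ k, (Wᵀ * WJ) j k * c k = 0
    refine Finset.sum_eq_zero fun k _ => ?_
    have : (Wᵀ * WJ) j k = 0 := by
      have := congrFun (congrFun hW j) k.1
      rw [one_apply_ne (ne_of_gt (lt_of_le_of_lt k.2 hj))] at this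
      simpa [mul_apply, WJ] using this
    rw [this, zero_mul]
  have h2 : l i ≤ z ⬝ᵥ A *ᵥ z := by
    rw [hA, dotProduct_mul_diagonal_mul_transpose_mulVec]
    calc l i = ∑ j, l i * (Wᵀ *ᵥ z) j ^ 2 := by
          rw [← Finset.mul_sum, sum_transpose_mulVec_sq hW, hz1, mul_one]
      _ ≤ _ := by
          refine Finset.sum_le_sum fun j _ => ?_
          rcases le_or_gt j i with hji | hji
          · rw [← sq]
            exact mul_le_mul_of_nonneg_right (hl hji) (sq_nonneg _)
          · simp [hWz j hji]
  linarith [(abs_le.1 h1).2]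

/-- The dual count: the range of `U` has dimension `r > i`, so it contains a unit vector orthogonal
to the first `i` eigenvectors. -/
lemma le_eigenvalue_of_quadratic_close (hW : Wᵀ * W = 1) (hl : Antitone l)
    (hA : A = W * diagonal l * Wᵀ) (hU : Uᵀ * U = 1) (hγ : 0 ≤ γ) (hL : ∀ j, L ≤ lam j)
    (hD : ∀ w : Fin n → ℝ, w ⬝ᵥ w = 1 →
      |w ⬝ᵥ A *ᵥ w - b - γ * (w ⬝ᵥ (U * diagonal lam * Uᵀ) *ᵥ w)| ≤ t)
    (i : Fin n) (hi : (i : ℕ) < r) : b + γ * L - t ≤ l i := by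
  let J := {j : Fin n // j < i}
  have hcard : Fintype.card J < Fintype.card (Fin r) := by
    rw [Fintype.card_fin, Fintype.card_subtype]
    have : (Finset.univ.filter fun j : Fin n => j < i) = Finset.Iio i := by ext; simp
    rw [this, Fin.card_Iio]
    omega
  let WJ : Matrix (Fin n) J ℝ := W.submatrix id Subtype.val
  obtain ⟨c, hc1, hc0⟩ := exists_unit_mulVec_eq_zero hcard (WJᵀ * U)
  set z := U *ᵥ c with hz
  have hz1 : z ⬝ᵥ z = 1 := by rw [hz, mulVec_dotProduct_mulVec_of_transpose_mul_self hU, hc1]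
  have hWz : ∀ j : Fin n, j < i → (Wᵀ *ᵥ z) j = 0 := by
    intro j hj
    rw [← mulVec_mulVec, ← hz] at hc0
    exact congrFun hc0 ⟨j, hj⟩
  have h1 := hD z hz1
  have hUz : Uᵀ *ᵥ z = c := by rw [hz, mulVec_mulVec, hU, one_mulVec]
  rw [dotProduct_mul_diagonal_mul_transpose_mulVec U, hUz] at h1
  have h3 : L ≤ ∑ j, lam j * (c j * c j) := by
    calc L = ∑ j, L * (c j * c j) := by
          rw [← Finset.mul_sum]; change L = L * (c ⬝ᵥ c); rw [hc1, mul_one]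
      _ ≤ _ := Finset.sum_le_sum fun j _ =>
          mul_le_mul_of_nonneg_right (hL j) (mul_self_nonneg _)
  have h2 : z ⬝ᵥ A *ᵥ z ≤ l i := by
    rw [hA, dotProduct_mul_diagonal_mul_transpose_mulVec]
    calc _ ≤ ∑ j, l i * (Wᵀ *ᵥ z) j ^ 2 := by
          refine Finset.sum_le_sum fun j _ => ?_
          rcases le_or_gt i j with hji | hji
          · rw [← sq]
            exact mul_le_mul_of_nonneg_right (hl hji) (sq_nonneg _)
          · simp [hWz j hji]
      _ = l i := by rw [← Finset.mul_sum, sum_transpose_mulVec_sq hW, hz1, mul_one]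
  have := mul_le_mul_of_nonneg_left h3 hγ
  linarith [(abs_le.1 h1).1]

/-- Polarisation with `α p ± u`. The free weight `α` makes this a Cauchy-Schwarz type bound without
square roots. -/
lemma two_mul_abs_dotProduct_mulVec_le {n : Type*} [Fintype n] {D : Matrix n n ℝ} (hDs : Dᵀ = D)
    {t : ℝ} (hD : ∀ w : n → ℝ, |w ⬝ᵥ D *ᵥ w| ≤ t * (w ⬝ᵥ w)) {α : ℝ} (hα : 0 < α) (p u : n → ℝ) :
    2 * |p ⬝ᵥ D *ᵥ u| ≤ t * (α * (p ⬝ᵥ p) + α⁻¹ * (u ⬝ᵥ u)) := by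
  have hsym : u ⬝ᵥ D *ᵥ p = p ⬝ᵥ D *ᵥ u := by
    rw [dotProduct_mulVec, ← mulVec_transpose, hDs, dotProduct_comm]
  have hpu : u ⬝ᵥ p = p ⬝ᵥ u := dotProduct_comm _ _
  have h1 := hD (α • p + u)
  have h2 := hD (α • p - u)
  simp only [mulVec_add, mulVec_sub, mulVec_smul, dotProduct_add, add_dotProduct, dotProduct_sub,
    sub_dotProduct, smul_dotProduct, dotProduct_smul, smul_eq_mul, hsym, hpu] at h1 h2
  have h3 : 4 * (α * |p ⬝ᵥ D *ᵥ u|) ≤ t * (2 * (α * (α * (p ⬝ᵥ p))) + 2 * (u ⬝ᵥ u)) := by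
    have : 4 * (α * |p ⬝ᵥ D *ᵥ u|) = |4 * (α * (p ⬝ᵥ D *ᵥ u))| := by
      rw [abs_mul, abs_mul, abs_of_pos hα]; norm_num
    rw [this]
    rw [abs_le] at h1 h2 ⊢
    constructor <;> nlinarith [h1.1, h1.2, h2.1, h2.2]
  have h4 : t * (α * (p ⬝ᵥ p) + α⁻¹ * (u ⬝ᵥ u)) =
      α⁻¹ * (t * (α * (α * (p ⬝ᵥ p)) + u ⬝ᵥ u)) := by field_simp
  rw [h4, ← mul_le_mul_iff_right₀ hα, mul_inv_cancel_left₀ hα.ne']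
  linarith

lemma dotProduct_mulVec_le_of_eigenvectors {ι : Type*} [Fintype ι] [DecidableEq ι]
    {G : Matrix ι ι ℝ} (hG : Gᵀ = G)
    {c : ℝ} (h : ∀ (v : ι → ℝ) (μ : ℝ), v ⬝ᵥ v = 1 → G *ᵥ v = μ • v → μ ≤ c) (v : ι → ℝ) :
    v ⬝ᵥ G *ᵥ v ≤ c * (v ⬝ᵥ v) := by
  have hH : G.IsHermitian := by rw [IsHermitian, conjTranspose_eq_transpose_of_trivial, hG]
  set Q : Matrix ι ι ℝ := (hH.eigenvectorUnitary : Matrix ι ι ℝ) with hQ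
  have hQ1 : Qᵀ * Q = 1 := by
    have := (Matrix.mem_unitaryGroup_iff').1 hH.eigenvectorUnitary.2
    rwa [star_eq_conjTranspose, conjTranspose_eq_transpose_of_trivial] at this
  have hQ2 : Q * Qᵀ = 1 := mul_eq_one_comm.1 hQ1
  have hsp : G = Q * diagonal hH.eigenvalues * Qᵀ := by
    have h1 := hH.spectral_theorem
    rw [Unitary.conjStarAlgAut_apply] at h1
    simpa [star_eq_conjTranspose] using h1
  have hev : ∀ j, hH.eigenvalues j ≤ c := by
    intro j
    refine h (Q *ᵥ Pi.single j 1) _ ?_ ?_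
    · rw [mulVec_dotProduct_mulVec_of_transpose_mul_self hQ1]; simp
    · conv_lhs => rw [hsp]
      rw [← mulVec_mulVec, ← mulVec_mulVec, mulVec_mulVec _ Qᵀ, hQ1, one_mulVec, ← mulVec_smul]
      congr 1
      ext k
      by_cases hk : k = j <;> simp [mulVec_diagonal, hk]
  conv_lhs => rw [hsp]
  rw [dotProduct_mul_diagonal_mul_transpose_mulVec, ← sum_transpose_mulVec_sq hQ1, Finset.mul_sum]
  exact Finset.sum_le_sum fun j _ => by
    rw [← sq]; exact mul_le_mul_of_nonneg_right (hev j) (sq_nonneg _)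

/-- A Davis-Kahan bound. The residual is the form of `G = Uᵀ Q U`, `Q` being the projection off the
top eigenspace, so it suffices to bound an eigenvalue `μ` of `G`. For its eigenvector `v` put `u = U
v` and `p = Q u`; then `p·p = p·u = μ` and `Uᵀ p = μ v`. As `A` commutes with `Q`, `p·Au = p·Ap ≤ (b
+ t) μ`, whereas the mean gives at least `(b + γ L) μ`. The deviation `D` thus satisfies `|p·Du| ≥
(γ L - t) μ`, and its quadratic bound `t` limits `μ`. -/
lemma residual_sq_le_of_quadratic_close (hW : Wᵀ * W = 1) (hl : Antitone l)
    (hA : A = W * diagonal l * Wᵀ) (hU : Uᵀ * U = 1) (hγ : 0 ≤ γ) (hL : ∀ j, L ≤ lam j)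
    (ht : 0 < t) (hgap : t < γ * L)
    (hD : ∀ w : Fin n → ℝ, w ⬝ᵥ w = 1 →
      |w ⬝ᵥ A *ᵥ w - b - γ * (w ⬝ᵥ (U * diagonal lam * Uᵀ) *ᵥ w)| ≤ t) (v : Fin r → ℝ) :
    (((1 - topProj W r) * U) *ᵥ v) ⬝ᵥ (((1 - topProj W r) * U) *ᵥ v) ≤
      (t / (γ * L - t)) ^ 2 * (v ⬝ᵥ v) := by
  set c := γ * L - t with hc
  have hc0 : 0 < c := by rw [hc]; linarith
  have hWW : W * Wᵀ = 1 := mul_eq_one_comm.1 hW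
  set e : Fin n → ℝ := fun i => if (i : ℕ) < r then 0 else 1 with he
  set Q := 1 - topProj W r with hQ
  have hQe : Q = W * diagonal e * Wᵀ := by
    have h1 : diagonal e + diagonal (fun i : Fin n => if (i : ℕ) < r then (1 : ℝ) else 0) = 1 := by
      rw [diagonal_add, ← diagonal_one]
      congr 1; ext i
      by_cases hi : (i : ℕ) < r <;> simp [he, hi]
    have h2 : W * diagonal e * Wᵀ + topProj W r = 1 := by
      rw [topProj, ← Matrix.add_mul, ← Matrix.mul_add, h1, Matrix.mul_one, hWW]
    rw [hQ, ← h2, add_sub_cancel_right]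
  have hQt : Qᵀ = Q := by
    rw [hQe]; simp [Matrix.mul_assoc]
  have hee : diagonal e * diagonal e = diagonal e := by
    rw [diagonal_mul_diagonal]; congr 1; ext i; by_cases hi : (i : ℕ) < r <;> simp [he, hi]
  have hQQ : Q * Q = Q := by
    calc Q * Q = W * diagonal e * (Wᵀ * W) * diagonal e * Wᵀ := by
          rw [hQe]; simp only [Matrix.mul_assoc]
      _ = W * (diagonal e * diagonal e) * Wᵀ := by rw [hW]; simp only [Matrix.mul_assoc, Matrix.one_mul]
      _ = Q := by rw [hee, hQe]
  have hQA : Q * A = A * Q := by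
    calc Q * A = W * diagonal e * (Wᵀ * W) * diagonal l * Wᵀ := by
          rw [hQe, hA]; simp only [Matrix.mul_assoc]
      _ = W * (diagonal e * diagonal l) * Wᵀ := by rw [hW]; simp only [Matrix.mul_assoc, Matrix.one_mul]
      _ = W * (diagonal l * diagonal e) * Wᵀ := by
          rw [diagonal_mul_diagonal, diagonal_mul_diagonal]; simp only [mul_comm]
      _ = W * diagonal l * (Wᵀ * W) * diagonal e * Wᵀ := by
          rw [hW]; simp only [Matrix.mul_assoc, Matrix.one_mul]
      _ = A * Q := by rw [hQe, hA]; simp only [Matrix.mul_assoc]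
  set G := Uᵀ * Q * U with hG
  have hGt : Gᵀ = G := by rw [hG]; simp [Matrix.mul_assoc, hQt]
  have hres : ∀ x : Fin r → ℝ, ((Q * U) *ᵥ x) ⬝ᵥ ((Q * U) *ᵥ x) = x ⬝ᵥ G *ᵥ x := by
    intro x
    rw [dotProduct_comm, dotProduct_mulVec, ← mulVec_transpose, mulVec_mulVec, dotProduct_comm,
      transpose_mul, hQt, hG, Matrix.mul_assoc, ← Matrix.mul_assoc Q Q, hQQ, Matrix.mul_assoc]
  rw [hres]
  refine dotProduct_mulVec_le_of_eigenvectors hGt (fun v μ hv hμ => ?_) v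
  set u := U *ᵥ v with hu
  set p := Q *ᵥ u with hp
  have hu1 : u ⬝ᵥ u = 1 := by rw [hu, mulVec_dotProduct_mulVec_of_transpose_mul_self hU, hv]
  have hpU : Uᵀ *ᵥ p = μ • v := by
    rw [hp, hu, mulVec_mulVec, mulVec_mulVec, ← hG, hμ]
  have hpu : p ⬝ᵥ u = μ := by
    rw [hu, dotProduct_mulVec, ← mulVec_transpose, hpU, smul_dotProduct, hv, smul_eq_mul, mul_one]
  have hQp : Q *ᵥ p = p := by rw [hp, mulVec_mulVec, hQQ]
  have hpp : p ⬝ᵥ p = μ := by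
    rw [← hpu]
    conv_lhs => arg 2; rw [hp]
    rw [dotProduct_mulVec, ← mulVec_transpose, hQt, hQp]
  have hpA : p ⬝ᵥ A *ᵥ u = p ⬝ᵥ A *ᵥ p := by
    conv_lhs => rw [← hQp]
    rw [dotProduct_comm, dotProduct_mulVec, ← mulVec_transpose, hQt, mulVec_mulVec, hQA,
      ← mulVec_mulVec, ← hp, dotProduct_comm]
  have hWp : Wᵀ *ᵥ p = fun j => e j * (Wᵀ *ᵥ u) j := by
    rw [hp, hQe, mulVec_mulVec, ← Matrix.mul_assoc, ← Matrix.mul_assoc, hW, Matrix.one_mul,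
      ← mulVec_mulVec]
    ext j
    rw [mulVec_diagonal]
  have hpAp : p ⬝ᵥ A *ᵥ p ≤ (b + t) * μ := by
    rw [← hpp, ← sum_transpose_mulVec_sq hW p, hA, dotProduct_mul_diagonal_mul_transpose_mulVec,
      Finset.mul_sum]
    refine Finset.sum_le_sum fun j _ => ?_
    rw [hWp]
    by_cases hj : (j : ℕ) < r
    · simp [he, hj]
    · rw [← sq]
      exact mul_le_mul_of_nonneg_right
        (eigenvalue_le_of_quadratic_close hW hl hA hD j (not_lt.1 hj)) (sq_nonneg _)
  set D := A - b • (1 : Matrix (Fin n) (Fin n) ℝ) - γ • (U * diagonal lam * Uᵀ) with hDd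
  have hDs : Dᵀ = D := by
    rw [hDd, hA]; simp [Matrix.mul_assoc]
  have hDq : ∀ w z : Fin n → ℝ, w ⬝ᵥ D *ᵥ z =
      w ⬝ᵥ A *ᵥ z - b * (w ⬝ᵥ z) - γ * (w ⬝ᵥ (U * diagonal lam * Uᵀ) *ᵥ z) := by
    intro w z
    simp [hDd, sub_mulVec, smul_mulVec, dotProduct_sub]
  have hDb : ∀ w : Fin n → ℝ, |w ⬝ᵥ D *ᵥ w| ≤ t * (w ⬝ᵥ w) := by
    intro w
    rcases eq_or_ne w 0 with rfl | hw
    · simp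
    have hw0 : 0 < w ⬝ᵥ w := lt_of_le_of_ne (Finset.sum_nonneg fun i _ => mul_self_nonneg _)
      (Ne.symm (by rwa [Ne, dotProduct_self_eq_zero]))
    set s := (Real.sqrt (w ⬝ᵥ w))⁻¹ with hs
    have hss : s * s * (w ⬝ᵥ w) = 1 := by
      rw [hs, ← mul_inv, Real.mul_self_sqrt hw0.le, inv_mul_cancel₀ hw0.ne']
    have hsw : (s • w) ⬝ᵥ (s • w) = 1 := by
      rw [smul_dotProduct, dotProduct_smul, smul_eq_mul, smul_eq_mul, ← mul_assoc, hss]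
    have h2 := hD (s • w) hsw
    have h3 := hDq (s • w) (s • w)
    rw [hsw, mul_one] at h3
    rw [← h3, mulVec_smul, smul_dotProduct, dotProduct_smul, smul_eq_mul, smul_eq_mul,
      ← mul_assoc, abs_mul, abs_of_nonneg (mul_self_nonneg s)] at h2
    calc |w ⬝ᵥ D *ᵥ w| = (s * s * |w ⬝ᵥ D *ᵥ w|) * (w ⬝ᵥ w) := by
          rw [mul_right_comm, hss, one_mul]
      _ ≤ _ := by gcongr
  have hμ0 : 0 ≤ μ := by rw [← hpp]; exact Finset.sum_nonneg fun i _ => mul_self_nonneg _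
  have hS : L * μ ≤ p ⬝ᵥ (U * diagonal lam * Uᵀ) *ᵥ u := by
    rw [dotProduct_mul_diagonal_mul_transpose_mulVec, hpU, hu, mulVec_mulVec, hU, one_mulVec]
    calc L * μ = ∑ j, L * (μ * (v j * v j)) := by
          rw [← Finset.mul_sum, ← Finset.mul_sum]
          change L * μ = L * (μ * (v ⬝ᵥ v)); rw [hv, mul_one]
      _ ≤ _ := by
          refine Finset.sum_le_sum fun j _ => ?_
          rw [Pi.smul_apply, smul_eq_mul, mul_assoc]
          exact mul_le_mul_of_nonneg_right (hL j) (mul_nonneg hμ0 (mul_self_nonneg _))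
  -- With `α = c / t` the bound reads `2 c μ ≤ c μ + t² / c`, so that half of the left side is
  -- absorbed.
  have hα : 0 < c / t := by positivity
  have key := two_mul_abs_dotProduct_mulVec_le hDs hDb hα p u
  rw [hDq, hpA, hpu, hpp, hu1] at key
  have h5 : c * μ ≤ |p ⬝ᵥ A *ᵥ p - b * μ - γ * (p ⬝ᵥ (U * diagonal lam * Uᵀ) *ᵥ u)| := by
    refine le_trans ?_ (neg_le_abs _)
    have := mul_le_mul_of_nonneg_left hS hγ
    rw [hc]; nlinarith
  have h6 : t * (c / t * μ + (c / t)⁻¹ * 1) = c * μ + t ^ 2 / c := by field_simp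
  rw [h6] at key
  have h7 : c * μ ≤ t ^ 2 / c := by linarith
  rw [div_pow, le_div_iff₀ (by positivity)]
  rw [le_div_iff₀ hc0] at h7
  linarith

end Perturbation

lemma IsTopEigenvector.unit_and_max {n : ℕ} {A : Matrix (Fin n) (Fin n) ℝ} {v : Fin n → ℝ}
    (h : IsTopEigenvector A v) :
    v ⬝ᵥ v = 1 ∧ ∀ u : Fin n → ℝ, u ⬝ᵥ u = 1 → u ⬝ᵥ A *ᵥ u ≤ v ⬝ᵥ A *ᵥ v := by
  obtain ⟨hr, W, l, hW, hl, hA, hv⟩ := h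
  set o : Fin n := Fin.castLE hr 0 with ho
  have hvW : v = W *ᵥ Pi.single o 1 := by
    ext i; simpa using hv i 0
  have hWv : Wᵀ *ᵥ v = Pi.single o 1 := by rw [hvW, mulVec_mulVec, hW, one_mulVec]
  refine ⟨?_, fun u hu => ?_⟩
  · rw [hvW, mulVec_dotProduct_mulVec_of_transpose_mul_self hW]; simp
  · rw [hA, dotProduct_mul_diagonal_mul_transpose_mulVec,
      dotProduct_mul_diagonal_mul_transpose_mulVec, hWv]
    calc ∑ j, l j * ((Wᵀ *ᵥ u) j * (Wᵀ *ᵥ u) j) ≤ ∑ j, l o * (Wᵀ *ᵥ u) j ^ 2 := by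
          refine Finset.sum_le_sum fun j _ => ?_
          rw [← sq]
          refine mul_le_mul_of_nonneg_right (hl ?_) (sq_nonneg _)
          rw [Fin.le_def]; simp [ho]
      _ = l o := by rw [← Finset.mul_sum, sum_transpose_mulVec_sq hW, hu, mul_one]
      _ = _ := by simp [Pi.single_apply]

end LRPR

/-! ### Concentration of the first-stage matrix. -/

namespace LRPR
open MeasureTheory ProbabilityTheory Real Matrix

variable {n m q : ℕ}

lemma quadratic_outer (a w : EuclideanSpace ℝ (Fin n)) :
    w.ofLp ⬝ᵥ outer a *ᵥ w.ofLp = inner ℝ a w ^ 2 := by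
  have h : outer a = vecMulVec a.ofLp a.ofLp := by
    ext i j; simp [outer, vecMulVec_apply]
  rw [h, vecMulVec_mulVec, dotProduct_smul, EuclideanSpace.inner_eq_star_dotProduct]
  simp only [op_smul_eq_smul, smul_eq_mul, star_trivial, sq, dotProduct_comm a.ofLp]

lemma quadratic_mul_transpose (X : Matrix (Fin n) (Fin q) ℝ) (w : EuclideanSpace ℝ (Fin n)) :
    w.ofLp ⬝ᵥ (X * Xᵀ) *ᵥ w.ofLp = ∑ k, inner ℝ (column X k) w ^ 2 := by
  rw [← mulVec_mulVec, dotProduct_mulVec, ← mulVec_transpose]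
  refine Finset.sum_congr rfl fun k _ => ?_
  rw [EuclideanSpace.inner_eq_star_dotProduct, ← sq]
  congr 1
  simp [mulVec, dotProduct, column, mul_comm]

/-- The mean squared norm of the columns. -/
noncomputable def meanSq (X : Matrix (Fin n) (Fin q) ℝ) : ℝ := (1 / (q : ℝ)) * ∑ k, ‖column X k‖ ^ 2

/-- The analogue of `truncatedMatrix` with the deterministic thresholds `τ ‖x_k‖²`. -/
noncomputable def thresholdMatrix (X : Matrix (Fin n) (Fin q) ℝ) (τ : ℝ)
    (a : Fin m × Fin q → EuclideanSpace ℝ (Fin n)) : Matrix (Fin n) (Fin n) ℝ :=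
  (1 / ((m : ℝ) * (q : ℝ))) • ∑ p, (if inner ℝ (a p) (column X p.2) ^ 2 ≤ τ * ‖column X p.2‖ ^ 2
    then inner ℝ (a p) (column X p.2) ^ 2 else 0) • outer (a p)

/-- The expectation of `thresholdMatrix`. -/
noncomputable def meanMatrix (X : Matrix (Fin n) (Fin q) ℝ) (τ : ℝ) : Matrix (Fin n) (Fin n) ℝ :=
  (truncMoment 2 τ * meanSq X) • 1 +
    (truncMoment 4 τ - truncMoment 2 τ) • ((1 / (q : ℝ)) • (X * Xᵀ))

lemma quadratic_meanMatrix (X : Matrix (Fin n) (Fin q) ℝ) (τ : ℝ) (w : EuclideanSpace ℝ (Fin n)) :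
    w.ofLp ⬝ᵥ meanMatrix X τ *ᵥ w.ofLp = truncMoment 2 τ * meanSq X * ‖w‖ ^ 2 +
      (truncMoment 4 τ - truncMoment 2 τ) * (w.ofLp ⬝ᵥ ((1 / (q : ℝ)) • (X * Xᵀ)) *ᵥ w.ofLp) := by
  have : w.ofLp ⬝ᵥ w.ofLp = ‖w‖ ^ 2 := by
    rw [← real_inner_self_eq_norm_sq, EuclideanSpace.inner_eq_star_dotProduct]; simp
  simp only [meanMatrix, add_mulVec, dotProduct_add, smul_mulVec, dotProduct_smul, one_mulVec,
    smul_eq_mul, this]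

lemma quadratic_thresholdMatrix (X : Matrix (Fin n) (Fin q) ℝ) (τ : ℝ)
    (a : Fin m × Fin q → EuclideanSpace ℝ (Fin n)) (w : EuclideanSpace ℝ (Fin n)) :
    w.ofLp ⬝ᵥ thresholdMatrix X τ a *ᵥ w.ofLp = (1 / ((m : ℝ) * (q : ℝ))) *
      ∑ p, (if inner ℝ (a p) (column X p.2) ^ 2 ≤ τ * ‖column X p.2‖ ^ 2
        then inner ℝ (a p) (column X p.2) ^ 2 else 0) * inner ℝ (a p) w ^ 2 := by
  simp only [thresholdMatrix, smul_mulVec, dotProduct_smul, sum_mulVec, dotProduct_sum,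
    smul_eq_mul, quadratic_outer]

lemma measurable_trunc_inner (τ : ℝ) (x w : EuclideanSpace ℝ (Fin n)) :
    Measurable (fun a : EuclideanSpace ℝ (Fin n) => (if inner ℝ a x ^ 2 ≤ τ * ‖x‖ ^ 2
      then inner ℝ a x ^ 2 else 0) * inner ℝ a w ^ 2) := by
  have h : Measurable fun a : EuclideanSpace ℝ (Fin n) => inner ℝ a x := by fun_prop
  exact (Measurable.ite (measurableSet_le (h.pow_const 2) measurable_const) (h.pow_const 2)
    measurable_const).mul (by fun_prop)

/-- For `τ ≤ 18` each summand is at most `18 B ⟨a, w⟩²`, so the Bernstein bound applies with `K = 18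
B`. The bound `B` on all columns is where `ρ` will enter. -/
lemma measure_thresholdMatrix_quadratic_ge_le (hm : 0 < m) (hq : 0 < q)
    (X : Matrix (Fin n) (Fin q) ℝ) {τ B : ℝ} (hτ : τ ≤ 18) (hB : 0 < B)
    (hX : ∀ k, ‖column X k‖ ^ 2 ≤ B) {w : EuclideanSpace ℝ (Fin n)} (hw : ‖w‖ = 1) {s : ℝ}
    (hs : 0 ≤ s) (hs1 : s ≤ 1) :
    (Measure.pi fun _ : Fin m × Fin q => stdGaussian (EuclideanSpace ℝ (Fin n))).real
      {a | 18 * B * s ≤ |w.ofLp ⬝ᵥ (thresholdMatrix X τ a - meanMatrix X τ) *ᵥ w.ofLp|} ≤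
      2 * rexp (-(m * q * s ^ 2 / (16 * expMomentConst))) := by
  let f : Fin m × Fin q → EuclideanSpace ℝ (Fin n) → ℝ := fun p a =>
    (if inner ℝ a (column X p.2) ^ 2 ≤ τ * ‖column X p.2‖ ^ 2
        then inner ℝ a (column X p.2) ^ 2 else 0) * inner ℝ a w ^ 2
  have h0 : ∀ p a, 0 ≤ f p a := by
    intro p a
    simp only [f]; split_ifs <;> positivity
  have h1 : ∀ p a, f p a ≤ 18 * B * inner ℝ a w ^ 2 := by
    intro p a
    simp only [f]
    refine mul_le_mul_of_nonneg_right ?_ (sq_nonneg _)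
    split_ifs with h
    · refine h.trans ?_
      have := hX p.2
      nlinarith [sq_nonneg ‖column X p.2‖]
    · positivity
  have hb := measure_pi_abs_sum_sub_ge_le (fun _ => hw) (fun p => measurable_trunc_inner τ _ w) h0 h1
    (by positivity) hs hs1 Finset.univ
  rw [Finset.card_univ, Fintype.card_prod, Fintype.card_fin, Fintype.card_fin] at hb
  push_cast at hb
  refine le_trans (measureReal_mono ?_) hb
  intro a ha
  rw [Set.mem_ofPred_eq] at ha ⊢
  have hmq : (0 : ℝ) < m * q := by positivity
  have hmean : w.ofLp ⬝ᵥ meanMatrix X τ *ᵥ w.ofLp =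
      1 / (m * q : ℝ) * ∑ p : Fin m × Fin q,
        ∫ b, f p b ∂(stdGaussian (EuclideanSpace ℝ (Fin n))) := by
    simp only [f, integral_trunc_inner_sq_mul_inner_sq]
    rw [quadratic_meanMatrix, hw, smul_mulVec, dotProduct_smul, quadratic_mul_transpose,
      Fintype.sum_prod_type]
    simp only [one_pow, mul_one, smul_eq_mul, nsmul_eq_mul, Finset.sum_const, Finset.card_univ,
      Fintype.card_fin, meanSq, Finset.sum_add_distrib, ← Finset.mul_sum]
    have : (m : ℝ) ≠ 0 := by positivity
    have : (q : ℝ) ≠ 0 := by positivity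
    field_simp
  have hdiff : w.ofLp ⬝ᵥ (thresholdMatrix X τ a - meanMatrix X τ) *ᵥ w.ofLp =
      1 / (m * q : ℝ) * ∑ p, (f p (a p) - ∫ b, f p b ∂(stdGaussian (EuclideanSpace ℝ (Fin n)))) := by
    rw [sub_mulVec, dotProduct_sub, quadratic_thresholdMatrix, hmean, Finset.sum_sub_distrib]
    ring
  rw [hdiff, abs_mul, abs_of_pos (by positivity), one_div, inv_mul_eq_div,
    le_div_iff₀ hmq] at ha
  linarith

lemma transpose_outer (a : EuclideanSpace ℝ (Fin n)) : (outer a)ᵀ = outer a := by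
  ext i j; simp [outer, mul_comm]

lemma measure_thresholdMatrix_uniform_le (hm : 0 < m) (hq : 0 < q)
    (X : Matrix (Fin n) (Fin q) ℝ) {τ B : ℝ} (hτ : τ ≤ 18) (hB : 0 < B)
    (hX : ∀ k, ‖column X k‖ ^ 2 ≤ B) {s : ℝ} (hs : 0 ≤ s) (hs1 : s ≤ 1) :
    (Measure.pi fun _ : Fin m × Fin q => stdGaussian (EuclideanSpace ℝ (Fin n))).real
      {a | ∃ w : EuclideanSpace ℝ (Fin n), ‖w‖ = 1 ∧
        32 * (18 * B * s) < |w.ofLp ⬝ᵥ (thresholdMatrix X τ a - meanMatrix X τ) *ᵥ w.ofLp|} ≤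
      5 ^ n * (2 * rexp (-(m * q * s ^ 2 / (16 * expMomentConst)))) := by
  obtain ⟨N, hN1, hN2, hN3⟩ := exists_half_net_sphere (EuclideanSpace ℝ (Fin n))
  rw [finrank_euclideanSpace_fin] at hN2
  set e := 2 * rexp (-(m * q * s ^ 2 / (16 * expMomentConst))) with he
  calc _ ≤ (Measure.pi fun _ : Fin m × Fin q => stdGaussian (EuclideanSpace ℝ (Fin n))).real
        (⋃ z ∈ N, {a | 18 * B * s ≤
          |z.ofLp ⬝ᵥ (thresholdMatrix X τ a - meanMatrix X τ) *ᵥ z.ofLp|}) := by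
        refine measureReal_mono ?_ (measure_ne_top _ _)
        rintro a ⟨w, hw, h⟩
        by_contra hcon
        simp only [Set.mem_iUnion, Set.mem_ofPred_eq, not_exists, not_le] at hcon
        set D := thresholdMatrix X τ a - meanMatrix X τ with hD
        have hDs : Dᵀ = D := by
          simp only [hD, thresholdMatrix, meanMatrix, transpose_sub, transpose_add, transpose_smul,
            transpose_sum, transpose_outer, transpose_one, transpose_mul, transpose_transpose]
        have hin : ∀ u v : EuclideanSpace ℝ (Fin n),
            inner ℝ (toEuclideanCLM (𝕜 := ℝ) D u) v = u.ofLp ⬝ᵥ D *ᵥ v.ofLp := by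
          intro u v
          rw [EuclideanSpace.inner_eq_star_dotProduct, ofLp_toEuclideanCLM, star_trivial,
            dotProduct_mulVec, ← mulVec_transpose, hDs, dotProduct_comm]
        have := abs_inner_le_of_half_net (T := toEuclideanCLM (𝕜 := ℝ) D) (s := 18 * B * s)
          (fun u v => by
            rw [hin, hin, dotProduct_mulVec, ← mulVec_transpose, hDs, dotProduct_comm])
          hN1 hN3 (fun z hz => by rw [hin]; exact (hcon z hz).le) hw
        rw [hin] at this
        linarith
    _ ≤ ∑ z ∈ N, _ := measureReal_biUnion_finset_le _ _
    _ ≤ ∑ _z ∈ N, e := Finset.sum_le_sum fun z hz =>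
        measure_thresholdMatrix_quadratic_ge_le hm hq X hτ hB hX (hN1 z hz) hs hs1
    _ = N.card * e := by rw [Finset.sum_const, nsmul_eq_mul]
    _ ≤ 5 ^ n * e := by
        have : (N.card : ℝ) ≤ 5 ^ n := by exact_mod_cast hN2
        gcongr

lemma measure_abs_mean_phaseless_sub_gt_le (hm : 0 < m) (x : EuclideanSpace ℝ (Fin n)) (k : Fin q)
    {δ : ℝ} (hδ : 0 ≤ δ) (hδ1 : δ ≤ 1) :
    (Measure.pi fun _ : Fin m × Fin q => stdGaussian (EuclideanSpace ℝ (Fin n))).real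
      {a | δ * ‖x‖ ^ 2 < |(∑ i, phaseless (a (i, k)) x) / m - ‖x‖ ^ 2|} ≤
      2 * rexp (-(m * δ ^ 2 / (16 * expMomentConst))) := by
  rcases eq_or_ne x 0 with rfl | hx
  · simp [phaseless]; positivity
  have hx0 : 0 < ‖x‖ := norm_pos_iff.2 hx
  set u := ‖x‖⁻¹ • x with hu
  have hu1 : ‖u‖ = 1 := by simp [hu, norm_smul, hx0.ne']
  have hb := measure_pi_abs_sum_sub_ge_le (ι := Fin m × Fin q) (w := fun _ => u) (K := 1)
    (f := fun _ a => inner ℝ a u ^ 2) (fun _ => hu1) (fun p => by fun_prop)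
    (fun p a => sq_nonneg _) (fun p a => by rw [one_mul]) one_pos hδ hδ1
    (Finset.univ ×ˢ {k})
  simp only [Finset.card_product, Finset.card_univ, Fintype.card_fin, Finset.card_singleton,
    mul_one, one_mul, Finset.sum_product, Finset.sum_singleton, integral_inner_sq_stdGaussian, hu1,
    one_pow] at hb
  refine le_trans (measureReal_mono ?_) hb
  intro a ha
  rw [Set.mem_ofPred_eq] at ha ⊢
  have hm0 : (0 : ℝ) < m := by positivity
  have h1 : (∑ i, phaseless (a (i, k)) x) / m - ‖x‖ ^ 2 =
      (‖x‖ ^ 2 / m) * ∑ i, (inner ℝ (a (i, k)) u ^ 2 - 1) := by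
    have : ∀ i, phaseless (a (i, k)) x = ‖x‖ ^ 2 * inner ℝ (a (i, k)) u ^ 2 := by
      intro i
      rw [phaseless, hu, inner_smul_right]
      field_simp
    simp only [this, ← Finset.mul_sum, Finset.sum_sub_distrib, Finset.sum_const, Finset.card_univ,
      Fintype.card_fin, nsmul_eq_mul, mul_one]
    field_simp
  rw [h1, abs_mul, abs_of_pos (by positivity)] at ha
  have h2 : δ * ‖x‖ ^ 2 = (‖x‖ ^ 2 / m) * (m * δ) := by field_simp
  rw [h2] at ha
  exact (lt_of_mul_lt_mul_left ha (by positivity)).le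

lemma quadratic_truncatedMatrix (X : Matrix (Fin n) (Fin q) ℝ)
    (a : Fin m × Fin q → EuclideanSpace ℝ (Fin n)) (w : EuclideanSpace ℝ (Fin n)) :
    w.ofLp ⬝ᵥ truncatedMatrix (fun i k => a (i, k)) (fun i k => phaseless (a (i, k)) (column X k))
      *ᵥ w.ofLp = (1 / ((m : ℝ) * (q : ℝ))) *
      ∑ p : Fin m × Fin q, (if inner ℝ (a p) (column X p.2) ^ 2 ≤
        9 * ((∑ i', phaseless (a (i', p.2)) (column X p.2)) / m)
        then inner ℝ (a p) (column X p.2) ^ 2 else 0) * inner ℝ (a p) w ^ 2 := by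
  simp only [truncatedMatrix, smul_mulVec, dotProduct_smul, sum_mulVec, dotProduct_sum,
    smul_eq_mul, Fintype.sum_prod_type]
  congr 1
  refine Finset.sum_congr rfl fun i _ => Finset.sum_congr rfl fun k _ => ?_
  rw [← phaseless]
  split_ifs with h
  · rw [smul_mulVec, dotProduct_smul, quadratic_outer, smul_eq_mul]
  · simp

/-- The data-dependent thresholds couple the summands. Since the summands are nonnegative, the form
is monotone in the thresholds and lies between its values for the deterministic `9 (1 - δ)` and `9
(1 + δ)`. -/
lemma quadratic_truncatedMatrix_close (X : Matrix (Fin n) (Fin q) ℝ)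
    (a : Fin m × Fin q → EuclideanSpace ℝ (Fin n)) {δ e : ℝ} (hδ : 0 ≤ δ) (hδ1 : δ ≤ 1)
    (hT : ∀ k, |(∑ i, phaseless (a (i, k)) (column X k)) / m - ‖column X k‖ ^ 2| ≤
      δ * ‖column X k‖ ^ 2) {w : EuclideanSpace ℝ (Fin n)} (hw : ‖w‖ = 1)
    (h1 : |w.ofLp ⬝ᵥ (thresholdMatrix X (9 * (1 - δ)) a - meanMatrix X (9 * (1 - δ))) *ᵥ w.ofLp| ≤ e)
    (h2 : |w.ofLp ⬝ᵥ (thresholdMatrix X (9 * (1 + δ)) a - meanMatrix X (9 * (1 + δ))) *ᵥ w.ofLp| ≤ e) :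
    |w.ofLp ⬝ᵥ (truncatedMatrix (fun i k => a (i, k)) (fun i k => phaseless (a (i, k)) (column X k)))
      *ᵥ w.ofLp - truncMoment 2 9 * meanSq X - (truncMoment 4 9 - truncMoment 2 9) *
        (w.ofLp ⬝ᵥ ((1 / (q : ℝ)) • (X * Xᵀ)) *ᵥ w.ofLp)| ≤ e + 2916 * δ * meanSq X := by
  have hlo : w.ofLp ⬝ᵥ thresholdMatrix X (9 * (1 - δ)) a *ᵥ w.ofLp ≤
      w.ofLp ⬝ᵥ (truncatedMatrix (fun i k => a (i, k))
        (fun i k => phaseless (a (i, k)) (column X k))) *ᵥ w.ofLp := by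
    rw [quadratic_thresholdMatrix, quadratic_truncatedMatrix]
    refine mul_le_mul_of_nonneg_left (Finset.sum_le_sum fun p _ =>
      mul_le_mul_of_nonneg_right ?_ (sq_nonneg _)) (by positivity)
    have := (abs_le.1 (hT p.2)).1
    split_ifs with c1 c2 c2
    · exact le_rfl
    · exact absurd (c1.trans (by linarith)) c2
    · positivity
    · exact le_rfl
  have hup : w.ofLp ⬝ᵥ (truncatedMatrix (fun i k => a (i, k))
        (fun i k => phaseless (a (i, k)) (column X k))) *ᵥ w.ofLp ≤
      w.ofLp ⬝ᵥ thresholdMatrix X (9 * (1 + δ)) a *ᵥ w.ofLp := by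
    rw [quadratic_thresholdMatrix, quadratic_truncatedMatrix]
    refine mul_le_mul_of_nonneg_left (Finset.sum_le_sum fun p _ =>
      mul_le_mul_of_nonneg_right ?_ (sq_nonneg _)) (by positivity)
    have := (abs_le.1 (hT p.2)).2
    split_ifs with c1 c2 c2
    · exact le_rfl
    · exact absurd (c1.trans (by linarith)) c2
    · positivity
    · exact le_rfl
  rw [sub_mulVec, dotProduct_sub, quadratic_meanMatrix, hw] at h1 h2
  set σ := w.ofLp ⬝ᵥ ((1 / (q : ℝ)) • (X * Xᵀ)) *ᵥ w.ofLp with hσ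
  have hσ0 : 0 ≤ σ := by
    rw [hσ, smul_mulVec, dotProduct_smul, quadratic_mul_transpose, smul_eq_mul]
    positivity
  have hσ1 : σ ≤ meanSq X := by
    rw [hσ, smul_mulVec, dotProduct_smul, quadratic_mul_transpose, smul_eq_mul, meanSq]
    refine mul_le_mul_of_nonneg_left (Finset.sum_le_sum fun k _ => ?_) (by positivity)
    have := abs_real_inner_le_norm (column X k) w
    rw [hw, mul_one] at this
    rw [← sq_abs]
    exact pow_le_pow_left₀ (abs_nonneg _) this 2
  obtain ⟨a1, a2⟩ := truncMoment_sub_mem (j := 2) (by decide) (by norm_num) (a := 9 * (1 - δ))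
    (b := 9) (by linarith) (by linarith) le_rfl (by norm_num)
  obtain ⟨a3, a4⟩ := truncMoment_sub_mem (j := 4) (by decide) (by norm_num) (a := 9 * (1 - δ))
    (b := 9) (by linarith) (by linarith) le_rfl (by norm_num)
  obtain ⟨b1, b2⟩ := truncMoment_sub_mem (j := 2) (by decide) (by norm_num) (a := 9)
    (b := 9 * (1 + δ)) (by linarith) (by linarith) (by linarith) (by linarith)
  obtain ⟨b3, b4⟩ := truncMoment_sub_mem (j := 4) (by decide) (by norm_num) (a := 9)
    (b := 9 * (1 + δ)) (by linarith) (by linarith) (by linarith) (by linarith)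
  -- The mean is `(meanSq X - σ)` times the second truncated moment plus `σ` times the fourth. Both
  -- weights are nonnegative, so moving the threshold by `9 δ` costs at most `324 · 9 δ · meanSq X =
  -- 2916 δ meanSq X`.
  have hσ2 : 0 ≤ meanSq X - σ := by linarith
  rw [abs_le] at h1 h2 ⊢
  have p1 := mul_le_mul_of_nonneg_right a2 hσ2
  have p2 := mul_le_mul_of_nonneg_right a4 hσ0
  have p3 := mul_le_mul_of_nonneg_right b2 hσ2
  have p4 := mul_le_mul_of_nonneg_right b4 hσ0
  constructor
  · linarith [h1.1]
  · linarith [h2.2]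

lemma measure_truncatedMatrix_not_close_le (hm : 0 < m) (hq : 0 < q)
    (X : Matrix (Fin n) (Fin q) ℝ) {B : ℝ} (hB : 0 < B)
    (hX : ∀ k, ‖column X k‖ ^ 2 ≤ B) {s δ : ℝ} (hs : 0 ≤ s) (hs1 : s ≤ 1) (hδ : 0 ≤ δ)
    (hδ1 : δ ≤ 1) :
    (Measure.pi fun _ : Fin m × Fin q => stdGaussian (EuclideanSpace ℝ (Fin n))).real
      {a | ¬ ∀ w : EuclideanSpace ℝ (Fin n), ‖w‖ = 1 →
        |w.ofLp ⬝ᵥ (truncatedMatrix (fun i k => a (i, k))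
          (fun i k => phaseless (a (i, k)) (column X k))) *ᵥ w.ofLp -
          truncMoment 2 9 * meanSq X - (truncMoment 4 9 - truncMoment 2 9) *
          (w.ofLp ⬝ᵥ ((1 / (q : ℝ)) • (X * Xᵀ)) *ᵥ w.ofLp)| ≤
          32 * (18 * B * s) + 2916 * δ * meanSq X} ≤
      q * (2 * rexp (-(m * δ ^ 2 / (16 * expMomentConst)))) +
        2 * (5 ^ n * (2 * rexp (-(m * q * s ^ 2 / (16 * expMomentConst))))) := by
  have k1 := measure_thresholdMatrix_uniform_le hm hq X (τ := 9 * (1 - δ)) (by linarith) hB hX hs hs1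
  have k2 := measure_thresholdMatrix_uniform_le hm hq X (τ := 9 * (1 + δ)) (by linarith) hB hX hs hs1
  set P := Measure.pi fun _ : Fin m × Fin q => stdGaussian (EuclideanSpace ℝ (Fin n))
  set T : Fin q → Set (Fin m × Fin q → EuclideanSpace ℝ (Fin n)) := fun k =>
    {a | δ * ‖column X k‖ ^ 2 <
      |(∑ i, phaseless (a (i, k)) (column X k)) / m - ‖column X k‖ ^ 2|} with hTdef
  have k3 : P.real (⋃ k, T k) ≤ q * (2 * rexp (-(m * δ ^ 2 / (16 * expMomentConst)))) := by
    refine (measureReal_iUnion_fintype_le _).trans ?_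
    calc ∑ k, P.real (T k) ≤ ∑ _k : Fin q, 2 * rexp (-(m * δ ^ 2 / (16 * expMomentConst))) :=
          Finset.sum_le_sum fun k _ => measure_abs_mean_phaseless_sub_gt_le hm _ k hδ hδ1
      _ = _ := by simp
  set S1 := {a : Fin m × Fin q → EuclideanSpace ℝ (Fin n) |
    ∃ w : EuclideanSpace ℝ (Fin n), ‖w‖ = 1 ∧ 32 * (18 * B * s) <
      |w.ofLp ⬝ᵥ (thresholdMatrix X (9 * (1 - δ)) a - meanMatrix X (9 * (1 - δ))) *ᵥ w.ofLp|}
  set S2 := {a : Fin m × Fin q → EuclideanSpace ℝ (Fin n) |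
    ∃ w : EuclideanSpace ℝ (Fin n), ‖w‖ = 1 ∧ 32 * (18 * B * s) <
      |w.ofLp ⬝ᵥ (thresholdMatrix X (9 * (1 + δ)) a - meanMatrix X (9 * (1 + δ))) *ᵥ w.ofLp|}
  refine (measureReal_mono (s₂ := (⋃ k, T k) ∪ (S1 ∪ S2)) ?_).trans ?_
  · intro a ha
    by_contra hcon
    simp only [Set.mem_union, Set.mem_iUnion, not_or, not_exists] at hcon
    obtain ⟨c1, c2, c3⟩ := hcon
    refine ha fun w hw => ?_
    refine quadratic_truncatedMatrix_close X a hδ hδ1 (fun k => not_lt.1 (c1 k)) hw ?_ ?_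
    · exact not_lt.1 fun h => c2 ⟨w, hw, h⟩
    · exact not_lt.1 fun h => c3 ⟨w, hw, h⟩
  · refine (measureReal_union_le _ _).trans ?_
    have := measureReal_union_le (μ := P) S1 S2
    linarith

end LRPR

/-! ### Polynomial tails for empirical means of quartic Gaussian expressions. -/

namespace LRPR
open MeasureTheory ProbabilityTheory Real Matrix
open scoped ENNReal

lemma add_four_pow_le {a b c d : ℝ} (ha : 0 ≤ a) (hb : 0 ≤ b) (hc : 0 ≤ c) (hd : 0 ≤ d) (k : ℕ) :
    (a + b + c + d) ^ k ≤ 4 ^ k * (a ^ k + b ^ k + c ^ k + d ^ k) := by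
  have h2 : ∀ x y : ℝ, 0 ≤ x → 0 ≤ y → (x + y) ^ k ≤ 2 ^ k * (x ^ k + y ^ k) := by
    intro x y hx hy
    refine (add_pow_le hx hy k).trans ?_
    gcongr
    · norm_num
    · omega
  calc (a + b + c + d) ^ k = ((a + b) + (c + d)) ^ k := by ring
    _ ≤ 2 ^ k * ((a + b) ^ k + (c + d) ^ k) := h2 _ _ (by positivity) (by positivity)
    _ ≤ 2 ^ k * (2 ^ k * (a ^ k + b ^ k) + 2 ^ k * (c ^ k + d ^ k)) := by
        gcongr
        · exact h2 _ _ ha hb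
        · exact h2 _ _ hc hd
    _ = (2 * 2) ^ k * (a ^ k + b ^ k + c ^ k + d ^ k) := by rw [mul_pow]; ring
    _ = _ := by norm_num

/-- A bound for the moments of order at most `2p` of a quartic expression in Gaussians. -/
noncomputable def quarticMomentConst (p : ℕ) : ℝ :=
  1 + 4 ^ (2 * p) * (3 * ∫ g : ℝ, g ^ (8 * p) ∂(gaussianReal 0 1) + 3 ^ (2 * p))

lemma quarticMomentConst_pos (p : ℕ) : 0 < quarticMomentConst p := by
  have : 0 ≤ ∫ g : ℝ, g ^ (8 * p) ∂(gaussianReal 0 1) :=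
    integral_nonneg fun g => by rw [show 8 * p = 2 * (4 * p) by ring, pow_mul]; positivity
  rw [quarticMomentConst]
  positivity

section Std
variable {E : Type*} [NormedAddCommGroup E] [InnerProductSpace ℝ E] [FiniteDimensional ℝ E]
  [MeasurableSpace E] [BorelSpace E]

lemma integrable_inner_pow (x : E) (k : ℕ) :
    Integrable (fun a => inner ℝ a x ^ k) (stdGaussian E) :=
  integrable_pow_of_forall_memLp (fun k => memLp_inner_stdGaussian x (by simp)) k

lemma integral_inner_pow {x : E} (hx : ‖x‖ = 1) (k : ℕ) :
    ∫ a, inner ℝ a x ^ k ∂(stdGaussian E) = ∫ g : ℝ, g ^ k ∂(gaussianReal 0 1) :=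
  (hasLaw_inner_stdGaussian hx).integral_comp (f := fun g => g ^ k) (by fun_prop)

/-- All orders `2k ≤ 2p` are controlled by one constant through `f ^ (2k) ≤ 1 + |f| ^ (2p)`, whence
the summand `1` in `quarticMomentConst`. -/
lemma memLp_and_integral_pow_le_of_quartic {f : E → ℝ} (hf : Measurable f) {x u w : E}
    (hx : ‖x‖ = 1) (hu : ‖u‖ = 1) (hw : ‖w‖ = 1)
    (hb : ∀ a, |f a| ≤ inner ℝ a x ^ 4 + inner ℝ a u ^ 4 + inner ℝ a w ^ 4 + 3) :
    (∀ k : ℕ, MemLp f k (stdGaussian E)) ∧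
    ∀ p k, k ≤ p → ∫ a, f a ^ (2 * k) ∂(stdGaussian E) ≤ quarticMomentConst p := by
  have hpt : ∀ (k : ℕ) a, |f a| ^ k ≤ 4 ^ k * (inner ℝ a x ^ (4 * k) + inner ℝ a u ^ (4 * k) +
      inner ℝ a w ^ (4 * k) + 3 ^ k) := by
    intro k a
    refine (pow_le_pow_left₀ (abs_nonneg _) (hb a) k).trans ?_
    refine (add_four_pow_le (by positivity) (by positivity) (by positivity) (by norm_num) k).trans ?_
    rw [pow_mul, pow_mul, pow_mul]
  have hint : ∀ k : ℕ, Integrable (fun a => inner ℝ a x ^ (4 * k) + inner ℝ a u ^ (4 * k) +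
      inner ℝ a w ^ (4 * k) + 3 ^ k) (stdGaussian E) := fun k =>
    (((integrable_inner_pow x _).add (integrable_inner_pow u _)).add
      (integrable_inner_pow w _)).add (integrable_const _)
  have hL : ∀ k : ℕ, MemLp f k (stdGaussian E) := by
    intro k
    rcases Nat.eq_zero_or_pos k with rfl | hk
    · rw [Nat.cast_zero, memLp_zero_iff_aestronglyMeasurable]
      exact hf.aestronglyMeasurable
    · rw [← integrable_norm_rpow_iff hf.aestronglyMeasurable (by simp; omega) (by simp)]
      simp only [ENNReal.toReal_natCast, rpow_natCast]
      refine ((hint k).const_mul (4 ^ k)).mono' (by fun_prop) (ae_of_all _ fun a => ?_)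
      rw [norm_pow, norm_norm, norm_eq_abs]
      exact hpt k a
  have h2 : ∀ k : ℕ, Integrable (fun a => inner ℝ a x ^ (4 * k) + inner ℝ a u ^ (4 * k))
      (stdGaussian E) := fun k => (integrable_inner_pow x _).add (integrable_inner_pow u _)
  have h3 : ∀ k : ℕ, Integrable (fun a => inner ℝ a x ^ (4 * k) + inner ℝ a u ^ (4 * k) +
      inner ℝ a w ^ (4 * k)) (stdGaussian E) := fun k => (h2 k).add (integrable_inner_pow w _)
  refine ⟨hL, fun p k hkp => ?_⟩
  calc ∫ a, f a ^ (2 * k) ∂(stdGaussian E)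
      ≤ ∫ a, 1 + 4 ^ (2 * p) * (inner ℝ a x ^ (4 * (2 * p)) + inner ℝ a u ^ (4 * (2 * p)) +
      inner ℝ a w ^ (4 * (2 * p)) + 3 ^ (2 * p)) ∂(stdGaussian E) := by
        refine integral_mono (integrable_pow_of_forall_memLp hL _)
          ((integrable_const 1).add ((hint _).const_mul _)) fun a => ?_
        have h1 := hpt (2 * p) a
        have h2 : f a ^ (2 * k) ≤ 1 + |f a| ^ (2 * p) := by
          rw [pow_mul, pow_mul, sq_abs]
          rcases le_total (f a ^ 2) 1 with h | h
          · have := pow_le_one₀ (n := k) (sq_nonneg (f a)) h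
            have : 0 ≤ (f a ^ 2) ^ p := by positivity
            linarith
          · have := pow_le_pow_right₀ h hkp
            linarith
        show f a ^ (2 * k) ≤ 1 + _
        linarith
    _ = _ := by
        rw [integral_add (integrable_const 1) ((hint _).const_mul _), integral_const_mul,
          integral_add (h3 _) (integrable_const _),
          integral_add (h2 _) (integrable_inner_pow w _),
          integral_add (integrable_inner_pow x _) (integrable_inner_pow u _),
          integral_inner_pow hx, integral_inner_pow hu, integral_inner_pow hw,
          show 4 * (2 * p) = 8 * p by ring, quarticMomentConst]
        simp
        ring

/-- Markov's inequality for the `2p`-th power of the sum: a moment of order `N ^ p` against `(N θ) ^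
(2p)`. -/
lemma measure_pi_abs_mean_ge_le {N : ℕ} (hN : 0 < N) {f : E → ℝ} (hf : Measurable f) {x u w : E}
    (hx : ‖x‖ = 1) (hu : ‖u‖ = 1) (hw : ‖w‖ = 1)
    (hb : ∀ a, |f a| ≤ inner ℝ a x ^ 4 + inner ℝ a u ^ 4 + inner ℝ a w ^ 4 + 3)
    (h0 : ∫ a, f a ∂(stdGaussian E) = 0) {θ : ℝ} (hθ : 0 < θ) (p : ℕ) :
    (Measure.pi fun _ : Fin N => stdGaussian E).real
      {z | θ ≤ |(1 / (N : ℝ)) * ∑ i, f (z i)|} ≤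
      momentConst (quarticMomentConst p) p / ((N : ℝ) * θ ^ 2) ^ p := by
  set P := Measure.pi fun _ : Fin N => stdGaussian E with hP
  obtain ⟨hL, hM⟩ := memLp_and_integral_pow_le_of_quartic hf hx hu hw hb
  let X : Fin N → (Fin N → E) → ℝ := fun i z => f (z i)
  have hmp : ∀ i, MeasurePreserving (Function.eval i) P (stdGaussian E) :=
    fun i => measurePreserving_eval _ i
  have htr : ∀ i (g : E → ℝ), Measurable g → ∫ z, g (z i) ∂P = ∫ a, g a ∂(stdGaussian E) := by
    intro i g hg
    rw [← (hmp i).map_eq, integral_map (hmp i).measurable.aemeasurable]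
    exact hg.aestronglyMeasurable
  have hind : iIndepFun X P := iIndepFun_pi (X := fun _ => f) fun i => hf.aemeasurable
  have key := integral_sum_pow_even_le hind
    (fun i k => (hL k).comp_measurePreserving (hmp i))
    (fun i => by simp only [X]; rw [htr i f hf, h0]) (quarticMomentConst_pos p).le
    (fun i k hk => by
      simp only [X]; rw [htr i (fun a => f a ^ (2 * k)) (by fun_prop)]; exact hM p k hk) Finset.univ
  have hSL : ∀ k : ℕ, MemLp (fun z => ∑ i, X i z) k P := fun k =>
    memLp_finsetSum _ fun i _ => (hL k).comp_measurePreserving (hmp i)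
  have hSi := integrable_pow_of_forall_memLp hSL (2 * p)
  have hmk := mul_meas_ge_le_integral_of_nonneg
    (ae_of_all P fun z => by
      show (0 : ℝ) ≤ (∑ i, X i z) ^ (2 * p)
      rw [pow_mul]; positivity) hSi (((N : ℝ) * θ) ^ (2 * p))
  rw [Finset.card_univ, Fintype.card_fin] at key
  have hN0 : (0 : ℝ) < N := by exact_mod_cast hN
  have hsub : P.real {z | θ ≤ |(1 / (N : ℝ)) * ∑ i, f (z i)|} ≤
      P.real {z | ((N : ℝ) * θ) ^ (2 * p) ≤ (∑ i, X i z) ^ (2 * p)} := by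
    refine measureReal_mono fun z hz => ?_
    rw [Set.mem_ofPred_eq] at hz ⊢
    rw [abs_mul, abs_of_pos (by positivity), one_div, inv_mul_eq_div, le_div_iff₀ hN0] at hz
    rw [pow_mul (∑ i, X i z), ← sq_abs (∑ i, X i z), ← pow_mul]
    refine pow_le_pow_left₀ (by positivity) ?_ _
    simp only [X]
    linarith
  have hpos : 0 < (N : ℝ) * θ ^ 2 := by positivity
  rw [le_div_iff₀ (by positivity)]
  have h3 : ((N : ℝ) * θ) ^ (2 * p) = (N : ℝ) ^ p * ((N : ℝ) * θ ^ 2) ^ p := by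
    rw [pow_mul, ← mul_pow]; congr 1; ring
  have h4 := mul_le_mul_of_nonneg_left hsub (by positivity : 0 ≤ ((N : ℝ) * θ) ^ (2 * p))
  have h5 := h4.trans (hmk.trans key)
  rw [h3] at h5
  have h6 : (N : ℝ) ^ p * (P.real {z | θ ≤ |(1 / (N : ℝ)) * ∑ i, f (z i)|} *
      ((N : ℝ) * θ ^ 2) ^ p) ≤ (N : ℝ) ^ p * momentConst (quarticMomentConst p) p := by
    calc _ = _ := by ring
      _ ≤ _ := h5
      _ = _ := by ring
  exact le_of_mul_le_mul_left h6 (by positivity)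

/-- Polarisation in `u ± w` of the case of a single square. -/
lemma integral_inner_sq_mul_inner_mul_inner {x : E} (hx : ‖x‖ = 1) (u w : E) :
    ∫ a, inner ℝ a x ^ 2 * (inner ℝ a u * inner ℝ a w) ∂(stdGaussian E) =
      inner ℝ u w + 2 * (inner ℝ x u * inner ℝ x w) := by
  have hI : ∀ v : E, Integrable (fun a => inner ℝ a x ^ 2 * inner ℝ a v ^ 2) (stdGaussian E) := by
    intro v
    refine ((integrable_inner_pow x 4).add (integrable_inner_pow v 4)).mono' (by fun_prop)
      (ae_of_all _ fun a => ?_)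
    rw [norm_eq_abs, abs_of_nonneg (by positivity)]
    show _ ≤ inner ℝ a x ^ 4 + inner ℝ a v ^ 4
    nlinarith [sq_nonneg (inner ℝ a x ^ 2 - inner ℝ a v ^ 2)]
  have hpt : ∀ a : E, inner ℝ a x ^ 2 * (inner ℝ a u * inner ℝ a w) =
      (1 / 4) * (inner ℝ a x ^ 2 * inner ℝ a (u + w) ^ 2 -
        inner ℝ a x ^ 2 * inner ℝ a (u - w) ^ 2) := by
    intro a; rw [inner_add_right, inner_sub_right]; ring
  simp_rw [hpt]
  rw [integral_const_mul, integral_sub (hI _) (hI _), integral_inner_sq_mul_inner_sq hx,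
    integral_inner_sq_mul_inner_sq hx, norm_add_sq_real, norm_sub_sq_real, inner_add_right,
    inner_sub_right]
  ring

lemma measure_pi_abs_mean_phaseless_ge_le {N : ℕ} (hN : 0 < N) {x : E} (hx : x ≠ 0) {η : ℝ}
    (hη : 0 < η) (p : ℕ) :
    (Measure.pi fun _ : Fin N => stdGaussian E).real
      {z | η * ‖x‖ ^ 2 ≤ |(1 / (N : ℝ)) * ∑ i, inner ℝ (z i) x ^ 2 - ‖x‖ ^ 2|} ≤
      momentConst (quarticMomentConst p) p / ((N : ℝ) * η ^ 2) ^ p := by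
  have hx0 : 0 < ‖x‖ := norm_pos_iff.2 hx
  set e := ‖x‖⁻¹ • x with he
  have he1 : ‖e‖ = 1 := by simp [he, norm_smul, hx0.ne']
  have hN0 : (0 : ℝ) < N := by exact_mod_cast hN
  refine le_trans (measureReal_mono ?_) (measure_pi_abs_mean_ge_le hN
    (f := fun a => inner ℝ a e ^ 2 - 1) (by fun_prop) he1 he1 he1 ?_ ?_ hη p)
  · intro z hz
    rw [Set.mem_ofPred_eq] at hz ⊢
    have h1 : (1 / (N : ℝ)) * ∑ i, inner ℝ (z i) x ^ 2 - ‖x‖ ^ 2 =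
        ‖x‖ ^ 2 * ((1 / (N : ℝ)) * ∑ i, (inner ℝ (z i) e ^ 2 - 1)) := by
      have : ∀ i, inner ℝ (z i) x ^ 2 = ‖x‖ ^ 2 * inner ℝ (z i) e ^ 2 := by
        intro i
        rw [he, inner_smul_right]
        field_simp
      simp only [this, ← Finset.mul_sum, Finset.sum_sub_distrib, Finset.sum_const, Finset.card_univ,
        Fintype.card_fin, nsmul_eq_mul, mul_one]
      field_simp
    rw [h1, abs_mul, abs_of_pos (by positivity), mul_comm η] at hz
    exact le_of_mul_le_mul_left hz (by positivity)
  · intro a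
    rw [abs_le]
    constructor <;> nlinarith [sq_nonneg (inner ℝ a e), sq_nonneg (inner ℝ a e ^ 2 - 1),
      sq_nonneg (inner ℝ a e ^ 2)]
  · rw [integral_sub (integrable_inner_pow e 2) (integrable_const 1),
      integral_inner_sq_stdGaussian, he1]
    simp

lemma measure_pi_abs_mean_quartic_ge_le {N : ℕ} (hN : 0 < N) {x u w : E} (hx : x ≠ 0)
    (hu : ‖u‖ = 1) (hw : ‖w‖ = 1) {η : ℝ} (hη : 0 < η) (p : ℕ) :
    (Measure.pi fun _ : Fin N => stdGaussian E).real
      {z | η * ‖x‖ ^ 2 ≤ |(1 / (N : ℝ)) * ∑ i, inner ℝ (z i) x ^ 2 *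
        (inner ℝ (z i) u * inner ℝ (z i) w) -
        (‖x‖ ^ 2 * inner ℝ u w + 2 * (inner ℝ x u * inner ℝ x w))|} ≤
      momentConst (quarticMomentConst p) p / ((N : ℝ) * η ^ 2) ^ p := by
  have hx0 : 0 < ‖x‖ := norm_pos_iff.2 hx
  set e := ‖x‖⁻¹ • x with he
  have he1 : ‖e‖ = 1 := by simp [he, norm_smul, hx0.ne']
  have hN0 : (0 : ℝ) < N := by exact_mod_cast hN
  set c := inner ℝ u w + 2 * (inner ℝ e u * inner ℝ e w) with hc
  have habs : ∀ y v : E, ‖y‖ = 1 → ‖v‖ = 1 → |inner ℝ y v| ≤ 1 := by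
    intro y v hy hv
    have := abs_real_inner_le_norm y v
    rwa [hy, hv, one_mul] at this
  have hc3 : |c| ≤ 3 := by
    have h1 := habs u w hu hw
    have h2 := mul_le_mul (habs e u he1 hu) (habs e w he1 hw) (abs_nonneg _) zero_le_one
    rw [← abs_mul] at h2
    rw [hc]
    refine (abs_add_le _ _).trans ?_
    rw [abs_mul 2, abs_two]
    linarith
  have hex : ∀ v : E, inner ℝ e v = ‖x‖⁻¹ * inner ℝ x v := by
    intro v; rw [he, inner_smul_left]; simp
  have hxe : ∀ v : E, inner ℝ v e = ‖x‖⁻¹ * inner ℝ v x := by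
    intro v; rw [he, inner_smul_right]
  refine le_trans (measureReal_mono ?_) (measure_pi_abs_mean_ge_le hN
    (f := fun a => inner ℝ a e ^ 2 * (inner ℝ a u * inner ℝ a w) - c) (by fun_prop) he1 hu hw
    ?_ ?_ hη p)
  · intro z hz
    rw [Set.mem_ofPred_eq] at hz ⊢
    have h1 : (1 / (N : ℝ)) * ∑ i, inner ℝ (z i) x ^ 2 * (inner ℝ (z i) u * inner ℝ (z i) w) -
        (‖x‖ ^ 2 * inner ℝ u w + 2 * (inner ℝ x u * inner ℝ x w)) =
        ‖x‖ ^ 2 * ((1 / (N : ℝ)) * ∑ i, (inner ℝ (z i) e ^ 2 *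
          (inner ℝ (z i) u * inner ℝ (z i) w) - c)) := by
      simp only [hc, hex, hxe, Finset.sum_sub_distrib, Finset.sum_const, Finset.card_univ,
        Fintype.card_fin, nsmul_eq_mul, mul_pow, mul_assoc, ← Finset.mul_sum]
      field_simp
    rw [h1, abs_mul, abs_of_pos (by positivity), mul_comm η] at hz
    exact le_of_mul_le_mul_left hz (by positivity)
  · intro a
    refine (abs_sub _ _).trans ?_
    have h1 : |inner ℝ a e ^ 2 * (inner ℝ a u * inner ℝ a w)| ≤
        inner ℝ a e ^ 4 + inner ℝ a u ^ 4 + inner ℝ a w ^ 4 := by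
      rw [abs_mul, abs_of_nonneg (sq_nonneg _)]
      have h2 : |inner ℝ a u * inner ℝ a w| ≤ (inner ℝ a u ^ 2 + inner ℝ a w ^ 2) / 2 := by
        rw [abs_le]
        constructor <;> nlinarith [sq_nonneg (inner ℝ a u + inner ℝ a w),
          sq_nonneg (inner ℝ a u - inner ℝ a w)]
      have h3 := mul_le_mul_of_nonneg_left h2 (sq_nonneg (inner ℝ a e))
      nlinarith [sq_nonneg (inner ℝ a e ^ 2 - inner ℝ a u ^ 2),
        sq_nonneg (inner ℝ a e ^ 2 - inner ℝ a w ^ 2), sq_nonneg (inner ℝ a u ^ 2),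
        sq_nonneg (inner ℝ a w ^ 2), sq_nonneg (inner ℝ a e ^ 2)]
    linarith
  · have hI : Integrable (fun a => inner ℝ a e ^ 2 * (inner ℝ a u * inner ℝ a w))
        (stdGaussian E) := by
      refine (((integrable_inner_pow e 4).add (integrable_inner_pow u 4)).add
        (integrable_inner_pow w 4)).mono' (by fun_prop) (ae_of_all _ fun a => ?_)
      show ‖_‖ ≤ inner ℝ a e ^ 4 + inner ℝ a u ^ 4 + inner ℝ a w ^ 4
      rw [norm_eq_abs, abs_mul, abs_of_nonneg (sq_nonneg _)]
      have h2 : |inner ℝ a u * inner ℝ a w| ≤ (inner ℝ a u ^ 2 + inner ℝ a w ^ 2) / 2 := by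
        rw [abs_le]
        constructor <;> nlinarith [sq_nonneg (inner ℝ a u + inner ℝ a w),
          sq_nonneg (inner ℝ a u - inner ℝ a w)]
      have h3 := mul_le_mul_of_nonneg_left h2 (sq_nonneg (inner ℝ a e))
      nlinarith [sq_nonneg (inner ℝ a e ^ 2 - inner ℝ a u ^ 2),
        sq_nonneg (inner ℝ a e ^ 2 - inner ℝ a w ^ 2), sq_nonneg (inner ℝ a u ^ 2),
        sq_nonneg (inner ℝ a w ^ 2), sq_nonneg (inner ℝ a e ^ 2)]
    rw [integral_sub hI (integrable_const c), integral_inner_sq_mul_inner_mul_inner he1]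
    simp [hc]

end Std
end LRPR

/-! ### The second stage for a fixed subspace. -/

namespace LRPR
open MeasureTheory ProbabilityTheory Real Matrix
open scoped ENNReal

variable {n r mt : ℕ}

/-- The difference between the unprojected second-stage matrix for the signal `x` and its mean. -/
noncomputable def newDeviation (x : EuclideanSpace ℝ (Fin n))
    (z : Fin mt → EuclideanSpace ℝ (Fin n)) : Matrix (Fin n) (Fin n) ℝ :=
  (1 / (mt : ℝ)) • ∑ i, phaseless (z i) x • outer (z i) - (‖x‖ ^ 2 • 1 + (2 : ℝ) • outer x)

lemma transpose_newDeviation (x : EuclideanSpace ℝ (Fin n))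
    (z : Fin mt → EuclideanSpace ℝ (Fin n)) : (newDeviation x z)ᵀ = newDeviation x z := by
  simp only [newDeviation, transpose_sub, transpose_add, transpose_smul, transpose_sum,
    transpose_outer, transpose_one]

lemma transpose_mul_outer_mul_apply (V : Matrix (Fin n) (Fin r) ℝ) (a : EuclideanSpace ℝ (Fin n))
    (j l : Fin r) : (Vᵀ * outer a * V) j l = inner ℝ a (column V j) * inner ℝ a (column V l) := by
  have h : outer a = vecMulVec a.ofLp a.ofLp := by
    ext i j; simp [outer, vecMulVec_apply]
  rw [h, mul_vecMulVec, vecMulVec_mul, vecMulVec_apply]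
  simp only [EuclideanSpace.inner_eq_star_dotProduct, column, star_trivial]
  congr 1
  exact dotProduct_comm _ _

lemma transpose_mul_newDeviation_mul_apply (V : Matrix (Fin n) (Fin r) ℝ)
    (x : EuclideanSpace ℝ (Fin n)) (z : Fin mt → EuclideanSpace ℝ (Fin n)) (j l : Fin r) :
    (Vᵀ * newDeviation x z * V) j l = (1 / (mt : ℝ)) * ∑ i, inner ℝ (z i) x ^ 2 *
      (inner ℝ (z i) (column V j) * inner ℝ (z i) (column V l)) -
      (‖x‖ ^ 2 * inner ℝ (column V j) (column V l) +
        2 * (inner ℝ x (column V j) * inner ℝ x (column V l))) := by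
  have h1 : (Vᵀ * V) j l = inner ℝ (column V j) (column V l) := by
    rw [EuclideanSpace.inner_eq_star_dotProduct, mul_apply]
    simp [column, dotProduct, mul_comm]
  simp only [newDeviation, Matrix.mul_sub, Matrix.sub_mul, Matrix.mul_add, Matrix.add_mul,
    Matrix.mul_smul, Matrix.smul_mul, Matrix.mul_sum, Matrix.sum_mul, Matrix.sub_apply,
    Matrix.add_apply, Matrix.smul_apply, Matrix.sum_apply, smul_eq_mul,
    transpose_mul_outer_mul_apply, Matrix.mul_one, h1, phaseless]

/-- The squared Frobenius norm of `Vᵀ D V` in a form that depends on `V` only through the projection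
`V Vᵀ`, hence not on the choice of eigenvectors within the subspace. -/
lemma trace_proj_eq_sum_sq {V : Matrix (Fin n) (Fin r) ℝ} {D : Matrix (Fin n) (Fin n) ℝ}
    (hD : Dᵀ = D) : trace (V * Vᵀ * D * (V * Vᵀ) * D) = ∑ j, ∑ l, (Vᵀ * D * V) j l ^ 2 := by
  have h1 : trace (V * Vᵀ * D * (V * Vᵀ) * D) = trace ((Vᵀ * D * V) * (Vᵀ * D * V)) := by
    rw [show V * Vᵀ * D * (V * Vᵀ) * D = V * (Vᵀ * D * V * Vᵀ * D) by
      simp only [Matrix.mul_assoc], trace_mul_comm]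
    simp only [Matrix.mul_assoc]
  have hs : (Vᵀ * D * V)ᵀ = Vᵀ * D * V := by
    simp only [transpose_mul, transpose_transpose, hD, Matrix.mul_assoc]
  rw [h1, trace]
  refine Finset.sum_congr rfl fun j _ => ?_
  rw [diag_apply, mul_apply]
  refine Finset.sum_congr rfl fun l _ => ?_
  rw [sq]
  congr 1
  conv_lhs => rw [← hs]
  rfl

/-- If all `r²` entries are below `η ‖x‖² / r`, the Frobenius norm is below `η ‖x‖²`. A union bound
over the entries suffices, and no net is needed. -/
lemma measure_pi_trace_newDeviation_ge_le (hmt : 0 < mt) (hr : 0 < r)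
    {V : Matrix (Fin n) (Fin r) ℝ} (hV : Vᵀ * V = 1) {x : EuclideanSpace ℝ (Fin n)} (hx : x ≠ 0)
    {η : ℝ} (hη : 0 < η) (p : ℕ) :
    (Measure.pi fun _ : Fin mt => stdGaussian (EuclideanSpace ℝ (Fin n))).real
      {z | (η * ‖x‖ ^ 2) ^ 2 ≤ trace (V * Vᵀ * newDeviation x z * (V * Vᵀ) * newDeviation x z)} ≤
      r ^ 2 * (momentConst (quarticMomentConst p) p / (mt * (η / r) ^ 2) ^ p) := by
  have hr0 : (0 : ℝ) < r := by exact_mod_cast hr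
  have hx0 : 0 < ‖x‖ := norm_pos_iff.2 hx
  have hcol : ∀ j, ‖column V j‖ = 1 := by
    intro j
    have h1 : inner ℝ (column V j) (column V j) = (Vᵀ * V) j j := by
      rw [EuclideanSpace.inner_eq_star_dotProduct, mul_apply]
      simp [column, dotProduct]
    rw [hV, one_apply_eq, real_inner_self_eq_norm_sq] at h1
    exact (pow_eq_one_iff_of_nonneg (norm_nonneg _) two_ne_zero).1 h1
  set P := Measure.pi fun _ : Fin mt => stdGaussian (EuclideanSpace ℝ (Fin n))
  let S : Fin r × Fin r → Set (Fin mt → EuclideanSpace ℝ (Fin n)) := fun jl =>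
    {z | η / r * ‖x‖ ^ 2 ≤ |(Vᵀ * newDeviation x z * V) jl.1 jl.2|}
  have hS : ∀ jl, P.real (S jl) ≤
      momentConst (quarticMomentConst p) p / (mt * (η / r) ^ 2) ^ p := by
    intro jl
    simp only [S, transpose_mul_newDeviation_mul_apply]
    exact measure_pi_abs_mean_quartic_ge_le hmt hx (hcol _) (hcol _) (by positivity) p
  calc _ ≤ P.real (⋃ jl, S jl) := by
        refine measureReal_mono fun z hz => ?_
        by_contra hcon
        simp only [S, Set.mem_iUnion, Set.mem_ofPred_eq, not_exists, not_le] at hcon hz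
        rw [trace_proj_eq_sum_sq (transpose_newDeviation x z)] at hz
        have : ∑ j, ∑ l, (Vᵀ * newDeviation x z * V) j l ^ 2 <
            ∑ _j : Fin r, ∑ _l : Fin r, (η / r * ‖x‖ ^ 2) ^ 2 := by
          have hne : (Finset.univ : Finset (Fin r)).Nonempty := ⟨⟨0, hr⟩, Finset.mem_univ _⟩
          refine Finset.sum_lt_sum_of_nonempty hne fun j _ =>
            Finset.sum_lt_sum_of_nonempty hne fun l _ => ?_
          rw [← sq_abs]
          exact pow_lt_pow_left₀ (hcon (j, l)) (abs_nonneg _) (by norm_num)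
        simp only [Finset.sum_const, Finset.card_univ, Fintype.card_fin, nsmul_eq_mul] at this
        have h2 : (r : ℝ) * (r * (η / r * ‖x‖ ^ 2) ^ 2) = (η * ‖x‖ ^ 2) ^ 2 := by field_simp
        linarith
    _ ≤ ∑ jl, P.real (S jl) := measureReal_iUnion_fintype_le _
    _ ≤ ∑ _jl : Fin r × Fin r, _ := Finset.sum_le_sum fun jl _ => hS jl
    _ = _ := by simp [sq]

/-- With `N = ‖x‖`, `y = v·ξ` and `ν = ‖x̂‖`, the squared distance is at most `(ν - N)² + 2 ν (N -
|y|)`. The first term is the energy error, at most `η N²`. For the second, the maximality of `v`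
gives `y² ≥ ‖ξ‖² - η N²`, while `‖ξ‖²` misses `N²` by at most `s N²`. -/
lemma phaseDist_sq_le_of_close {V : Matrix (Fin n) (Fin r) ℝ} (hV : Vᵀ * V = 1)
    {x : EuclideanSpace ℝ (Fin n)} {z : Fin mt → EuclideanSpace ℝ (Fin n)} {η s : ℝ}
    (hη : 0 ≤ η) (hη1 : η ≤ 1)
    (hD : trace (V * Vᵀ * newDeviation x z * (V * Vᵀ) * newDeviation x z) ≤ (η * ‖x‖ ^ 2) ^ 2)
    (hν : |(1 / (mt : ℝ)) * ∑ i, phaseless (z i) x - ‖x‖ ^ 2| ≤ η * ‖x‖ ^ 2)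
    (hs : ‖x‖ ^ 2 - (Vᵀ *ᵥ x.ofLp) ⬝ᵥ (Vᵀ *ᵥ x.ofLp) ≤ s * ‖x‖ ^ 2) {v : Fin r → ℝ}
    (hv : IsTopEigenvector (projectedMatrix V z (fun i => phaseless (z i) x)) v)
    {xh : EuclideanSpace ℝ (Fin n)}
    (hxh : xh.ofLp = V *ᵥ (Real.sqrt ((1 / (mt : ℝ)) * ∑ i, phaseless (z i) x) • v)) :
    phaseDist x xh ^ 2 ≤ (5 * η + 4 * s) * ‖x‖ ^ 2 := by
  set D := newDeviation x z with hDdef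
  set M := projectedMatrix V z (fun i => phaseless (z i) x) with hM
  set ξ := Vᵀ *ᵥ x.ofLp with hξ
  obtain ⟨hv1, hvmax⟩ := hv.unit_and_max
  have hN2 : x.ofLp ⬝ᵥ x.ofLp = ‖x‖ ^ 2 := by
    rw [← real_inner_self_eq_norm_sq, EuclideanSpace.inner_eq_star_dotProduct]; simp
  have hMD : M = Vᵀ * D * V + (‖x‖ ^ 2 • 1 + (2 : ℝ) • vecMulVec ξ ξ) := by
    have h : outer x = vecMulVec x.ofLp x.ofLp := by
      ext i j; simp [outer, vecMulVec_apply]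
    have h2 : Vᵀ * outer x * V = vecMulVec ξ ξ := by
      rw [h, mul_vecMulVec, vecMulVec_mul, ← mulVec_transpose]
    rw [← h2, hM, projectedMatrix, hDdef, newDeviation, Matrix.mul_sub, Matrix.sub_mul,
      Matrix.mul_add, Matrix.add_mul, Matrix.mul_smul Vᵀ (‖x‖ ^ 2), Matrix.smul_mul,
      Matrix.mul_one, hV, Matrix.mul_smul Vᵀ (2 : ℝ), Matrix.smul_mul (2 : ℝ), sub_add_cancel]
  have hG : ∀ c : Fin r → ℝ, c ⬝ᵥ c = 1 → |c ⬝ᵥ (Vᵀ * D * V) *ᵥ c| ≤ η * ‖x‖ ^ 2 := by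
    intro c hc
    rw [trace_proj_eq_sum_sq (transpose_newDeviation x z)] at hD
    refine abs_le_of_sq_le_sq ?_ (by positivity)
    refine le_trans ?_ hD
    rw [← Fintype.sum_prod_type']
    have h1 : c ⬝ᵥ (Vᵀ * D * V) *ᵥ c =
        ∑ p : Fin r × Fin r, (c p.1 * c p.2) * (Vᵀ * D * V) p.1 p.2 := by
      rw [Fintype.sum_prod_type]
      simp only [dotProduct, mulVec, Finset.mul_sum]
      exact Finset.sum_congr rfl fun i _ => Finset.sum_congr rfl fun j _ => by ring
    have h2 : ∑ p : Fin r × Fin r, (c p.1 * c p.2) ^ 2 = 1 := by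
      rw [Fintype.sum_prod_type]
      simp only [mul_pow, ← Finset.mul_sum, ← Finset.sum_mul]
      have : ∑ i, c i ^ 2 = 1 := by rw [← hc]; simp [dotProduct, sq]
      rw [this, one_mul]
    rw [h1]
    refine (Finset.sum_mul_sq_le_sq_mul_sq _ _ _).trans ?_
    rw [h2, one_mul]
  have hq : ∀ c : Fin r → ℝ, c ⬝ᵥ c = 1 →
      c ⬝ᵥ M *ᵥ c = c ⬝ᵥ (Vᵀ * D * V) *ᵥ c + (‖x‖ ^ 2 + 2 * (c ⬝ᵥ ξ) ^ 2) := by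
    intro c hc
    rw [hMD, add_mulVec, add_mulVec, dotProduct_add, dotProduct_add, smul_mulVec, smul_mulVec,
      dotProduct_smul, dotProduct_smul, one_mulVec, hc, vecMulVec_mulVec, dotProduct_smul,
      dotProduct_comm ξ c]
    simp [sq]
  set N := ‖x‖ with hN
  have hN0 : 0 ≤ N := norm_nonneg _
  set y := v ⬝ᵥ ξ with hy
  have hξ0 : 0 ≤ ξ ⬝ᵥ ξ := Finset.sum_nonneg fun i _ => mul_self_nonneg _
  -- The Rayleigh quotient at `v` is compared with that at `ξ / ‖ξ‖`. Each deviates by at most `η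
  -- N²`, and the rank-one part carries the factor `2`.
  have hylo : ξ ⬝ᵥ ξ - η * N ^ 2 ≤ y ^ 2 := by
    rcases hξ0.eq_or_lt with h0 | h0
    · rw [← h0]
      nlinarith [sq_nonneg y, mul_nonneg hη (sq_nonneg N)]
    · set c := (Real.sqrt (ξ ⬝ᵥ ξ))⁻¹ • ξ with hc
      have hss : (Real.sqrt (ξ ⬝ᵥ ξ))⁻¹ * (Real.sqrt (ξ ⬝ᵥ ξ))⁻¹ * (ξ ⬝ᵥ ξ) = 1 := by
        rw [← mul_inv, Real.mul_self_sqrt h0.le, inv_mul_cancel₀ h0.ne']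
      have hc1 : c ⬝ᵥ c = 1 := by
        rw [hc, smul_dotProduct, dotProduct_smul, smul_eq_mul, smul_eq_mul, ← mul_assoc, hss]
      have hcξ : (c ⬝ᵥ ξ) ^ 2 = ξ ⬝ᵥ ξ := by
        rw [hc, smul_dotProduct, smul_eq_mul, mul_pow, sq, sq, ← mul_assoc, hss, one_mul]
      have h1 := hvmax c hc1
      rw [hq c hc1, hq v hv1, hcξ] at h1
      have h2 := (abs_le.1 (hG c hc1)).1
      have h3 := (abs_le.1 (hG v hv1)).2
      linarith
  have hyup : |y| ≤ N := by
    refine abs_le_of_sq_le_sq ?_ hN0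
    have h1 : y = (V *ᵥ v) ⬝ᵥ x.ofLp := by
      rw [hy, hξ, dotProduct_mulVec, vecMul_transpose]
    have h2 : (V *ᵥ v) ⬝ᵥ (V *ᵥ v) = 1 := by
      rw [mulVec_dotProduct_mulVec_of_transpose_mul_self hV, hv1]
    rw [h1, ← hN2]
    have h3 := Finset.sum_mul_sq_le_sq_mul_sq Finset.univ (V *ᵥ v) x.ofLp
    have h4 : ∑ i, (V *ᵥ v) i ^ 2 = 1 := by rw [← h2]; simp [dotProduct, sq]
    rw [h4, one_mul] at h3
    refine h3.trans (le_of_eq ?_)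
    simp [dotProduct, sq]
  set A := (1 / (mt : ℝ)) * ∑ i, phaseless (z i) x with hA
  have hA0 : 0 ≤ A := by
    rw [hA]
    have : ∀ i, 0 ≤ phaseless (z i) x := fun i => sq_nonneg _
    have := Finset.sum_nonneg fun i (_ : i ∈ Finset.univ) => this i
    positivity
  set ν := Real.sqrt A with hνdef
  have hν0 : 0 ≤ ν := Real.sqrt_nonneg _
  have hν2 : ν ^ 2 = A := Real.sq_sqrt hA0
  have hnxh : ‖xh‖ ^ 2 = A := by
    rw [← real_inner_self_eq_norm_sq, EuclideanSpace.inner_eq_star_dotProduct, star_trivial, hxh,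
      mulVec_dotProduct_mulVec_of_transpose_mul_self hV, smul_dotProduct, dotProduct_smul, hv1]
    simp [← sq, hν2]
  have hin : inner ℝ x xh = ν * y := by
    rw [EuclideanSpace.inner_eq_star_dotProduct, star_trivial, hxh, mulVec_smul, smul_dotProduct,
      hy, hξ, dotProduct_mulVec, vecMul_transpose, smul_eq_mul]
  have hpd : phaseDist x xh ^ 2 ≤ N ^ 2 + A - 2 * (ν * |y|) := by
    have h1 : ‖x - xh‖ ^ 2 = N ^ 2 - 2 * (ν * y) + A := by
      rw [norm_sub_sq_real, hin, hnxh]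
    have h2 : ‖x + xh‖ ^ 2 = N ^ 2 + 2 * (ν * y) + A := by
      rw [norm_add_sq_real, hin, hnxh]
    have hm0 : 0 ≤ phaseDist x xh := le_min (norm_nonneg _) (norm_nonneg _)
    rcases abs_cases y with ⟨h, -⟩ | ⟨h, -⟩ <;> rw [h]
    · have : phaseDist x xh ^ 2 ≤ ‖x - xh‖ ^ 2 := pow_le_pow_left₀ hm0 (min_le_left _ _) 2
      linarith
    · have : phaseDist x xh ^ 2 ≤ ‖x + xh‖ ^ 2 := pow_le_pow_left₀ hm0 (min_le_right _ _) 2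
      linarith
  rw [abs_le] at hν
  have hνN : (ν - N) ^ 2 ≤ η * N ^ 2 := by
    rcases le_total ν N with h | h
    · nlinarith [mul_nonneg hν0 (sub_nonneg.2 h)]
    · nlinarith [mul_nonneg hN0 (sub_nonneg.2 h)]
  have hν2N : ν ≤ 2 * N := by
    refine abs_le_of_sq_le_sq' ?_ (by positivity) |>.2
    nlinarith [sq_nonneg N]
  -- From `|y| ≤ N` one has `N (N - |y|) ≤ N² - y²`.
  have hNy : N * (N - |y|) ≤ (s + η) * N ^ 2 := by
    have h1 := abs_nonneg y
    have h2 := sq_abs y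
    nlinarith
  have h5 : 2 * ν * (N - |y|) ≤ 4 * ((s + η) * N ^ 2) := by
    have := mul_le_mul_of_nonneg_right hν2N (sub_nonneg.2 hyup)
    nlinarith
  nlinarith

/-! ### Ordered eigenbases, measurability and conditioning on the first stage. -/

/-- `W` diagonalizes `Y` with eigenvalues in non-increasing order. -/
def IsOrderedEigenbasis (Y W : Matrix (Fin n) (Fin n) ℝ) : Prop :=
  Wᵀ * W = 1 ∧ (∀ i j, i ≠ j → (Wᵀ * Y * W) i j = 0) ∧ ∀ i j, i ≤ j →
    (Wᵀ * Y * W) j j ≤ (Wᵀ * Y * W) i i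

lemma IsTopEigenvectors.exists_isOrderedEigenbasis {Y : Matrix (Fin n) (Fin n) ℝ}
    {V : Matrix (Fin n) (Fin r) ℝ} (h : IsTopEigenvectors Y V) :
    Vᵀ * V = 1 ∧ ∃ W, IsOrderedEigenbasis Y W ∧ V * Vᵀ = topProj W r := by
  obtain ⟨hr, W, l, hW, hl, hY, hV⟩ := h
  refine ⟨transpose_mul_self_of_castLE hr hW hV, W, ⟨hW, ?_, ?_⟩, mul_transpose_eq_topProj hr hV⟩
  all_goals
    have h1 : Wᵀ * Y * W = diagonal l := by
      rw [hY]
      calc Wᵀ * (W * diagonal l * Wᵀ) * W = (Wᵀ * W) * diagonal l * (Wᵀ * W) := by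
            simp only [Matrix.mul_assoc]
        _ = _ := by rw [hW, Matrix.one_mul, Matrix.mul_one]
    rw [h1]
  · intro i j hij
    exact diagonal_apply_ne _ hij
  · intro i j hij
    rw [diagonal_apply_eq, diagonal_apply_eq]
    exact hl hij

lemma IsOrderedEigenbasis.eq_mul_diagonal_mul {Y W : Matrix (Fin n) (Fin n) ℝ}
    (h : IsOrderedEigenbasis Y W) : Antitone (fun i => (Wᵀ * Y * W) i i) ∧
      Y = W * diagonal (fun i => (Wᵀ * Y * W) i i) * Wᵀ := by
  obtain ⟨hW, h1, h2⟩ := h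
  refine ⟨fun i j hij => h2 i j hij, ?_⟩
  have h3 : diagonal (fun i => (Wᵀ * Y * W) i i) = Wᵀ * Y * W := by
    ext i j
    by_cases hij : i = j
    · subst hij; simp
    · rw [diagonal_apply_ne _ hij, h1 i j hij]
  have hWW : W * Wᵀ = 1 := mul_eq_one_comm.1 hW
  rw [h3]
  calc Y = (W * Wᵀ) * Y * (W * Wᵀ) := by rw [hWW, Matrix.one_mul, Matrix.mul_one]
    _ = _ := by simp only [Matrix.mul_assoc]

/-- An ordered eigenbasis is described by equations and weak inequalities between continuous
functions of `Y` and `W`. The set is therefore the projection of a closed set along the compact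
orthogonal group, hence closed. -/
lemma isClosed_exists_isOrderedEigenbasis (n r : ℕ) (c : ℝ) :
    IsClosed {p : Matrix (Fin n) (Fin n) ℝ × Matrix (Fin n) (Fin n) ℝ |
      ∃ W : Matrix (Fin n) (Fin n) ℝ, IsOrderedEigenbasis (p.1) W ∧
        c ≤ trace (topProj W r * p.2 * topProj W r * p.2)} := by
  let K : Set (Matrix (Fin n) (Fin n) ℝ) := {W | Wᵀ * W = 1}
  have hKc : IsClosed K := isClosed_eq (by fun_prop) (by fun_prop)
  have hKK : IsCompact K := by
    have hbox : IsCompact (Set.pi Set.univ fun _ : Fin n =>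
        (Set.pi Set.univ fun _ : Fin n => Set.Icc (-1 : ℝ) 1)) :=
      isCompact_univ_pi fun _ => isCompact_univ_pi fun _ => isCompact_Icc
    refine hbox.of_isClosed_subset hKc fun (W : Matrix (Fin n) (Fin n) ℝ) hW i _ j _ => ?_
    have h1 : ∑ i', W i' j * W i' j = 1 := by
      have := congrFun (congrFun (hW : Wᵀ * W = 1) j) j
      simpa [mul_apply] using this
    have h2 : W i j * W i j ≤ 1 := by
      rw [← h1]
      exact Finset.single_le_sum (f := fun i' => W i' j * W i' j)
        (fun i' _ => mul_self_nonneg _) (Finset.mem_univ i)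
    rw [← sq] at h2
    exact abs_le.1 (abs_le_one_iff_mul_self_le_one.2 (by rwa [← sq]))
  have : CompactSpace K := isCompact_iff_compactSpace.1 hKK
  let S : Set (K × (Matrix (Fin n) (Fin n) ℝ × Matrix (Fin n) (Fin n) ℝ)) :=
    {w | (∀ i j, i ≠ j → ((w.1.1)ᵀ * w.2.1 * w.1.1) i j = 0) ∧
      (∀ i j, i ≤ j → ((w.1.1)ᵀ * w.2.1 * w.1.1) j j ≤
        ((w.1.1)ᵀ * w.2.1 * w.1.1) i i) ∧
      c ≤ trace (topProj w.1.1 r * w.2.2 * topProj w.1.1 r * w.2.2)}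
  have hof1 : Continuous fun w : K × (Matrix (Fin n) (Fin n) ℝ × Matrix (Fin n) (Fin n) ℝ) =>
      w.2.1 := by fun_prop
  have hof2 : Continuous fun w : K × (Matrix (Fin n) (Fin n) ℝ × Matrix (Fin n) (Fin n) ℝ) =>
      w.2.2 := by fun_prop
  have hW : Continuous fun w : K × (Matrix (Fin n) (Fin n) ℝ × Matrix (Fin n) (Fin n) ℝ) =>
      w.1.1 := by fun_prop
  have hWt : Continuous fun w : K × (Matrix (Fin n) (Fin n) ℝ × Matrix (Fin n) (Fin n) ℝ) =>
      (w.1.1)ᵀ := hW.matrix_transpose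
  have hY : Continuous fun w : K × (Matrix (Fin n) (Fin n) ℝ × Matrix (Fin n) (Fin n) ℝ) =>
      (w.1.1)ᵀ * w.2.1 * w.1.1 := (hWt.matrix_mul hof1).matrix_mul hW
  have hP : Continuous fun w : K × (Matrix (Fin n) (Fin n) ℝ × Matrix (Fin n) (Fin n) ℝ) =>
      topProj w.1.1 r := (hW.matrix_mul continuous_const).matrix_mul hWt
  have hS : IsClosed S := by
    refine IsClosed.and ?_ (IsClosed.and ?_ ?_)
    · simp only [Set.ofPred_forall]
      exact isClosed_iInter fun i => isClosed_iInter fun j => isClosed_iInter fun _ =>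
        isClosed_eq (hY.matrix_elem i j) continuous_const
    · simp only [Set.ofPred_forall]
      exact isClosed_iInter fun i => isClosed_iInter fun j => isClosed_iInter fun _ =>
        isClosed_le (hY.matrix_elem j j) (hY.matrix_elem i i)
    · exact isClosed_le continuous_const
        ((((hP.matrix_mul hof2).matrix_mul hP).matrix_mul hof2).matrix_trace)
  convert isClosedMap_snd_of_compactSpace S hS using 1
  ext p
  constructor
  · rintro ⟨W, ⟨h1, h2, h3⟩, h4⟩
    exact ⟨(⟨W, h1⟩, p), ⟨h2, h3, h4⟩, rfl⟩
  · rintro ⟨⟨W, p'⟩, ⟨h2, h3, h4⟩, rfl⟩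
    exact ⟨W.1, ⟨W.2, h2, h3⟩, h4⟩

/-- `B` need not be measurable: it is replaced by a measurable hull of the same measure. Off the
hull the sections of `C` are bounded by hypothesis. -/
lemma measure_prod_union_le {α β : Type*} [MeasurableSpace α] [MeasurableSpace β] {μ : Measure α}
    {ν : Measure β} [IsProbabilityMeasure μ] [IsProbabilityMeasure ν] {B : Set α} {C : Set (α × β)}
    (hC : MeasurableSet C) {e : ℝ} (h : ∀ a ∉ B, ν.real {b | (a, b) ∈ C} ≤ e) (he : 0 ≤ e) :
    (μ.prod ν).real {p | p.1 ∈ B ∨ p ∈ C} ≤ μ.real B + e := by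
  set N := toMeasurable μ B with hN
  have hNm : MeasurableSet N := measurableSet_toMeasurable _ _
  have hsub : {p : α × β | p.1 ∈ B ∨ p ∈ C} ⊆ N ×ˢ Set.univ ∪ (C ∩ Nᶜ ×ˢ Set.univ) := by
    rintro ⟨a, b⟩ hp
    by_cases ha : a ∈ N
    · exact Or.inl ⟨ha, trivial⟩
    · rcases hp with h1 | h1
      · exact absurd (subset_toMeasurable _ _ h1) ha
      · exact Or.inr ⟨h1, ha, trivial⟩
  refine (measureReal_mono hsub).trans ((measureReal_union_le _ _).trans (add_le_add ?_ ?_))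
  · rw [measureReal_def, Measure.prod_prod, measure_univ, mul_one, hN, measure_toMeasurable,
      measureReal_def]
  · have hm : MeasurableSet (C ∩ Nᶜ ×ˢ (Set.univ : Set β)) :=
      hC.inter (hNm.compl.prod MeasurableSet.univ)
    rw [measureReal_def, Measure.prod_apply hm]
    refine ENNReal.toReal_le_of_le_ofReal he ?_
    calc ∫⁻ a, ν (Prod.mk a ⁻¹' (C ∩ Nᶜ ×ˢ Set.univ)) ∂μ ≤ ∫⁻ _a, ENNReal.ofReal e ∂μ := by
          refine lintegral_mono fun a => ?_
          by_cases ha : a ∈ N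
          · have : Prod.mk a ⁻¹' (C ∩ Nᶜ ×ˢ (Set.univ : Set β)) = ∅ := by
              ext b; simp [ha]
            rw [this]; simp
          · have haB : a ∉ B := fun h => ha (subset_toMeasurable _ _ h)
            calc ν (Prod.mk a ⁻¹' (C ∩ Nᶜ ×ˢ Set.univ)) ≤ ν {b | (a, b) ∈ C} :=
                  measure_mono fun b hb => hb.1
              _ = ENNReal.ofReal (ν.real {b | (a, b) ∈ C}) := by
                  rw [ofReal_measureReal]
              _ ≤ _ := ENNReal.ofReal_le_ofReal (h a haB)
      _ = ENNReal.ofReal e := by simp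

end LRPR

/-! ### The joint law of the measurements and the measurability of the matrices. -/

namespace LRPR
open MeasureTheory ProbabilityTheory Real Matrix

section Law

variable {n m mt q : ℕ} {Ω : Type*} [MeasurableSpace Ω] {P : Measure Ω}
  {a : Fin m → Fin q → Ω → EuclideanSpace ℝ (Fin n)}
  {anew : Fin mt → Ω → EuclideanSpace ℝ (Fin n)}

lemma MeasurementModel.aemeasurable (h : MeasurementModel P a anew) :
    AEMeasurable (fun ω => ((fun p : Fin m × Fin q => a p.1 p.2 ω), fun i => anew i ω)) P :=
  (aemeasurable_pi_lambda _ fun p : Fin m × Fin q => (h.law p.1 p.2).aemeasurable).prodMk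
    (aemeasurable_pi_lambda _ fun i => (h.law_new i).aemeasurable)

lemma MeasurementModel.map_eq (h : MeasurementModel P a anew) :
    P.map (fun ω => ((fun p : Fin m × Fin q => a p.1 p.2 ω), fun i => anew i ω)) =
      (Measure.pi fun _ => stdGaussian (EuclideanSpace ℝ (Fin n))).prod
        (Measure.pi fun _ => stdGaussian (EuclideanSpace ℝ (Fin n))) := by
  set f : (Fin m × Fin q) ⊕ Fin mt → Ω → EuclideanSpace ℝ (Fin n) :=
    Sum.elim (fun p => a p.1 p.2) anew with hf
  have hm : ∀ i, AEMeasurable (f i) P := by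
    rintro (p | i)
    · exact (h.law p.1 p.2).aemeasurable
    · exact (h.law_new i).aemeasurable
  have hl : ∀ i, P.map (f i) = stdGaussian (EuclideanSpace ℝ (Fin n)) := by
    rintro (p | i)
    · exact (h.law p.1 p.2).map_eq
    · exact (h.law_new i).map_eq
  have h1 := h.indep.map_fun_eq_pi_map hm
  simp only [hl] at h1
  have h2 := measurePreserving_sumPiEquivProdPi
    (fun _ : (Fin m × Fin q) ⊕ Fin mt => stdGaussian (EuclideanSpace ℝ (Fin n)))
  rw [← h2.map_eq, ← h1, AEMeasurable.map_map_of_aemeasurable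
    (MeasurableEquiv.measurable _).aemeasurable (aemeasurable_pi_lambda _ hm)]
  rfl

/-- `S` is arbitrary, so the good event is the complement of a measurable hull of its preimage. -/
lemma MeasurementModel.exists_event_compl_le [IsProbabilityMeasure P]
    (h : MeasurementModel P a anew)
    (S : Set ((Fin m × Fin q → EuclideanSpace ℝ (Fin n)) × (Fin mt → EuclideanSpace ℝ (Fin n)))) :
    ∃ E, MeasurableSet E ∧
      1 - ((Measure.pi fun _ => stdGaussian (EuclideanSpace ℝ (Fin n))).prod
        (Measure.pi fun _ => stdGaussian (EuclideanSpace ℝ (Fin n)))).real S ≤ P.real E ∧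
      ∀ ω ∈ E, ((fun p : Fin m × Fin q => a p.1 p.2 ω), fun i => anew i ω) ∉ S := by
  set F := fun ω => ((fun p : Fin m × Fin q => a p.1 p.2 ω), fun i => anew i ω) with hF
  refine ⟨(toMeasurable P (F ⁻¹' S))ᶜ, (measurableSet_toMeasurable _ _).compl, ?_, ?_⟩
  · rw [probReal_compl_eq_one_sub (measurableSet_toMeasurable _ _), ← h.map_eq]
    refine sub_le_sub_left ?_ _
    rw [measureReal_def, measureReal_def, measure_toMeasurable]
    have : IsProbabilityMeasure (P.map F) := Measure.isProbabilityMeasure_map h.aemeasurable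
    refine ENNReal.toReal_mono (measure_ne_top _ _) ?_
    exact Measure.le_map_apply h.aemeasurable S
  · intro ω hω hS
    exact hω (subset_toMeasurable _ _ hS)

end Law

section Measurability

variable {n m mt q : ℕ}

lemma measurable_phaseless (x : EuclideanSpace ℝ (Fin n)) :
    Measurable fun z : EuclideanSpace ℝ (Fin n) => phaseless z x := by
  unfold phaseless
  fun_prop

lemma measurable_newDeviation_apply (x : EuclideanSpace ℝ (Fin n)) (i j : Fin n) :
    Measurable fun z : Fin mt → EuclideanSpace ℝ (Fin n) => newDeviation x z i j := by
  simp only [newDeviation, Matrix.sub_apply, Matrix.smul_apply, Matrix.sum_apply, smul_eq_mul]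
  refine Measurable.sub_const (Measurable.const_mul (Finset.measurable_sum _ fun l _ => ?_) _) _
  have h : Measurable fun z : Fin mt → EuclideanSpace ℝ (Fin n) => phaseless (z l) x :=
    (measurable_phaseless x).comp (measurable_pi_apply _)
  refine h.mul ?_
  simp only [outer, of_apply]
  fun_prop

lemma measurable_truncatedMatrix_apply (X : Matrix (Fin n) (Fin q) ℝ) (i j : Fin n) :
    Measurable fun a : Fin m × Fin q → EuclideanSpace ℝ (Fin n) =>
      truncatedMatrix (fun i k => a (i, k)) (fun i k => phaseless (a (i, k)) (column X k)) i j := by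
  simp only [truncatedMatrix, Matrix.smul_apply, Matrix.sum_apply, smul_eq_mul]
  refine Measurable.const_mul (Finset.measurable_sum _ fun l _ => Finset.measurable_sum _
    fun k _ => ?_) _
  have h (l : Fin m) : Measurable fun a : Fin m × Fin q → EuclideanSpace ℝ (Fin n) =>
      phaseless (a (l, k)) (column X k) := (measurable_phaseless _).comp (measurable_pi_apply _)
  simp only [apply_ite (fun M : Matrix (Fin n) (Fin n) ℝ => M i j), Matrix.smul_apply, smul_eq_mul,
    Matrix.zero_apply, outer, of_apply]
  refine Measurable.ite (measurableSet_le (h l) (by fun_prop)) ((h l).mul ?_) measurable_const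
  fun_prop

end Measurability

/-! ### Consequences of the reduced eigenvalue decomposition. -/

section ReducedEVD

variable {n q r : ℕ} {X : Matrix (Fin n) (Fin q) ℝ} {U : Matrix (Fin n) (Fin r) ℝ}
  {lam : Fin r → ℝ}

lemma sum_norm_column_sq (X : Matrix (Fin n) (Fin q) ℝ) :
    ∑ k, ‖column X k‖ ^ 2 = trace (X * Xᵀ) := by
  rw [trace_mul_comm]
  refine Finset.sum_congr rfl fun k _ => ?_
  rw [← real_inner_self_eq_norm_sq, EuclideanSpace.inner_eq_star_dotProduct, diag_apply, mul_apply]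
  simp [column, dotProduct]

lemma IsReducedEVD.meanSq_eq (h : IsReducedEVD X U lam) : meanSq X = ∑ j, lam j := by
  rw [meanSq, sum_norm_column_sq, ← smul_eq_mul, ← trace_smul, h.2, Matrix.mul_assoc,
    trace_mul_comm, Matrix.mul_assoc, h.1, Matrix.mul_one, trace_diagonal]

/-- The entries are values of the form of `X X'`, hence nonnegative. A zero entry would push the
rank of the diagonal matrix, and so of `X`, below `r`. -/
lemma IsReducedEVD.pos (h : IsReducedEVD X U lam) (hq : 0 < q) (hX : X.rank = r) (j : Fin r) :
    0 < lam j := by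
  have hq0 : (0 : ℝ) < q := by exact_mod_cast hq
  have hnn : ∀ j, 0 ≤ lam j := by
    intro j
    have h1 := quadratic_mul_transpose X (WithLp.toLp 2 (U *ᵥ Pi.single j 1))
    have h2 : (U *ᵥ Pi.single j 1) ⬝ᵥ ((1 / (q : ℝ)) • (X * Xᵀ)) *ᵥ (U *ᵥ Pi.single j 1) =
        lam j := by
      rw [h.2, dotProduct_mul_diagonal_mul_transpose_mulVec, mulVec_mulVec, h.1, one_mulVec,
        Finset.sum_eq_single j]
      · simp
      · intro b _ hb; simp [Pi.single_eq_of_ne hb]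
      · simp
    rw [← h2, smul_mulVec, dotProduct_smul, h1, smul_eq_mul]
    have := Finset.sum_nonneg fun k (_ : k ∈ Finset.univ) =>
      sq_nonneg (inner ℝ (column X k) (WithLp.toLp 2 (U *ᵥ Pi.single j 1)))
    positivity
  refine lt_of_le_of_ne (hnn j) fun h0 => ?_
  have h3 : X * Xᵀ = U * (diagonal ((q : ℝ) • lam)) * Uᵀ := by
    rw [diagonal_smul, Matrix.mul_smul, Matrix.smul_mul, ← h.2, smul_smul]
    field_simp
    simp
  have h4 : r ≤ (diagonal ((q : ℝ) • lam)).rank := by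
    refine hX.symm.trans_le ?_
    rw [← rank_self_mul_transpose, h3]
    exact (rank_mul_le_left _ _).trans (rank_mul_le_right _ _)
  rw [rank_diagonal] at h4
  have h5 := Fintype.card_subtype_lt (p := fun i => ((q : ℝ) • lam) i ≠ 0) (x := j)
    (by simp [← h0])
  rw [Fintype.card_fin] at h5
  omega

/-- The columns of `X` lie in the range of `U`: with `Q = 1 - U Uᵀ`, the matrix `(Q X) (Q X)ᵀ`
vanishes, hence so does `Q X`. -/
lemma IsReducedEVD.mul_transpose_mul (h : IsReducedEVD X U lam) (hq : 0 < q) :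
    U * (Uᵀ * X) = X := by
  have hq0 : (0 : ℝ) < q := by exact_mod_cast hq
  set Q := 1 - U * Uᵀ with hQ
  have hQU : Q * U = 0 := by
    rw [hQ, Matrix.sub_mul, Matrix.one_mul, Matrix.mul_assoc, h.1, Matrix.mul_one, sub_self]
  have h3 : X * Xᵀ = (q : ℝ) • (U * diagonal lam * Uᵀ) := by
    rw [← h.2, smul_smul]
    field_simp
    simp
  have h4 : (Q * X) * (Q * X)ᵀ = 0 := by
    rw [transpose_mul, Matrix.mul_assoc, ← Matrix.mul_assoc X, h3, Matrix.smul_mul,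
      Matrix.mul_smul, ← Matrix.mul_assoc, ← Matrix.mul_assoc, ← Matrix.mul_assoc, hQU]
    simp
  have h5 : Q * X = 0 := by
    rw [← conjTranspose_eq_transpose_of_trivial] at h4
    exact self_mul_conjTranspose_eq_zero.1 h4
  rw [hQ, Matrix.sub_mul, Matrix.one_mul, sub_eq_zero] at h5
  rw [← Matrix.mul_assoc, ← h5]

lemma le_rho_mul_meanSq (hX : 0 < meanSq X) (k : Fin q) : ‖column X k‖ ^ 2 ≤ rho X * meanSq X := by
  rw [rho, ← meanSq, div_mul_cancel₀ _ hX.ne']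
  exact le_ciSup (f := fun k => ‖column X k‖ ^ 2) (Set.finite_range _).bddAbove k

lemma one_le_rho (hq : 0 < q) (hX : 0 < meanSq X) : 1 ≤ rho X := by
  have hq0 : (0 : ℝ) < q := by exact_mod_cast hq
  have h1 : ∑ k, ‖column X k‖ ^ 2 ≤ ∑ _k : Fin q, rho X * meanSq X :=
    Finset.sum_le_sum fun k _ => le_rho_mul_meanSq hX k
  have h2 : ∑ k, ‖column X k‖ ^ 2 = q * meanSq X := by rw [meanSq]; field_simp
  rw [h2] at h1
  simp only [Finset.sum_const, Finset.card_univ, Fintype.card_fin, nsmul_eq_mul] at h1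
  have h3 := le_of_mul_le_mul_left h1 hq0
  exact le_of_mul_le_mul_right (by linarith) hX

/-- The smallest of the eigenvalues `lam`. -/
noncomputable def minEigenvalue (lam : Fin r → ℝ) : ℝ := ⨅ j, lam j

lemma minEigenvalue_le (lam : Fin r → ℝ) (j : Fin r) : minEigenvalue lam ≤ lam j :=
  ciInf_le (Set.finite_range _).bddBelow j

lemma minEigenvalue_pos (hr : 0 < r) (h : ∀ j, 0 < lam j) : 0 < minEigenvalue lam := by
  have : Nonempty (Fin r) := ⟨⟨0, hr⟩⟩
  obtain ⟨j, hj⟩ := exists_eq_ciInf_of_finite (f := lam)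
  rw [minEigenvalue, ← hj]
  exact h j

lemma le_conditionNumber_mul (hr : 0 < r) (h : ∀ j, 0 < lam j) (j : Fin r) :
    lam j ≤ conditionNumber lam * minEigenvalue lam := by
  have := minEigenvalue_pos hr h
  rw [conditionNumber, ← minEigenvalue, div_mul_cancel₀ _ this.ne']
  exact le_ciSup (f := lam) (Set.finite_range _).bddAbove j

lemma one_le_conditionNumber (hr : 0 < r) (h : ∀ j, 0 < lam j) : 1 ≤ conditionNumber lam := by
  have h0 := minEigenvalue_pos hr h
  have h1 := (minEigenvalue_le lam ⟨0, hr⟩).trans (le_conditionNumber_mul hr h ⟨0, hr⟩)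
  exact le_of_mul_le_mul_right (by linarith) h0

lemma IsReducedEVD.meanSq_le (hE : IsReducedEVD X U lam) (hr : 0 < r) (h : ∀ j, 0 < lam j) :
    meanSq X ≤ r * (conditionNumber lam * minEigenvalue lam) := by
  rw [hE.meanSq_eq]
  refine (Finset.sum_le_sum fun j _ => le_conditionNumber_mul hr h j).trans ?_
  simp

lemma IsReducedEVD.meanSq_pos (hE : IsReducedEVD X U lam) (hr : 0 < r) (h : ∀ j, 0 < lam j) :
    0 < meanSq X := by
  rw [hE.meanSq_eq]
  exact Finset.sum_pos (fun j _ => h j) ⟨⟨0, hr⟩, Finset.mem_univ _⟩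

end ReducedEVD

end LRPR

/-! ### From closeness in quadratic form to subspace error and uniqueness of the projection. -/

namespace LRPR
open MeasureTheory ProbabilityTheory Real Matrix

section Deterministic

variable {n r : ℕ}

open scoped Matrix.Norms.L2Operator in
lemma subspaceError_le {Uhat U : Matrix (Fin n) (Fin r) ℝ} {c : ℝ} (hc : 0 ≤ c)
    (h : ∀ v : Fin r → ℝ, (((1 - Uhat * Uhatᵀ) * U) *ᵥ v) ⬝ᵥ (((1 - Uhat * Uhatᵀ) * U) *ᵥ v) ≤
      c ^ 2 * (v ⬝ᵥ v)) : subspaceError Uhat U ≤ c := by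
  rw [subspaceError, l2_opNorm_def]
  refine ContinuousLinearMap.opNorm_le_bound _ hc fun x => ?_
  refine abs_le_of_sq_le_sq' ?_ (by positivity) |>.2
  have h1 (k : ℕ) (y : EuclideanSpace ℝ (Fin k)) : ‖y‖ ^ 2 = y.ofLp ⬝ᵥ y.ofLp := by
    rw [← real_inner_self_eq_norm_sq, EuclideanSpace.inner_eq_star_dotProduct, star_trivial]
  rw [mul_pow, h1, h1]
  exact h x.ofLp

variable {A : Matrix (Fin n) (Fin n) ℝ} {U : Matrix (Fin n) (Fin r) ℝ} {lam : Fin r → ℝ}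
  {b γ L t : ℝ}

/-- The top `r` eigenvalues are at least `b + γ L - t` and the others at most `b + t`, in either
basis; `2 t < γ L` separates them. -/
lemma IsOrderedEigenbasis.topProj_eq {W W' : Matrix (Fin n) (Fin n) ℝ}
    (hW : IsOrderedEigenbasis A W) (hW' : IsOrderedEigenbasis A W') (hU : Uᵀ * U = 1)
    (hγ : 0 ≤ γ) (hL : ∀ j, L ≤ lam j) (hgap : 2 * t < γ * L)
    (hD : ∀ w : Fin n → ℝ, w ⬝ᵥ w = 1 →
      |w ⬝ᵥ A *ᵥ w - b - γ * (w ⬝ᵥ (U * diagonal lam * Uᵀ) *ᵥ w)| ≤ t) :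
    topProj W r = topProj W' r := by
  obtain ⟨hl, hA⟩ := hW.eq_mul_diagonal_mul
  obtain ⟨hl', hA'⟩ := hW'.eq_mul_diagonal_mul
  refine topProj_eq_of_gap hW.1 hW'.1 (hA.symm.trans hA') fun i j hi hj => ?_
  have h1 := le_eigenvalue_of_quadratic_close hW.1 hl hA hU hγ hL hD i hi
  have h2 := eigenvalue_le_of_quadratic_close hW.1 hl hA hD j hj
  have h3 := le_eigenvalue_of_quadratic_close hW'.1 hl' hA' hU hγ hL hD i hi
  have h4 := eigenvalue_le_of_quadratic_close hW'.1 hl' hA' hD j hj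
  exact ⟨ne_of_gt (by linarith), ne_of_lt (by linarith)⟩

end Deterministic

/-! ### The probability of failure. -/

section Bad

variable {n r m mt q : ℕ}

/-- The second-stage matrix compressed to some leading eigenspace of `Y`, or the second-stage
energy, is not `η ‖x‖²`-close to its mean. -/
def SecondStageFails (r : ℕ) (Y : Matrix (Fin n) (Fin n) ℝ) (x : EuclideanSpace ℝ (Fin n)) (η : ℝ)
    (z : Fin mt → EuclideanSpace ℝ (Fin n)) : Prop :=
  (∃ W : Matrix (Fin n) (Fin n) ℝ, IsOrderedEigenbasis Y W ∧ (η * ‖x‖ ^ 2) ^ 2 ≤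
      trace (topProj W r * newDeviation x z * topProj W r * newDeviation x z)) ∨
    η * ‖x‖ ^ 2 ≤ |(1 / (mt : ℝ)) * ∑ i, phaseless (z i) x - ‖x‖ ^ 2|

lemma measurableSet_secondStageFails (r : ℕ) (X : Matrix (Fin n) (Fin q) ℝ) (η : ℝ) :
    MeasurableSet {p : (Fin m × Fin q → EuclideanSpace ℝ (Fin n)) ×
      (Fin mt → EuclideanSpace ℝ (Fin n)) | ∃ k, column X k ≠ 0 ∧
        SecondStageFails r (truncatedMatrix (fun i k => p.1 (i, k))
          (fun i k => phaseless (p.1 (i, k)) (column X k))) (column X k) η p.2} := by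
  simp only [Set.ofPred_exists]
  refine MeasurableSet.iUnion fun k => ?_
  refine (MeasurableSet.const (column X k ≠ 0)).inter (MeasurableSet.union ?_ ?_)
  · set c := (η * ‖column X k‖ ^ 2) ^ 2
    let F : (Fin m × Fin q → EuclideanSpace ℝ (Fin n)) × (Fin mt → EuclideanSpace ℝ (Fin n)) →
        (Fin n → Fin n → ℝ) × (Fin n → Fin n → ℝ) := fun p =>
      (fun i j => truncatedMatrix (fun i k => p.1 (i, k))
        (fun i k => phaseless (p.1 (i, k)) (column X k)) i j,
        fun i j => newDeviation (column X k) p.2 i j)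
    have hF : Measurable F :=
      (measurable_pi_lambda _ fun i => measurable_pi_lambda _ fun j =>
        (measurable_truncatedMatrix_apply X i j).comp measurable_fst).prodMk
      (measurable_pi_lambda _ fun i => measurable_pi_lambda _ fun j =>
        (measurable_newDeviation_apply (column X k) i j).comp measurable_snd)
    let T : Set ((Fin n → Fin n → ℝ) × (Fin n → Fin n → ℝ)) :=
      {p : Matrix (Fin n) (Fin n) ℝ × Matrix (Fin n) (Fin n) ℝ |
        ∃ W : Matrix (Fin n) (Fin n) ℝ, IsOrderedEigenbasis p.1 W ∧
        c ≤ trace (topProj W r * p.2 * topProj W r * p.2)}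
    have hc : IsClosed T := isClosed_exists_isOrderedEigenbasis n r c
    have hT : MeasurableSet T := hc.measurableSet
    exact hF hT
  · have h : Measurable fun p : (Fin m × Fin q → EuclideanSpace ℝ (Fin n)) ×
        (Fin mt → EuclideanSpace ℝ (Fin n)) =>
        (1 / (mt : ℝ)) * ∑ i, phaseless (p.2 i) (column X k) - ‖column X k‖ ^ 2 :=
      ((Finset.measurable_sum _ fun i _ => (measurable_phaseless _).comp
        ((measurable_pi_apply i).comp measurable_snd)).const_mul _).sub_const _
    exact measurableSet_le (f := fun _ => η * ‖column X k‖ ^ 2) measurable_const h.abs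

/-- Under `hY` the existential over eigenbases concerns a single projection, so the bound for one
fixed `V` applies. -/
lemma measure_pi_secondStageFails_le (hmt : 0 < mt) (hr : 0 < r) (hrn : r ≤ n)
    {Y : Matrix (Fin n) (Fin n) ℝ}
    (hY : ∀ W W', IsOrderedEigenbasis Y W → IsOrderedEigenbasis Y W' → topProj W r = topProj W' r)
    {x : EuclideanSpace ℝ (Fin n)} (hx : x ≠ 0) {η : ℝ} (hη : 0 < η) (p : ℕ) :
    (Measure.pi fun _ : Fin mt => stdGaussian (EuclideanSpace ℝ (Fin n))).real
      {z | SecondStageFails r Y x η z} ≤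
      r ^ 2 * (momentConst (quarticMomentConst p) p / (mt * (η / r) ^ 2) ^ p) +
        momentConst (quarticMomentConst p) p / (mt * η ^ 2) ^ p := by
  refine (measureReal_union_le _ _).trans
    (add_le_add ?_ (measure_pi_abs_mean_phaseless_ge_le hmt hx hη p))
  have hK := momentConst_nonneg (quarticMomentConst_pos p).le p
  by_cases h : ∃ W, IsOrderedEigenbasis Y W
  · obtain ⟨W, hW⟩ := h
    let V : Matrix (Fin n) (Fin r) ℝ := W.submatrix id (Fin.castLE hrn)
    have hV : ∀ i j, V i j = W i (Fin.castLE hrn j) := fun _ _ => rfl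
    have hVV := transpose_mul_self_of_castLE hrn hW.1 hV
    refine (measureReal_mono ?_).trans (measure_pi_trace_newDeviation_ge_le hmt hr hVV hx hη p)
    rintro z ⟨W', hW', hz⟩
    rw [hY W' W hW' hW, ← mul_transpose_eq_topProj hrn hV] at hz
    exact hz
  · have : {z : Fin mt → EuclideanSpace ℝ (Fin n) | ∃ W : Matrix (Fin n) (Fin n) ℝ,
        IsOrderedEigenbasis Y W ∧ (η * ‖x‖ ^ 2) ^ 2 ≤
        trace (topProj W r * newDeviation x z * topProj W r * newDeviation x z)} = ∅ := by
      ext z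
      simp only [Set.mem_ofPred_eq, Set.mem_empty_iff_false, iff_false]
      rintro ⟨W, hW, -⟩
      exact h ⟨W, hW⟩
    refine ((congrArg (Measure.real _) this).trans measureReal_empty).trans_le ?_
    positivity

/-- The first-stage matrix is uniformly `t`-close to its mean in quadratic form. -/
def FirstStageClose (X : Matrix (Fin n) (Fin q) ℝ) (t : ℝ)
    (a : Fin m × Fin q → EuclideanSpace ℝ (Fin n)) : Prop :=
  ∀ w : EuclideanSpace ℝ (Fin n), ‖w‖ = 1 →
    |w.ofLp ⬝ᵥ (truncatedMatrix (fun i k => a (i, k))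
      (fun i k => phaseless (a (i, k)) (column X k))) *ᵥ w.ofLp -
      truncMoment 2 9 * meanSq X - (truncMoment 4 9 - truncMoment 2 9) *
      (w.ofLp ⬝ᵥ ((1 / (q : ℝ)) • (X * Xᵀ)) *ᵥ w.ofLp)| ≤ t

lemma FirstStageClose.quadratic_close {X : Matrix (Fin n) (Fin q) ℝ} {t : ℝ}
    {a : Fin m × Fin q → EuclideanSpace ℝ (Fin n)} (h : FirstStageClose X t a)
    {U : Matrix (Fin n) (Fin r) ℝ} {lam : Fin r → ℝ} (hE : IsReducedEVD X U lam) (w : Fin n → ℝ)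
    (hw : w ⬝ᵥ w = 1) :
    |w ⬝ᵥ (truncatedMatrix (fun i k => a (i, k))
      (fun i k => phaseless (a (i, k)) (column X k))) *ᵥ w -
      truncMoment 2 9 * meanSq X - (truncMoment 4 9 - truncMoment 2 9) *
      (w ⬝ᵥ (U * diagonal lam * Uᵀ) *ᵥ w)| ≤ t := by
  rw [← hE.2]
  refine h (WithLp.toLp 2 w) ?_
  rw [← pow_eq_one_iff_of_nonneg (norm_nonneg _) two_ne_zero, ← real_inner_self_eq_norm_sq,
    EuclideanSpace.inner_eq_star_dotProduct, star_trivial]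
  exact hw

lemma measure_failure_le (hmt : 0 < mt) (hm : 0 < m) (hq : 0 < q) (hr : 0 < r) (hrn : r ≤ n)
    {X : Matrix (Fin n) (Fin q) ℝ} {U : Matrix (Fin n) (Fin r) ℝ} {lam : Fin r → ℝ}
    (hE : IsReducedEVD X U lam) {L : ℝ} (hL : ∀ j, L ≤ lam j) {B s δ η t : ℝ} (hB : 0 < B)
    (hX : ∀ k, ‖column X k‖ ^ 2 ≤ B) (hs : 0 ≤ s) (hs1 : s ≤ 1) (hδ : 0 ≤ δ) (hδ1 : δ ≤ 1)
    (hη : 0 < η) (ht : 32 * (18 * B * s) + 2916 * δ * meanSq X ≤ t)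
    (hgap : 2 * t < (truncMoment 4 9 - truncMoment 2 9) * L) (p : ℕ) :
    ((Measure.pi fun _ => stdGaussian (EuclideanSpace ℝ (Fin n))).prod
      (Measure.pi fun _ => stdGaussian (EuclideanSpace ℝ (Fin n)))).real
      {w : (Fin m × Fin q → EuclideanSpace ℝ (Fin n)) × (Fin mt → EuclideanSpace ℝ (Fin n)) |
        ¬ FirstStageClose X t w.1 ∨ ∃ k, column X k ≠ 0 ∧
          SecondStageFails r (truncatedMatrix (fun i k => w.1 (i, k))
            (fun i k => phaseless (w.1 (i, k)) (column X k))) (column X k) η w.2} ≤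
      q * (2 * rexp (-(m * δ ^ 2 / (16 * expMomentConst)))) +
        2 * (5 ^ n * (2 * rexp (-(m * q * s ^ 2 / (16 * expMomentConst))))) +
        q * (r ^ 2 * (momentConst (quarticMomentConst p) p / (mt * (η / r) ^ 2) ^ p) +
          momentConst (quarticMomentConst p) p / (mt * η ^ 2) ^ p) := by
  have hK := momentConst_nonneg (quarticMomentConst_pos p).le p
  refine (measure_prod_union_le (B := {a | ¬ FirstStageClose X t a})
    (measurableSet_secondStageFails r X η) (fun a ha => ?_) (by positivity)).trans
    (add_le_add (?_ : _ ≤ _) le_rfl)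
  · simp only [Set.mem_ofPred_eq, not_not] at ha
    have hY := fun W W' hW hW' => IsOrderedEigenbasis.topProj_eq (W := W) (W' := W') hW hW' hE.1
      (by have := truncMoment_gap; linarith) hL hgap (ha.quadratic_close hE)
    set Y := truncatedMatrix (fun i k => a (i, k))
      (fun i k => phaseless (a (i, k)) (column X k)) with hYdef
    refine (measureReal_mono (s₂ := ⋃ k, {z | column X k ≠ 0 ∧
      SecondStageFails r Y (column X k) η z}) fun z hz => Set.mem_iUnion.2 hz).trans ?_
    refine (measureReal_iUnion_fintype_le _).trans ?_
    refine (Finset.sum_le_sum (g := fun _ => r ^ 2 * (momentConst (quarticMomentConst p) p /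
      (mt * (η / r) ^ 2) ^ p) + momentConst (quarticMomentConst p) p / (mt * η ^ 2) ^ p)
      fun k _ => ?_).trans (by simp [mul_add])
    by_cases hk : column X k = 0
    · simp only [hk, ne_eq, not_true_eq_false, false_and, Set.ofPred_false, measureReal_empty]
      positivity
    · simp only [hk, ne_eq, not_false_eq_true, true_and]
      exact measure_pi_secondStageFails_le hmt hr hrn hY hk hη p
  · refine (measureReal_mono fun a ha hc => ?_).trans
      (measure_truncatedMatrix_not_close_le hm hq X hB hX hs hs1 hδ hδ1)
    exact ha fun w hw => (hc w hw).trans ht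

end Bad

/-! ### Error bounds on the good event. -/

section Output

variable {n r m mt q : ℕ}

lemma IsOutput.error_bounds (hq : 0 < q)
    {X : Matrix (Fin n) (Fin q) ℝ} {U : Matrix (Fin n) (Fin r) ℝ} {lam : Fin r → ℝ}
    (hE : IsReducedEVD X U lam) {L : ℝ} (hL : ∀ j, L ≤ lam j) {η t τ : ℝ} (hη : 0 ≤ η)
    (hη1 : η ≤ 1) (ht0 : 0 < t) (hgap : t < (truncMoment 4 9 - truncMoment 2 9) * L)
    (hτ : t / ((truncMoment 4 9 - truncMoment 2 9) * L - t) ≤ τ)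
    {a : Fin m × Fin q → EuclideanSpace ℝ (Fin n)} {z : Fin mt → EuclideanSpace ℝ (Fin n)}
    (h1 : FirstStageClose X t a)
    (h2 : ¬ ∃ k, column X k ≠ 0 ∧ SecondStageFails r (truncatedMatrix (fun i k => a (i, k))
            (fun i k => phaseless (a (i, k)) (column X k))) (column X k) η z)
    {Uhat : Matrix (Fin n) (Fin r) ℝ} {Xhat : Matrix (Fin n) (Fin q) ℝ}
    (ho : IsOutput (fun i k => a (i, k)) (fun i k => phaseless (a (i, k)) (column X k))
      z (fun i k => phaseless (z i) (column X k)) Uhat Xhat) :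
    subspaceError Uhat U ≤ τ ∧ ∀ k, phaseDist (column X k) (column Xhat k) ^ 2 ≤
      (5 * η + 4 * τ ^ 2) * ‖column X k‖ ^ 2 := by
  obtain ⟨hU, hk⟩ := ho
  obtain ⟨hV, W, hW, hP⟩ := hU.exists_isOrderedEigenbasis
  obtain ⟨hl, hA⟩ := hW.eq_mul_diagonal_mul
  set γ := truncMoment 4 9 - truncMoment 2 9 with hγ
  have hτ0 : 0 ≤ τ := le_trans (div_nonneg ht0.le (by linarith)) hτ
  have hres (v : Fin r → ℝ) : (((1 - Uhat * Uhatᵀ) * U) *ᵥ v) ⬝ᵥ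
      (((1 - Uhat * Uhatᵀ) * U) *ᵥ v) ≤ τ ^ 2 * (v ⬝ᵥ v) := by
    rw [hP]
    refine (residual_sq_le_of_quadratic_close hW.1 hl hA hE.1
      (by have := truncMoment_gap; linarith) hL ht0 hgap (h1.quadratic_close hE) v).trans ?_
    refine mul_le_mul_of_nonneg_right ?_ (Finset.sum_nonneg fun i _ => mul_self_nonneg _)
    exact pow_le_pow_left₀ (div_nonneg ht0.le (by linarith)) hτ 2
  refine ⟨subspaceError_le hτ0 hres, fun k => ?_⟩
  obtain ⟨v, hv, hx⟩ := hk k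
  have hN2 (x : EuclideanSpace ℝ (Fin n)) : x.ofLp ⬝ᵥ x.ofLp = ‖x‖ ^ 2 := by
    rw [← real_inner_self_eq_norm_sq, EuclideanSpace.inner_eq_star_dotProduct, star_trivial]
  have hclose : trace (Uhat * Uhatᵀ * newDeviation (column X k) z * (Uhat * Uhatᵀ) *
        newDeviation (column X k) z) ≤ (η * ‖column X k‖ ^ 2) ^ 2 ∧
      |(1 / (mt : ℝ)) * ∑ i, phaseless (z i) (column X k) - ‖column X k‖ ^ 2| ≤
        η * ‖column X k‖ ^ 2 := by
    -- The failure event covers nonzero columns only. For a zero column both deviations vanish.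
    by_cases h0 : column X k = 0
    · have : newDeviation (column X k) z = 0 := by
        ext i j
        simp [newDeviation, h0, phaseless, outer]
      rw [this, h0]
      simp [phaseless]
    · by_contra hcon
      refine h2 ⟨k, h0, ?_⟩
      rw [not_and_or, not_le, not_le] at hcon
      rcases hcon with hc | hc
      · exact Or.inl ⟨W, hW, by rw [← hP]; exact hc.le⟩
      · exact Or.inr hc.le
  refine phaseDist_sq_le_of_close hV hη hη1 hclose.1 hclose.2 ?_ hv (s := τ ^ 2) (by exact hx)
  -- Since `x = U ξ` with `‖ξ‖ = ‖x‖`, the residual bound at `ξ` says that `Û` captures all but a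
  -- fraction `τ²` of the energy of `x`.
  set x := (column X k).ofLp with hxdef
  set ξ := Uᵀ *ᵥ x with hξ
  have hUξ : U *ᵥ ξ = x := by
    rw [hξ, mulVec_mulVec]
    ext i
    have h3 := congrFun (congrFun (hE.mul_transpose_mul hq) i) k
    rw [← Matrix.mul_assoc, mul_apply] at h3
    exact h3
  have hξξ : ξ ⬝ᵥ ξ = ‖column X k‖ ^ 2 := by
    rw [← mulVec_dotProduct_mulVec_of_transpose_mul_self hE.1, hUξ, hN2]
  have h4 := hres ξ
  rw [← mulVec_mulVec, hUξ, hξξ, sub_mulVec, one_mulVec, ← mulVec_mulVec, sub_dotProduct,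
    dotProduct_sub, dotProduct_sub, mulVec_dotProduct_mulVec_of_transpose_mul_self hV, hxdef,
    hN2] at h4
  have h5 : (Uhat *ᵥ (Uhatᵀ *ᵥ x)) ⬝ᵥ x = (Uhatᵀ *ᵥ x) ⬝ᵥ (Uhatᵀ *ᵥ x) := by
    rw [dotProduct_comm, dotProduct_mulVec, ← mulVec_transpose]
  rw [← hxdef, dotProduct_comm x, h5] at h4
  linarith

lemma normErr_le {X Xhat : Matrix (Fin n) (Fin q) ℝ} {c : ℝ} (hc : 0 ≤ c)
    (h : ∀ k, phaseDist (column X k) (column Xhat k) ^ 2 ≤ c * ‖column X k‖ ^ 2) :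
    normErr X Xhat ≤ c := by
  refine div_le_of_le_mul₀ (Finset.sum_nonneg fun k _ => sq_nonneg _) hc ?_
  rw [Finset.mul_sum]
  exact Finset.sum_le_sum fun k _ => h k

end Output

end LRPR

/-! ### Numerical bounds under the sample size conditions. -/

namespace LRPR
open MeasureTheory ProbabilityTheory Real Matrix

lemma exp_neg_mul_sq_le_inv_pow {n : ℕ} (hn : 0 < n) {C κ r L ε m : ℝ} (hC : 0 < C) (hκ : 0 < κ)
    (hr : 0 < r) (hL : 0 < L) (hε : 0 < ε)
    (hm : 4 * 34992 ^ 2 * 16 * C * κ ^ 2 * r ^ 4 * log n * L ^ 2 / ε ^ 2 ≤ m) :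
    rexp (-(m * (ε / (34992 * (κ * r ^ 2 * L))) ^ 2 / (16 * C))) ≤ 1 / (n : ℝ) ^ 4 := by
  have hn0 : (0 : ℝ) < n := by exact_mod_cast hn
  have h1 : 4 * log n ≤ m * (ε / (34992 * (κ * r ^ 2 * L))) ^ 2 / (16 * C) := by
    have h := mul_le_mul_of_nonneg_right hm
      (by positivity : 0 ≤ (ε / (34992 * (κ * r ^ 2 * L))) ^ 2 / (16 * C))
    rw [← mul_div_assoc, ← mul_div_assoc] at h
    refine le_trans (le_of_eq ?_) h
    field_simp
  have h2 : (1 : ℝ) / (n : ℝ) ^ 4 = rexp (-(4 * log n)) := by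
    rw [exp_neg, show 4 * log n = log ((n : ℝ) ^ 4) by rw [log_pow]; norm_num,
      exp_log (by positivity), one_div]
  rw [h2]
  exact exp_le_exp.2 (by linarith)

lemma five_pow_mul_exp_le {n : ℕ} {C κ ρ r L ε M : ℝ} (hC : 0 < C) (hκ : 0 < κ) (hρ : 0 < ρ)
    (hr : 0 < r) (hL : 0 < L) (hε : 0 < ε)
    (hM : 48 * 6912 ^ 2 * C * ρ ^ 2 * κ ^ 2 * n * r ^ 4 * L ^ 2 / ε ^ 2 ≤ M) :
    5 ^ n * rexp (-(M * (ε / (6912 * (ρ * κ * r ^ 2 * L))) ^ 2 / (16 * C))) ≤ rexp (-n) := by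
  have h1 : 3 * n ≤ M * (ε / (6912 * (ρ * κ * r ^ 2 * L))) ^ 2 / (16 * C) := by
    have h := mul_le_mul_of_nonneg_right hM
      (by positivity : 0 ≤ (ε / (6912 * (ρ * κ * r ^ 2 * L))) ^ 2 / (16 * C))
    rw [← mul_div_assoc, ← mul_div_assoc] at h
    refine le_trans (le_of_eq ?_) h
    field_simp
    ring
  have h5 : (5 : ℝ) ^ n ≤ rexp (2 * n) := by
    have : (5 : ℝ) ≤ rexp 2 := by
      have h := exp_one_gt_d9
      rw [show (2 : ℝ) = 1 + 1 by norm_num, exp_add]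
      nlinarith
    rw [mul_comm, exp_nat_mul]
    exact pow_le_pow_left₀ (by norm_num) this n
  calc _ ≤ rexp (2 * n) * rexp (-(3 * n)) :=
        mul_le_mul h5 (exp_le_exp.2 (by linarith)) (exp_pos _).le (exp_pos _).le
    _ = rexp (-n) := by rw [← exp_add]; ring_nf

/-- With exponent `p` the numerator is of order `r ^ (2 + 2p) ≲ n ^ ((2 + 2p) / 5)` and the
denominator at least of order `n ^ (p / 2)`. The quotient is of order `n⁻⁴` as soon as `p / 2 ≥ (2 +
2p) / 5 + 4`, and `p = 44` is the least such exponent. -/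
lemma moment_bound_le_inv_pow {n : ℕ} (hn : 0 < n) {K c₀ r ε N : ℝ} (hK : 0 ≤ K) (hc₀ : 0 < c₀)
    (hr : 0 < r) (hε : 0 < ε) (hrn : r ≤ c₀ * (n : ℝ) ^ ((1 : ℝ) / 5))
    (hN : (3 + K * (1 + c₀ ^ 90)) * sqrt n / ε ^ 2 ≤ N) :
    r ^ 2 * (K / (N * (ε / r) ^ 2) ^ 44) + K / (N * ε ^ 2) ^ 44 ≤ 1 / (n : ℝ) ^ 4 := by
  have hn0 : (0 : ℝ) < n := by exact_mod_cast hn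
  have hn1 : (1 : ℝ) ≤ n := by exact_mod_cast hn
  set c := 3 + K * (1 + c₀ ^ 90) with hc
  have hc1 : 1 ≤ c := by
    have : 0 ≤ K * (1 + c₀ ^ 90) := by positivity
    linarith
  have hNε : c * sqrt n ≤ N * ε ^ 2 := by
    rwa [div_le_iff₀ (by positivity)] at hN
  have hpow : c * (n : ℝ) ^ 22 ≤ (N * ε ^ 2) ^ 44 := by
    calc c * (n : ℝ) ^ 22 ≤ c ^ 44 * (n : ℝ) ^ 22 :=
          mul_le_mul_of_nonneg_right (le_self_pow₀ hc1 (by norm_num)) (by positivity)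
      _ = (c * sqrt n) ^ 44 := by
          rw [mul_pow, show (44 : ℕ) = 2 * 22 by norm_num, pow_mul (sqrt n), sq_sqrt hn0.le]
      _ ≤ _ := pow_le_pow_left₀ (by positivity) hNε 44
  have hr5 : r ^ 90 ≤ c₀ ^ 90 * (n : ℝ) ^ 18 := by
    calc r ^ 90 ≤ (c₀ * (n : ℝ) ^ ((1 : ℝ) / 5)) ^ 90 := pow_le_pow_left₀ hr.le hrn 90
      _ = c₀ ^ 90 * (n : ℝ) ^ 18 := by
          rw [mul_pow, ← rpow_natCast ((n : ℝ) ^ ((1 : ℝ) / 5)), ← rpow_mul hn0.le,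
            ← rpow_natCast (n : ℝ) 18]
          norm_num
  have h1 : r ^ 2 * (K / (N * (ε / r) ^ 2) ^ 44) = K * r ^ 90 / (N * ε ^ 2) ^ 44 := by
    have : N * (ε / r) ^ 2 = N * ε ^ 2 / r ^ 2 := by ring
    rw [this, div_pow, ← pow_mul, div_div_eq_mul_div]
    ring
  rw [h1, ← add_div, div_le_div_iff₀ (lt_of_lt_of_le (by positivity) hpow) (by positivity), one_mul]
  refine le_trans ?_ hpow
  have h2 : (1 : ℝ) ≤ (n : ℝ) ^ 18 := one_le_pow₀ hn1
  calc (K * r ^ 90 + K) * (n : ℝ) ^ 4 ≤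
        (K * (c₀ ^ 90 * (n : ℝ) ^ 18) + K * (n : ℝ) ^ 18) * (n : ℝ) ^ 4 := by
        gcongr
        exact le_mul_of_one_le_right hK h2
    _ = (K * (1 + c₀ ^ 90)) * (n : ℝ) ^ 22 := by ring
    _ ≤ c * (n : ℝ) ^ 22 := by
        gcongr
        linarith

lemma exp_neg_le_two_div_sq {x : ℝ} (hx : 0 < x) : rexp (-x) ≤ 2 / x ^ 2 := by
  have h := quadratic_le_exp_of_nonneg hx.le
  rw [exp_neg, inv_le_comm₀ (exp_pos _) (by positivity), inv_div]
  nlinarith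

end LRPR

/-! ### The theorem: choice of the constants and assembly. -/

open MeasureTheory LRPR in
theorem theorem1 :
    ∀ c₀ : ℝ, 0 < c₀ →
    ∃ c₁ c₂ c₃ c₄ c₅ c₆ : ℝ, 0 < c₁ ∧ 0 < c₂ ∧ 0 < c₃ ∧ 0 < c₄ ∧ 0 < c₅ ∧ 0 < c₆ ∧
    ∀ c₇ : ℝ, 0 < c₇ → ∃ c₈ : ℝ, 0 < c₈ ∧
    ∀ (n q r m mt : ℕ) (X : Matrix (Fin n) (Fin q) ℝ), 1 ≤ r → X.rank = r →
    ∀ (U : Matrix (Fin n) (Fin r) ℝ) (lam : Fin r → ℝ), IsReducedEVD X U lam →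
    ∀ ε : ℝ, 0 < ε → ε < 1 →
      (r : ℝ) ≤ c₀ * (n : ℝ) ^ ((1 : ℝ) / 5) →
      c₁ * Real.sqrt n / ε ^ 2 ≤ (mt : ℝ) →
      c₂ * conditionNumber lam ^ 2 * (r : ℝ) ^ 4 * Real.log n * Real.log mt ^ 2 / ε ^ 2 ≤ (m : ℝ) →
      c₃ * rho X ^ 2 * conditionNumber lam ^ 2 * (n : ℝ) * (r : ℝ) ^ 4 * Real.log mt ^ 2 / ε ^ 2
        ≤ (m : ℝ) * (q : ℝ) →
    ∀ {Ω : Type*} [MeasurableSpace Ω] (P : Measure Ω) [IsProbabilityMeasure P]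
      (a : Fin m → Fin q → Ω → EuclideanSpace ℝ (Fin n))
      (anew : Fin mt → Ω → EuclideanSpace ℝ (Fin n)),
      MeasurementModel P a anew →
    ∃ E : Set Ω, MeasurableSet E ∧
      1 - 4 * Real.exp (-c₄ * n) - 32 * (q : ℝ) / (n : ℝ) ^ 4 ≤ P.real E ∧
      ((q : ℝ) ≤ c₇ * (n : ℝ) ^ 2 → 1 - c₈ / (n : ℝ) ^ 2 ≤ P.real E) ∧
      ∀ ω ∈ E, ∀ (Uhat : Matrix (Fin n) (Fin r) ℝ) (Xhat : Matrix (Fin n) (Fin q) ℝ),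
        IsOutput (fun i k => a i k ω) (fun i k => phaseless (a i k ω) (column X k))
          (fun i => anew i ω) (fun i k => phaseless (anew i ω) (column X k)) Uhat Xhat →
        subspaceError Uhat U ≤ c₅ * ε / (r * Real.log mt) ∧
        (∀ k, phaseDist (column X k) (column Xhat k) ^ 2 ≤ c₆ * ε * ‖column X k‖ ^ 2) ∧
        normErr X Xhat ≤ c₆ * ε := by
  intro c₀ hc₀
  set C := expMomentConst with hC
  have hC1 : 1 ≤ C := one_le_expMomentConst
  obtain ⟨K, hKdef⟩ : ∃ K, K = momentConst (quarticMomentConst 44) 44 := ⟨_, rfl⟩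
  have hK : 0 ≤ K := hKdef ▸ momentConst_nonneg (quarticMomentConst_pos 44).le 44
  -- In `c₁`, the `3` forces `m̃ ≥ 3 > e`, so that `log m̃ ≥ 1`, and the other summand serves the
  -- moment bound. `c₂` makes the exponent of the energy bound at least `4 log n`, `c₃` makes that
  -- of the net bound at least `3 n`, and `c₆ = 9` comes from `5 ε + 4 ε²`.
  refine ⟨3 + K * (1 + c₀ ^ 90), 4 * 34992 ^ 2 * 16 * C, 48 * 6912 ^ 2 * C, 1, 1, 9,
    by positivity, by positivity, by positivity, one_pos, one_pos, by norm_num, ?_⟩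
  intro c₇ hc₇
  refine ⟨8 + 32 * c₇, by positivity, ?_⟩
  intro n q r m mt X hr1 hX U lam hE ε hε hε1 hrn hmt hm hmq Ω _ P _ a anew hmodel
  have hr : 0 < r := hr1
  have hrn' : r ≤ n := by
    have := X.rank_le_card_height
    rwa [hX, Fintype.card_fin] at this
  have hq : 0 < q := by
    have := X.rank_le_card_width
    rw [hX, Fintype.card_fin] at this
    omega
  have hn : 0 < n := by omega
  have hn0 : (0 : ℝ) < n := by exact_mod_cast hn
  have hn1 : (1 : ℝ) ≤ n := by exact_mod_cast hn
  have hr0 : (0 : ℝ) < r := by exact_mod_cast hr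
  have hr1' : (1 : ℝ) ≤ r := by exact_mod_cast hr1
  have hq0 : (0 : ℝ) < q := by exact_mod_cast hq
  have hlam := hE.pos hq hX
  set κ := conditionNumber lam with hκdef
  set l := minEigenvalue lam with hldef
  have hl0 : 0 < l := minEigenvalue_pos hr hlam
  have hκ1 : 1 ≤ κ := one_le_conditionNumber hr hlam
  have hS := hE.meanSq_le hr hlam
  have hS0 := hE.meanSq_pos hr hlam
  have hρ1 : 1 ≤ rho X := one_le_rho hq hS0
  set ρ := rho X with hρdef
  have hmt3 : (3 : ℝ) ≤ mt := by
    refine le_trans ?_ hmt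
    rw [le_div_iff₀ (by positivity)]
    have h1 : 1 ≤ Real.sqrt n := Real.one_le_sqrt.2 hn1
    have h2 : 0 ≤ K * (1 + c₀ ^ 90) := by positivity
    have h3 : ε ^ 2 ≤ 1 := pow_le_one₀ hε.le hε1.le
    calc 3 * ε ^ 2 ≤ 3 + K * (1 + c₀ ^ 90) := by linarith
      _ ≤ _ := le_mul_of_one_le_right (by positivity) h1
  have hmt0 : 0 < mt := by
    have : (0 : ℝ) < mt := by linarith
    exact_mod_cast this
  set L := Real.log mt with hLdef
  have hL1 : 1 ≤ L := by
    rw [hLdef, Real.le_log_iff_exp_le (by linarith)]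
    linarith [Real.exp_one_lt_d9]
  have hm0 : 0 < m := by
    refine Nat.pos_of_ne_zero fun h0 => ?_
    rw [h0, Nat.cast_zero, zero_mul] at hmq
    refine absurd hmq (not_le.2 ?_)
    positivity
  set γ := truncMoment 4 9 - truncMoment 2 9 with hγdef
  have hγ : 1 / 3 ≤ γ := truncMoment_gap
  -- As `γ l ≥ l / 3` and `t ≤ l / 6`, the gap `γ l - t` is at least `l / 6`, and `t / (l / 6)` is
  -- the required subspace error.
  set t := l * ε / (6 * r * L) with ht
  have hrL : 1 ≤ r * L := one_le_mul_of_one_le_of_one_le hr1' hL1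
  have ht0 : 0 < t := by positivity
  have htl : t ≤ l * ε / 6 := by
    rw [ht, mul_assoc]
    exact div_le_div_of_nonneg_left (by positivity) (by norm_num) (by linarith)
  have hlε : l * ε < l := mul_lt_of_lt_one_right hl0 hε1
  have hγl : 1 / 3 * l ≤ γ * l := mul_le_mul_of_nonneg_right hγ hl0.le
  have hgap : 2 * t < γ * l := by linarith
  have hτ : t / (γ * l - t) ≤ ε / (r * L) := by
    have h1 : l / 6 ≤ γ * l - t := by linarith
    calc t / (γ * l - t) ≤ t / (l / 6) := div_le_div_of_nonneg_left ht0.le (by positivity) h1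
      _ = ε / (r * L) := by rw [ht]; field_simp
  -- The constants `34992 = 12 · 2916` and `6912 = 12 · 32 · 18` make each of the two parts of the
  -- first-stage error at most `t / 2`, once `meanSq X` is replaced by its bound `r κ l`.
  set δ := ε / (34992 * (κ * r ^ 2 * L)) with hδ
  set s := ε / (6912 * (ρ * κ * r ^ 2 * L)) with hs
  have hr2 : (1 : ℝ) ≤ (r : ℝ) ^ 2 := one_le_pow₀ hr1'
  have hκrL : 1 ≤ κ * r ^ 2 * L := one_le_mul_of_one_le_of_one_le
    (one_le_mul_of_one_le_of_one_le hκ1 hr2) hL1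
  have hδ1 : δ ≤ 1 := by
    rw [hδ, div_le_one (by positivity)]
    linarith
  have hs1 : s ≤ 1 := by
    have : 1 ≤ ρ * κ * r ^ 2 * L := one_le_mul_of_one_le_of_one_le
      (one_le_mul_of_one_le_of_one_le (one_le_mul_of_one_le_of_one_le hρ1 hκ1) hr2) hL1
    rw [hs, div_le_one (by positivity)]
    linarith
  have hB : ∀ k, ‖column X k‖ ^ 2 ≤ ρ * (r * (κ * l)) := fun k =>
    (le_rho_mul_meanSq hS0 k).trans (mul_le_mul_of_nonneg_left hS (by linarith))
  have htt : 32 * (18 * (ρ * (r * (κ * l))) * s) + 2916 * δ * meanSq X ≤ t := by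
    have h1 : 2916 * δ * meanSq X ≤ 2916 * δ * (r * (κ * l)) :=
      mul_le_mul_of_nonneg_left hS (by positivity)
    have h2 : 2916 * δ * (r * (κ * l)) = t / 2 := by
      rw [hδ, ht]; field_simp; norm_num
    have h3 : 32 * (18 * (ρ * (r * (κ * l))) * s) = t / 2 := by
      rw [hs, ht]; field_simp; norm_num
    linarith
  have hbad := measure_failure_le hmt0 hm0 hq hr hrn' hE (minEigenvalue_le lam)
    (by positivity) hB (by positivity) hs1 (by positivity) hδ1 hε htt hgap 44
  rw [← hKdef] at hbad
  obtain ⟨E, hEm, hEP, hEω⟩ := hmodel.exists_event_compl_le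
    {w | ¬ FirstStageClose X t w.1 ∨ ∃ k, column X k ≠ 0 ∧
      SecondStageFails r (truncatedMatrix (fun i k => w.1 (i, k))
        (fun i k => phaseless (w.1 (i, k)) (column X k))) (column X k) ε w.2}
  have hprob : 1 - 4 * Real.exp (-1 * n) - 32 * (q : ℝ) / (n : ℝ) ^ 4 ≤ P.real E := by
    have h1 := exp_neg_mul_sq_le_inv_pow hn (by positivity : 0 < C) (by positivity : 0 < κ) hr0
      (by positivity : 0 < L) hε hm
    have h2 := five_pow_mul_exp_le (n := n) (by positivity : 0 < C) (by positivity : 0 < κ)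
      (by positivity : 0 < ρ) hr0 (by positivity : 0 < L) hε hmq
    have h3 := moment_bound_le_inv_pow hn hK hc₀ hr0 hε hrn hmt
    have h4 := mul_le_mul_of_nonneg_left h1 hq0.le
    have h5 := mul_le_mul_of_nonneg_left h3 hq0.le
    rw [neg_one_mul]
    have h6 : 32 * (q : ℝ) / (n : ℝ) ^ 4 = 32 * (q * (1 / (n : ℝ) ^ 4)) := by ring
    -- The three failure bounds add up to `4 exp (-n) + 3 q / n⁴`; the surplus up to `32 q / n⁴` is
    -- dropped by positivity.
    have h7 : 0 ≤ (q : ℝ) * (1 / (n : ℝ) ^ 4) := by positivity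
    rw [h6]
    linarith
  refine ⟨E, hEm, hprob, fun hqn => ?_, fun ω hω Uhat Xhat ho => ?_⟩
  · refine le_trans ?_ hprob
    have h1 := exp_neg_le_two_div_sq hn0
    have h2 : 32 * (q : ℝ) / (n : ℝ) ^ 4 ≤ 32 * c₇ / (n : ℝ) ^ 2 := by
      rw [div_le_div_iff₀ (by positivity) (by positivity)]
      calc 32 * (q : ℝ) * (n : ℝ) ^ 2 ≤ 32 * (c₇ * (n : ℝ) ^ 2) * (n : ℝ) ^ 2 := by gcongr
        _ = _ := by ring
    have h3 : (8 + 32 * c₇) / (n : ℝ) ^ 2 = 4 * (2 / (n : ℝ) ^ 2) + 32 * c₇ / (n : ℝ) ^ 2 := by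
      ring
    rw [neg_one_mul, h3]
    linarith
  · have hgood := hEω ω hω
    obtain ⟨hg1, hg2⟩ := not_or.1 hgood
    obtain ⟨h1, h2⟩ := IsOutput.error_bounds hq hE (minEigenvalue_le lam) hε.le hε1.le ht0
      (by linarith) hτ (not_not.1 hg1) hg2 ho
    have h3 : ∀ k, phaseDist (column X k) (column Xhat k) ^ 2 ≤ 9 * ε * ‖column X k‖ ^ 2 := by
      intro k
      refine (h2 k).trans (mul_le_mul_of_nonneg_right ?_ (sq_nonneg _))
      have h4 : ε / (r * L) ≤ ε := div_le_self hε.le hrL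
      have h5 : (ε / (r * L)) ^ 2 ≤ ε ^ 2 := pow_le_pow_left₀ (by positivity) h4 2
      have h6 : ε ^ 2 ≤ ε := pow_le_of_le_one hε.le hε1.le two_ne_zero
      linarith
    refine ⟨by rwa [one_mul], h3, normErr_le (by positivity) h3⟩
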